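/- Let $\Bbbk$ be a field of characteristic $0$. An associative conformal algebra over $\Bbbk$ is a $\Bbbk[\partial]$-module $C$ with bilinear products $(a,b)\mapsto a_{(n)}b$, $n\ge 0$, such that $a_{(n)}b=0$ for all sufficiently large $n$, $(\partial a)_{(n)}b=-n\,a_{(n-1)}b$, $a_{(n)}\partial b=\partial(a_{(n)}b)+n\,a_{(n-1)}b$, and $(a_{(n)}b)_{(m)}c=\sum_{s=0}^{n}(-1)^s\binom ns a_{(n-s)}(b_{(m+s)}c)$. Write $\{a_{(n)}b\}=\sum_{s\ge0}\frac{(-1)^{n+s}}{s!}\partial^s(a_{(n+s)}b)$ and $[a_{(n)}b]=a_{(n)}b-\{b_{(n)}a\}$; $C$ is commutative if $a_{(n)}b=\{b_{(n)}a\}$ for all $a,b\in C$, $n\ge0$. For a set $Y$, let $\mathrm{ComConf}(Y,N=3)$ be the free commutative (associative) conformal algebra generated by $Y$ subject to the locality $x_{(n)}y=0$ for $x,y\in Y$, $n\ge 3$. In a conformal algebra containing (the image of) $Y$ write $L_n^x v=x_{(n)}v$ for $x\in Y$. Let $Y$ be a linearly ordered set. Then the following monomials, over all $x_i,y_i,y,z,u\in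 Y$ (formally different monomials being different elements), form a linear basis of $\mathrm{ComConf}(Y,N=3)$: 1. $L_0^{x_1}\cdots L_0^{x_n}L_1^{y_1}\cdots L_1^{y_m}L_2^z u$ with $n,m\ge0$, $x_1\le\dots\le x_n$, $y_1\le\dots\le y_m\le z\le u$; 2. $L_0^{x_1}\cdots L_0^{x_n}L_1^{y_1}\cdots L_1^{y_m}\partial^s z$ with $n,m\ge0$, $s\ge1$, $x_1\le\dots\le x_n$, $y_1\le\dots\le y_m\le z$; 3. $L_0^{x_1}\cdots L_0^{x_n}L_1^{y_1}\cdots L_1^{y_m} z$ with $n\ge0$, $m=0$ or $m\ge2$, $x_1\le\dots\le x_n$, $y_1\le\dots\le y_m\le z$; 4. $L_0^{x_1}\cdots L_0^{x_n}L_1^{y} z$ with $n\ge0$, $x_1\le\dots\le x_n$, and $x_n\le y$ or $y\le z$ (no condition on $y,z$ if $n=0$). Moreover, let $\mathfrak g$ be a Lie algebra over $\Bbbk$ with a symmetric invariant bilinear form $\langle\cdot|\cdot\rangle$ (that is, $\langle[a,b]|c\rangle=\langle a|[b,c]\rangle$), and let $X_1$ be a linear basis of $\mathfrak g$ which is linearly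 ordered. Let $K(\mathfrak g)=(\Bbbk[\partial]\otimes\mathfrak g)\oplus\Bbbk e$ be the Lie conformal algebra with $\partial e=0$, $e$ central, and $[a_{(0)}b]=[a,b]$, $[a_{(1)}b]=\langle a|b\rangle e$, $[a_{(n)}b]=0$ $(n\ge2)$ for $a,b\in\mathfrak g$. Let $U=U(K(\mathfrak g);X,N=3)$, $X=X_1\cup\{e\}$, be its universal associative conformal envelope, i.e. the associative conformal algebra generated by $X$ that is universal among associative conformal algebras $A$ equipped with a homomorphism $\varphi$ of Lie conformal algebras from $K(\mathfrak g)$ to $A$ with the commutator operations $[a_{(n)}b]$ such that $\varphi(x)_{(n)}\varphi(y)=0$ for all $x,y\in X$, $n\ge3$. Then the monomials 1–4 with $Y=X_1$, together with $e$, form a linear basis of $U$. -/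

import Mathlib

namespace ConformalAlg

/-! ### Conformal algebras through their `n`-products -/

/-- The operations of a conformal algebra: the derivation `∂` and the bilinear `n`-products
`a ₍ₙ₎ b`, `n ≥ 0`; the `λ`-product is `a ₍λ₎ b = ∑ₙ (λⁿ / n!) (a ₍ₙ₎ b)`. -/
class Ops (k : Type*) (C : Type*) [Field k] [AddCommGroup C] [Module k C] where
  /-- the operator `∂` -/
  D : C →ₗ[k] C
  /-- the `n`-product -/
  prod : ℕ → C →ₗ[k] C →ₗ[k] C

section Basic

variable (k : Type*) {C : Type*} [Field k] [AddCommGroup C] [Module k C] [Ops k C]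

/-- The operator `∂`. -/
abbrev del : C →ₗ[k] C := Ops.D

/-- The `n`-product `a ₍ₙ₎ b`. -/
abbrev nprod (n : ℕ) (a b : C) : C := Ops.prod (k := k) n a b

/-- `N(a, b) ≤ N`, i.e. `a ₍ₙ₎ b = 0` for all `n ≥ N`. -/
def LocalAt (N : ℕ) (a b : C) : Prop := ∀ n, N ≤ n → nprod k n a b = 0

/-- The reversed `n`-product `{a ₍ₙ₎ b} = ∑_{s ≥ 0} (-1)^(n+s) ∂^s/s! (a ₍ₙ₊ₛ₎ b)`, the
coefficient at `λⁿ / n!` of `a ₍-∂-λ₎ b` (a finite sum as soon as `a`, `b` are local). -/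
noncomputable def rev (n : ℕ) (a b : C) : C :=
  ∑ᶠ s : ℕ, ((-1 : k) ^ (n + s) / (s.factorial : k)) •
    ((del k : Module.End k C) ^ s) (nprod k (n + s) a b)

/-- The commutator `[a ₍ₙ₎ b] = a ₍ₙ₎ b - {b ₍ₙ₎ a}`. -/
noncomputable def comm (n : ℕ) (a b : C) : C := nprod k n a b - rev k n b a

end Basic

section Classes

variable (k : Type*) (C : Type*) [Field k] [AddCommGroup C] [Module k C] [Ops k C]

/-- Conformal algebra: locality and sesquilinearity of the `n`-products. -/
class IsConformal : Prop where
  exists_local : ∀ a b : C, ∃ N, LocalAt k N a b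
  del_left : ∀ (n : ℕ) (a b : C), nprod k n (del k a) b = -((n : k) • nprod k (n - 1) a b)
  del_right : ∀ (n : ℕ) (a b : C),
    nprod k n a (del k b) = del k (nprod k n a b) + (n : k) • nprod k (n - 1) a b

/-- Associativity: `(a ₍λ₎ b) ₍λ+μ₎ c = a ₍λ₎ (b ₍μ₎ c)`, written in terms of `n`-products. -/
class IsAssoc : Prop where
  assoc : ∀ (n m : ℕ) (a b c : C), nprod k m (nprod k n a b) c =
    ∑ s ∈ Finset.range (n + 1),
      ((-1 : k) ^ s * (n.choose s : k)) • nprod k (n - s) a (nprod k (m + s) b c)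

/-- Commutativity: `a ₍λ₎ b = b ₍-∂-λ₎ a`. -/
class IsComm : Prop where
  comm : ∀ (n : ℕ) (a b : C), nprod k n a b = rev k n b a

/-- The Lie identities: `a ₍λ₎ b = - b ₍-∂-λ₎ a` and
`a ₍λ₎ (b ₍μ₎ c) - b ₍μ₎ (a ₍λ₎ c) = (a ₍λ₎ b) ₍λ+μ₎ c`. -/
class IsLie : Prop where
  skew : ∀ (n : ℕ) (a b : C), nprod k n a b = -rev k n b a
  jacobi : ∀ (n m : ℕ) (a b c : C),
    nprod k n a (nprod k m b c) - nprod k m b (nprod k n a c) =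
      ∑ s ∈ Finset.range (n + 1),
        (n.choose s : k) • nprod k (n + m - s) (nprod k s a b) c

end Classes

section Hom

variable {k : Type*} {C C' : Type*} [Field k] [AddCommGroup C] [Module k C] [Ops k C]
  [AddCommGroup C'] [Module k C'] [Ops k C']

/-- Homomorphisms of conformal algebras. -/
structure IsHom (f : C →ₗ[k] C') : Prop where
  map_del : ∀ a, f (del k a) = del k (f a)
  map_nprod : ∀ n a b, f (nprod k n a b) = nprod k n (f a) (f b)

/-- Homomorphisms from a Lie conformal algebra `C` to the commutator algebra `C'⁽⁻⁾` of an
associative conformal algebra `C'`. -/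
structure IsLieHom (f : C →ₗ[k] C') : Prop where
  map_del : ∀ a, f (del k a) = del k (f a)
  map_nprod : ∀ n a b, f (nprod k n a b) = comm k n (f a) (f b)

theorem IsHom.comp {C'' : Type*} [AddCommGroup C''] [Module k C''] [Ops k C'']
    {f : C →ₗ[k] C'} {h : C' →ₗ[k] C''} (hh : IsHom h) (hf : IsHom f) : IsHom (h ∘ₗ f) where
  map_del a := by rw [LinearMap.comp_apply, hf.map_del, hh.map_del, LinearMap.comp_apply]
  map_nprod n a b := by
    rw [LinearMap.comp_apply, hf.map_nprod, hh.map_nprod, LinearMap.comp_apply,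
      LinearMap.comp_apply]

theorem rev_eq_sum {N : ℕ} {a b : C} (h : LocalAt k N a b) (n : ℕ) :
    rev k n a b = ∑ s ∈ Finset.range N, ((-1 : k) ^ (n + s) / (s.factorial : k)) •
      ((del k : Module.End k C) ^ s) (nprod k (n + s) a b) := by
  refine finsum_eq_sum_of_support_subset _ ?_
  intro s hs
  by_contra hlt
  simp only [Finset.coe_range, Set.mem_Iio, not_lt] at hlt
  refine hs ?_
  simp only
  rw [h (n + s) (by omega), map_zero, smul_zero]

theorem IsHom.map_del_pow {f : C →ₗ[k] C'} (hf : IsHom f) (s : ℕ) (a : C) :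
    f (((del k : Module.End k C) ^ s) a) = ((del k : Module.End k C') ^ s) (f a) := by
  induction s with
  | zero => simp
  | succ s ih => rw [pow_succ', pow_succ', Module.End.mul_apply, Module.End.mul_apply,
      hf.map_del, ih]

theorem IsHom.map_local {f : C →ₗ[k] C'} (hf : IsHom f) {N : ℕ} {a b : C}
    (h : LocalAt k N a b) : LocalAt k N (f a) (f b) := by
  intro n hn
  rw [← hf.map_nprod, h n hn, map_zero]

theorem IsHom.map_rev [IsConformal k C] {f : C →ₗ[k] C'} (hf : IsHom f) (n : ℕ) (a b : C) :
    f (rev k n a b) = rev k n (f a) (f b) := by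
  obtain ⟨N, hN⟩ := IsConformal.exists_local (k := k) a b
  rw [rev_eq_sum hN, rev_eq_sum (hf.map_local hN), map_sum]
  refine Finset.sum_congr rfl fun s _ => ?_
  rw [map_smul, hf.map_del_pow, hf.map_nprod]

theorem IsHom.map_comm [IsConformal k C] {f : C →ₗ[k] C'} (hf : IsHom f) (n : ℕ) (a b : C) :
    f (comm k n a b) = comm k n (f a) (f b) := by
  simp only [comm, map_sub, hf.map_nprod, hf.map_rev]

theorem IsHom.isConformal [IsConformal k C] {f : C →ₗ[k] C'} (hf : IsHom f)
    (hs : Function.Surjective f) : IsConformal k C' where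
  exists_local a b := by
    obtain ⟨a, rfl⟩ := hs a
    obtain ⟨b, rfl⟩ := hs b
    obtain ⟨N, hN⟩ := IsConformal.exists_local (k := k) a b
    exact ⟨N, hf.map_local hN⟩
  del_left n a b := by
    obtain ⟨a, rfl⟩ := hs a
    obtain ⟨b, rfl⟩ := hs b
    rw [← hf.map_del, ← hf.map_nprod, ← hf.map_nprod, IsConformal.del_left, map_neg, map_smul]
  del_right n a b := by
    obtain ⟨a, rfl⟩ := hs a
    obtain ⟨b, rfl⟩ := hs b
    rw [← hf.map_del, ← hf.map_nprod, ← hf.map_nprod, ← hf.map_nprod, IsConformal.del_right,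
      map_add, map_smul, hf.map_del]

theorem IsHom.isAssoc [IsAssoc k C] {f : C →ₗ[k] C'} (hf : IsHom f)
    (hs : Function.Surjective f) : IsAssoc k C' where
  assoc n m a b c := by
    obtain ⟨a, rfl⟩ := hs a
    obtain ⟨b, rfl⟩ := hs b
    obtain ⟨c, rfl⟩ := hs c
    simp only [← hf.map_nprod, IsAssoc.assoc, map_sum, map_smul]

end Hom

/-! ### Ideals and quotients -/

section Ideal

variable (k : Type*) {C : Type*} [Field k] [AddCommGroup C] [Module k C] [Ops k C]

/-- Two-sided ideals: `k`-submodules stable under `∂` and all left and right `n`-products. -/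
structure IsIdeal (I : Submodule k C) : Prop where
  del_mem : ∀ a ∈ I, del k a ∈ I
  left_mem : ∀ n a, ∀ b ∈ I, nprod k n a b ∈ I
  right_mem : ∀ n, ∀ a ∈ I, ∀ b, nprod k n a b ∈ I

/-- The ideal generated by a set. -/
def idealSpan (S : Set C) : Submodule k C := sInf {I | IsIdeal k I ∧ S ⊆ I}

theorem subset_idealSpan (S : Set C) : S ⊆ idealSpan k S := by
  intro x hx
  simp only [idealSpan, SetLike.mem_coe, Submodule.mem_sInf, Set.mem_ofPred_eq]
  exact fun I hI => hI.2 hx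

theorem idealSpan_le {S : Set C} {I : Submodule k C} (hI : IsIdeal k I) (hS : S ⊆ I) :
    idealSpan k S ≤ I := sInf_le ⟨hI, hS⟩

theorem isIdeal_idealSpan (S : Set C) : IsIdeal k (idealSpan k S) where
  del_mem a ha := by
    simp only [idealSpan, Submodule.mem_sInf, Set.mem_ofPred_eq] at ha ⊢
    exact fun I hI => hI.1.del_mem a (ha I hI)
  left_mem n a b hb := by
    simp only [idealSpan, Submodule.mem_sInf, Set.mem_ofPred_eq] at hb ⊢
    exact fun I hI => hI.1.left_mem n a b (hb I hI)
  right_mem n a ha b := by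
    simp only [idealSpan, Submodule.mem_sInf, Set.mem_ofPred_eq] at ha ⊢
    exact fun I hI => hI.1.right_mem n a (ha I hI) b

/-- The operations on the quotient by the ideal generated by `S`, induced from `C`. -/
noncomputable instance quotientOps (S : Set C) : Ops k (C ⧸ idealSpan k S) where
  D := (idealSpan k S).mapQ (idealSpan k S) (del k)
    fun a ha => (isIdeal_idealSpan k S).del_mem a ha
  prod n := (idealSpan k S).liftQ
    (LinearMap.mk₂ k (fun a => (idealSpan k S).mapQ (idealSpan k S) (Ops.prod n a)
        fun b hb => (isIdeal_idealSpan k S).left_mem n a b hb)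
      (fun a a' y => by
        obtain ⟨b, rfl⟩ := Submodule.Quotient.mk_surjective _ y
        simp [Submodule.mapQ_apply])
      (fun c a y => by
        obtain ⟨b, rfl⟩ := Submodule.Quotient.mk_surjective _ y
        simp [Submodule.mapQ_apply])
      (fun a y y' => map_add _ y y')
      (fun c a y => map_smul _ c y))
    (fun a ha => by
      rw [LinearMap.mem_ker]
      ext b
      simpa using (isIdeal_idealSpan k S).right_mem n a ha b)

theorem isHom_mkQ (S : Set C) : IsHom (idealSpan k S).mkQ where
  map_del _ := rfl
  map_nprod _ _ _ := rfl

/-- Homomorphisms that vanish on `S` factor through the quotient. -/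
theorem exists_lift {C' : Type*} [AddCommGroup C'] [Module k C'] [Ops k C']
    {S : Set C} {f : C →ₗ[k] C'} (hf : IsHom f) (h : ∀ x ∈ S, f x = 0) :
    ∃ g : (C ⧸ idealSpan k S) →ₗ[k] C', IsHom g ∧ ∀ x, g ((idealSpan k S).mkQ x) = f x := by
  have hI : IsIdeal k (LinearMap.ker f) :=
    { del_mem := fun a ha => by rw [LinearMap.mem_ker] at *; rw [hf.map_del, ha, map_zero]
      left_mem := fun n a b hb => by
        rw [LinearMap.mem_ker] at *; rw [hf.map_nprod, hb, nprod, map_zero]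
      right_mem := fun n a ha b => by
        rw [LinearMap.mem_ker] at *
        rw [hf.map_nprod, ha, nprod, map_zero, LinearMap.zero_apply] }
  refine ⟨(idealSpan k S).liftQ f (idealSpan_le k hI h), ⟨?_, ?_⟩, fun x => by simp⟩
  · intro a
    obtain ⟨a, rfl⟩ := Submodule.mkQ_surjective _ a
    rw [← (isHom_mkQ k S).map_del]
    simp [hf.map_del]
  · intro n a b
    obtain ⟨a, rfl⟩ := Submodule.mkQ_surjective _ a
    obtain ⟨b, rfl⟩ := Submodule.mkQ_surjective _ b
    rw [← (isHom_mkQ k S).map_nprod]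
    simp [hf.map_nprod]

instance quotient_isConformal [IsConformal k C] (S : Set C) :
    IsConformal k (C ⧸ idealSpan k S) :=
  (isHom_mkQ k S).isConformal (Submodule.mkQ_surjective _)

instance quotient_isAssoc [IsAssoc k C] (S : Set C) : IsAssoc k (C ⧸ idealSpan k S) :=
  (isHom_mkQ k S).isAssoc (Submodule.mkQ_surjective _)

end Ideal

/-! ### Free associative conformal algebras -/

/-- Nonassociative conformal words in the alphabet `X`. -/
inductive Word (X : Type*) where
  | gen : X → Word X
  | del : Word X → Word X
  | prod : ℕ → Word X → Word X → Word X

section Free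

variable (k : Type*) (X : Type*) [Field k]

/-- The operations on the space spanned by all conformal words. -/
noncomputable instance wordOps : Ops k (Word X →₀ k) where
  D := Finsupp.lmapDomain k k Word.del
  prod n := Finsupp.linearCombination k fun u => Finsupp.lmapDomain k k (Word.prod n u)

variable {X}

theorem del_single (u : Word X) (c : k) :
    del k (Finsupp.single u c) = Finsupp.single (Word.del u) c :=
  Finsupp.mapDomain_single

theorem nprod_single (n : ℕ) (u v : Word X) (c d : k) :
    nprod k n (Finsupp.single u c) (Finsupp.single v d) =
      Finsupp.single (Word.prod n u v) (c * d) := by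
  change (Finsupp.linearCombination k fun u => Finsupp.lmapDomain k k (Word.prod n u))
    (Finsupp.single u c) (Finsupp.single v d) = _
  rw [Finsupp.linearCombination_single, LinearMap.smul_apply, Finsupp.lmapDomain_apply,
    Finsupp.mapDomain_single, Finsupp.smul_single, smul_eq_mul]

/-- The defining relations of the free associative conformal algebra with locality function `N`:
sesquilinearity, associativity, and locality of the generators. -/
inductive AssocRel (N : X → X → ℕ) : (Word X →₀ k) → Prop
  | del_left (n : ℕ) (a b : Word X →₀ k) :
      AssocRel N (nprod k n (del k a) b + (n : k) • nprod k (n - 1) a b)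
  | del_right (n : ℕ) (a b : Word X →₀ k) :
      AssocRel N (nprod k n a (del k b) - (del k (nprod k n a b) + (n : k) • nprod k (n - 1) a b))
  | assoc (n m : ℕ) (a b c : Word X →₀ k) :
      AssocRel N (nprod k m (nprod k n a b) c -
        ∑ s ∈ Finset.range (n + 1),
          ((-1 : k) ^ s * (n.choose s : k)) • nprod k (n - s) a (nprod k (m + s) b c))
  | gen_local (x y : X) (n : ℕ) (h : N x y ≤ n) :
      AssocRel N (nprod k n (Finsupp.single (Word.gen x) 1) (Finsupp.single (Word.gen y) 1))

/-- The free associative conformal algebra generated by `X` relative to the locality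
function `N`. -/
abbrev FreeAssoc (N : X → X → ℕ) : Type _ :=
  (Word X →₀ k) ⧸ idealSpan k {f | AssocRel k N f}

/-- The generators of the free associative conformal algebra. -/
noncomputable def FreeAssoc.of (N : X → X → ℕ) (x : X) : FreeAssoc k N :=
  (idealSpan k {f | AssocRel k N f}).mkQ (Finsupp.single (Word.gen x) 1)

variable {k}

theorem FreeAssoc.mkQ_eq_zero {N : X → X → ℕ} {f : Word X →₀ k} (h : AssocRel k N f) :
    (idealSpan k {f | AssocRel k N f}).mkQ f = 0 := by
  rw [Submodule.mkQ_apply, Submodule.Quotient.mk_eq_zero]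
  exact subset_idealSpan k _ h

theorem FreeAssoc.del_left {N : X → X → ℕ} (n : ℕ) (a b : FreeAssoc k N) :
    nprod k n (del k a) b = -((n : k) • nprod k (n - 1) a b) := by
  obtain ⟨a, rfl⟩ := Submodule.mkQ_surjective _ a
  obtain ⟨b, rfl⟩ := Submodule.mkQ_surjective _ b
  rw [eq_neg_iff_add_eq_zero]
  have := FreeAssoc.mkQ_eq_zero (AssocRel.del_left (k := k) (N := N) n a b)
  simpa only [map_add, map_smul, (isHom_mkQ k _).map_nprod, (isHom_mkQ k _).map_del] using this

theorem FreeAssoc.del_right {N : X → X → ℕ} (n : ℕ) (a b : FreeAssoc k N) :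
    nprod k n a (del k b) = del k (nprod k n a b) + (n : k) • nprod k (n - 1) a b := by
  obtain ⟨a, rfl⟩ := Submodule.mkQ_surjective _ a
  obtain ⟨b, rfl⟩ := Submodule.mkQ_surjective _ b
  rw [← sub_eq_zero]
  have := FreeAssoc.mkQ_eq_zero (AssocRel.del_right (k := k) (N := N) n a b)
  simpa only [map_add, map_sub, map_smul, (isHom_mkQ k _).map_nprod,
    (isHom_mkQ k _).map_del] using this

instance FreeAssoc.instIsAssoc (N : X → X → ℕ) : IsAssoc k (FreeAssoc k N) where
  assoc n m a b c := by
    obtain ⟨a, rfl⟩ := Submodule.mkQ_surjective _ a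
    obtain ⟨b, rfl⟩ := Submodule.mkQ_surjective _ b
    obtain ⟨c, rfl⟩ := Submodule.mkQ_surjective _ c
    rw [← sub_eq_zero]
    have := FreeAssoc.mkQ_eq_zero (AssocRel.assoc (k := k) (N := N) n m a b c)
    simpa only [map_sub, map_sum, map_smul, (isHom_mkQ k _).map_nprod] using this

theorem FreeAssoc.of_local (N : X → X → ℕ) (x y : X) :
    LocalAt k (N x y) (FreeAssoc.of k N x) (FreeAssoc.of k N y) := by
  intro n hn
  rw [FreeAssoc.of, FreeAssoc.of, ← (isHom_mkQ k _).map_nprod]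
  exact FreeAssoc.mkQ_eq_zero (AssocRel.gen_local x y n hn)

/-- Dong's lemma, left factor. -/
theorem dong_left {C : Type*} [AddCommGroup C] [Module k C] [Ops k C] [IsAssoc k C]
    {N : ℕ} {a b c : C} (h : LocalAt k N b c) (n : ℕ) : LocalAt k N (nprod k n a b) c := by
  intro m hm
  rw [IsAssoc.assoc]
  refine Finset.sum_eq_zero fun s _ => ?_
  rw [h (m + s) (by omega), nprod, map_zero, smul_zero]

/-- Dong's lemma, right factor. -/
theorem dong_right {C : Type*} [AddCommGroup C] [Module k C] [Ops k C] [IsAssoc k C]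
    {N M : ℕ} {a b c : C} (hab : LocalAt k N a b) (hca : LocalAt k M c a) :
    ∀ j n : ℕ, N ≤ n + j → LocalAt k (M + j * (N + 1)) c (nprod k n a b) := by
  intro j
  induction j using Nat.strong_induction_on with
  | _ j ih =>
    intro n hn m hm
    by_cases hj : N ≤ n
    · rw [hab n hj, nprod, map_zero]
    have h0 : nprod k n (nprod k m c a) b = 0 := by
      rw [hca m (by omega), nprod, map_zero, LinearMap.zero_apply]
    rw [IsAssoc.assoc, Finset.sum_range_succ'] at h0
    rw [Finset.sum_eq_zero] at h0
    · simpa using h0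
    · intro s _
      by_cases hs : N ≤ n + (s + 1)
      · rw [hab _ hs, nprod, map_zero, smul_zero]
      · have hj1 : 1 ≤ j := by omega
        rw [ih (j - 1) (by omega) (n + (s + 1)) (by omega) (m - (s + 1)), smul_zero]
        have : j * (N + 1) = (j - 1) * (N + 1) + (N + 1) := by
          obtain ⟨i, rfl⟩ : ∃ i, j = i + 1 := ⟨j - 1, by omega⟩
          rw [Nat.add_sub_cancel]
          ring
        omega

theorem FreeAssoc.exists_local_word {N : X → X → ℕ} (v : Word X) : ∀ u : Word X, ∃ M,
    LocalAt k M ((idealSpan k {f | AssocRel k N f}).mkQ (Finsupp.single u 1))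
      ((idealSpan k {f | AssocRel k N f}).mkQ (Finsupp.single v 1)) := by
  have hD : ∀ u : Word X, (Finsupp.single (Word.del u) 1 : Word X →₀ k) =
      del k (Finsupp.single u 1) := fun u => (del_single k u 1).symm
  have hP : ∀ n (u v : Word X), (Finsupp.single (Word.prod n u v) 1 : Word X →₀ k) =
      nprod k n (Finsupp.single u 1) (Finsupp.single v 1) := fun n u v => by
    rw [nprod_single, one_mul]
  induction v with
  | gen y =>
    intro u
    induction u with
    | gen x => exact ⟨N x y, FreeAssoc.of_local N x y⟩
    | del u ih =>
      obtain ⟨M, hM⟩ := ih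
      refine ⟨M + 1, fun n hn => ?_⟩
      rw [hD, (isHom_mkQ k _).map_del, FreeAssoc.del_left, hM _ (by omega), smul_zero, neg_zero]
    | prod n u v _ ih =>
      obtain ⟨M, hM⟩ := ih
      rw [hP, (isHom_mkQ k _).map_nprod]
      exact ⟨M, dong_left hM n⟩
  | del v ih =>
    intro u
    obtain ⟨M, hM⟩ := ih u
    refine ⟨M + 1, fun n hn => ?_⟩
    rw [hD, (isHom_mkQ k _).map_del, FreeAssoc.del_right, hM _ (by omega), hM _ (by omega),
      smul_zero, map_zero, add_zero]
  | prod n v w ihv ihw =>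
    intro u
    obtain ⟨M, hM⟩ := ihv u
    obtain ⟨M', hM'⟩ := ihw v
    rw [hP, (isHom_mkQ k _).map_nprod]
    exact ⟨_, dong_right hM' hM M' n (by omega)⟩

instance FreeAssoc.instIsConformal (N : X → X → ℕ) : IsConformal k (FreeAssoc k N) where
  del_left := FreeAssoc.del_left
  del_right := FreeAssoc.del_right
  exists_local a b := by
    obtain ⟨a, rfl⟩ := Submodule.mkQ_surjective _ a
    obtain ⟨b, rfl⟩ := Submodule.mkQ_surjective _ b
    induction a using Finsupp.induction_linear with
    | zero => exact ⟨0, fun n _ => by simp [nprod]⟩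
    | add f g hf hg =>
      obtain ⟨M, hM⟩ := hf
      obtain ⟨M', hM'⟩ := hg
      refine ⟨max M M', fun n hn => ?_⟩
      have h1 := hM n (by omega)
      have h2 := hM' n (by omega)
      simp only [nprod, map_add, LinearMap.add_apply] at *
      rw [h1, h2, add_zero]
    | single u c =>
      induction b using Finsupp.induction_linear with
      | zero => exact ⟨0, fun n _ => by simp [nprod]⟩
      | add f g hf hg =>
        obtain ⟨M, hM⟩ := hf
        obtain ⟨M', hM'⟩ := hg
        refine ⟨max M M', fun n hn => ?_⟩
        have h1 := hM n (by omega)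
        have h2 := hM' n (by omega)
        simp only [nprod, map_add] at *
        rw [h1, h2, add_zero]
      | single v d =>
        obtain ⟨M, hM⟩ := FreeAssoc.exists_local_word (k := k) (N := N) v u
        refine ⟨M, fun n hn => ?_⟩
        have h1 := hM n hn
        rw [← mul_one c, ← mul_one d, ← smul_eq_mul, ← smul_eq_mul, ← Finsupp.smul_single,
          ← Finsupp.smul_single]
        simp only [nprod, map_smul, LinearMap.smul_apply] at *
        rw [h1, smul_zero, smul_zero]

/-- Two homomorphisms that agree on the generators are equal. -/
theorem FreeAssoc.hom_ext {N : X → X → ℕ} {C : Type*} [AddCommGroup C] [Module k C] [Ops k C]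
    {f g : FreeAssoc k N →ₗ[k] C} (hf : IsHom f) (hg : IsHom g)
    (h : ∀ x, f (FreeAssoc.of k N x) = g (FreeAssoc.of k N x)) : f = g := by
  refine Submodule.linearMap_qext _ (Finsupp.lhom_ext' fun u => LinearMap.ext_ring ?_)
  simp only [LinearMap.comp_apply, Finsupp.lsingle_apply]
  induction u with
  | gen x => exact h x
  | del u ih =>
    have hD : (Finsupp.single (Word.del u) 1 : Word X →₀ k) = del k (Finsupp.single u 1) :=
      (del_single k u 1).symm
    rw [hD, (isHom_mkQ k _).map_del, hf.map_del, hg.map_del, ih]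
  | prod n u v ihu ihv =>
    have hP : (Finsupp.single (Word.prod n u v) 1 : Word X →₀ k) =
      nprod k n (Finsupp.single u 1) (Finsupp.single v 1) := by rw [nprod_single, one_mul]
    rw [hP, (isHom_mkQ k _).map_nprod, hf.map_nprod, hg.map_nprod, ihu, ihv]

/-- The universal property of the free associative conformal algebra. -/
theorem FreeAssoc.existsUnique_lift {N : X → X → ℕ} {C : Type*} [AddCommGroup C] [Module k C]
    [Ops k C] [IsConformal k C] [IsAssoc k C] (f : X → C)
    (hf : ∀ x y, LocalAt k (N x y) (f x) (f y)) :
    ∃! g : FreeAssoc k N →ₗ[k] C, IsHom g ∧ ∀ x, g (FreeAssoc.of k N x) = f x := by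
  let ev : Word X → C := fun u =>
    Word.rec (motive := fun _ => C) f (fun _ a => del k a) (fun n _ _ a b => nprod k n a b) u
  let F : (Word X →₀ k) →ₗ[k] C := Finsupp.linearCombination k ev
  have hF : IsHom F := by
    constructor
    · intro a
      induction a using Finsupp.induction_linear with
      | zero => simp
      | add a b ha hb => simp only [map_add, ha, hb]
      | single u c =>
        rw [del_single]
        simp [F, ev]
    · intro n a b
      induction a using Finsupp.induction_linear with
      | zero => simp [nprod]
      | add a a' ha hb =>
        simp only [nprod, map_add, LinearMap.add_apply] at *
        rw [ha, hb]
      | single u c =>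
        induction b using Finsupp.induction_linear with
        | zero => simp [nprod]
        | add a a' ha hb =>
          simp only [nprod, map_add] at *
          rw [ha, hb]
        | single v d =>
          rw [nprod_single]
          simp only [F, ev, nprod, Finsupp.linearCombination_single, map_smul,
            LinearMap.smul_apply, smul_smul]
          rw [mul_comm]
  have hgen : ∀ x, F (Finsupp.single (Word.gen x) 1) = f x := fun x => by simp [F, ev]
  obtain ⟨g, hg, hgF⟩ := exists_lift k (S := {f | AssocRel k N f}) hF (by
    rintro _ (⟨n, a, b⟩ | ⟨n, a, b⟩ | ⟨n, m, a, b, c⟩ | ⟨x, y, n, h⟩)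
    · rw [map_add, map_smul, hF.map_nprod, hF.map_nprod, hF.map_del, IsConformal.del_left,
        neg_add_cancel]
    · rw [map_sub, map_add, map_smul, hF.map_del, hF.map_nprod, hF.map_nprod, hF.map_nprod,
        hF.map_del, IsConformal.del_right, sub_self]
    · simp only [map_sub, map_sum, map_smul, hF.map_nprod]
      rw [IsAssoc.assoc, sub_self]
    · rw [hF.map_nprod, hgen, hgen]
      exact hf x y n h)
  refine ⟨g, ⟨hg, fun x => by rw [FreeAssoc.of, hgF, hgen]⟩, ?_⟩
  rintro g' ⟨hg', hx⟩
  exact FreeAssoc.hom_ext hg' hg fun x => by rw [hx, FreeAssoc.of, hgF, hgen]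

end Free

/-! ### Free commutative conformal algebras -/

section FreeComm

variable (k : Type*) {X : Type*} [Field k]

/-- The free (associative and) commutative conformal algebra generated by `X` relative to the
locality function `N`: the quotient of the free associative conformal algebra by the ideal
generated by all `a ₍ₙ₎ b - {b ₍ₙ₎ a}`. -/
abbrev ComConf (N : X → X → ℕ) : Type _ :=
  FreeAssoc k N ⧸ idealSpan k {f : FreeAssoc k N | ∃ n a b, f = comm k n a b}

/-- The generators of the free commutative conformal algebra. -/
noncomputable def ComConf.of (N : X → X → ℕ) (x : X) : ComConf k N :=
  (idealSpan k {f : FreeAssoc k N | ∃ n a b, f = comm k n a b}).mkQ (FreeAssoc.of k N x)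

instance ComConf.instIsComm (N : X → X → ℕ) : IsComm k (ComConf k N) where
  comm n a b := by
    obtain ⟨a, rfl⟩ := Submodule.mkQ_surjective _ a
    obtain ⟨b, rfl⟩ := Submodule.mkQ_surjective _ b
    rw [← sub_eq_zero, ← ConformalAlg.comm, ← (isHom_mkQ k _).map_comm, Submodule.mkQ_apply,
      Submodule.Quotient.mk_eq_zero]
    exact subset_idealSpan k _ ⟨n, a, b, rfl⟩

variable {k}

/-- The generators satisfy the prescribed locality. -/
theorem ComConf.of_local (N : X → X → ℕ) (x y : X) :
    LocalAt k (N x y) (ComConf.of k N x) (ComConf.of k N y) :=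
  (isHom_mkQ k _).map_local (FreeAssoc.of_local N x y)

/-- The universal property of the free commutative conformal algebra. -/
theorem ComConf.existsUnique_lift {N : X → X → ℕ} {C : Type*} [AddCommGroup C] [Module k C]
    [Ops k C] [IsConformal k C] [IsAssoc k C] [IsComm k C] (f : X → C)
    (hf : ∀ x y, LocalAt k (N x y) (f x) (f y)) :
    ∃! g : ComConf k N →ₗ[k] C, IsHom g ∧ ∀ x, g (ComConf.of k N x) = f x := by
  obtain ⟨g, ⟨hg, hgf⟩, -⟩ := FreeAssoc.existsUnique_lift (k := k) (N := N) f hf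
  obtain ⟨h, hh, hhg⟩ := exists_lift k
    (S := {f : FreeAssoc k N | ∃ n a b, f = comm k n a b}) hg (by
      rintro _ ⟨n, a, b, rfl⟩
      rw [hg.map_comm, ConformalAlg.comm, IsComm.comm (k := k) n (g a) (g b), sub_self])
  refine ⟨h, ⟨hh, fun x => by rw [ComConf.of, hhg, hgf]⟩, ?_⟩
  rintro h' ⟨hh', hx⟩
  refine Submodule.linearMap_qext _ (FreeAssoc.hom_ext (k := k) (N := N)
    (hh'.comp (isHom_mkQ k _)) (hh.comp (isHom_mkQ k _)) fun x => ?_)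
  change h' (ComConf.of k N x) = h ((Submodule.mkQ _) _)
  rw [hx, hhg, hgf]

end FreeComm

/-! ### Universal associative conformal envelopes -/

section Envelope

variable (k : Type*) {L : Type*} [Field k] [AddCommGroup L] [Module k L] [Ops k L]

/-- The subalgebra of `L × FreeAssoc(X, N)⁽⁻⁾` generated by the pairs `(x, x)`, `x ∈ X`:
`EnvRel a f` says that the element `a` of the Lie conformal algebra `L` is represented by the
conformal Lie polynomial `f` in the generators `X ⊆ L`. -/
inductive EnvRel {X : Set L} (N : X → X → ℕ) : L → FreeAssoc k N → Prop
  | gen (x : X) : EnvRel N x (FreeAssoc.of k N x)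
  | zero : EnvRel N 0 0
  | add {a b f g} : EnvRel N a f → EnvRel N b g → EnvRel N (a + b) (f + g)
  | smul (c : k) {a f} : EnvRel N a f → EnvRel N (c • a) (c • f)
  | del {a f} : EnvRel N a f → EnvRel N (del k a) (del k f)
  | prod (n : ℕ) {a b f g} : EnvRel N a f → EnvRel N b g →
      EnvRel N (nprod k n a b) (comm k n f g)

/-- The universal associative conformal envelope `U(L; X, N)` of a Lie conformal algebra `L`
generated by `X ⊆ L`, relative to a locality function `N` on `X`: the quotient of the free
associative conformal algebra by all relations between the generators `X` that hold in `L`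
for the commutator operations. Its universal property is stated in `Env.exists_lieHom`,
`Env.of_local` and `Env.existsUnique_lift`. -/
abbrev Env {X : Set L} (N : X → X → ℕ) : Type _ :=
  FreeAssoc k N ⧸ idealSpan k {f : FreeAssoc k N | EnvRel k N 0 f}

/-- The generators of the universal envelope. -/
noncomputable def Env.of {X : Set L} (N : X → X → ℕ) (x : X) : Env k N :=
  (idealSpan k {f : FreeAssoc k N | EnvRel k N 0 f}).mkQ (FreeAssoc.of k N x)

/-- `X` generates `L` as a conformal algebra. -/
def Generates (X : Set L) : Prop :=
  ∀ S : Submodule k L, X ⊆ S → (∀ a ∈ S, del k a ∈ S) →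
    (∀ n, ∀ a ∈ S, ∀ b ∈ S, nprod k n a b ∈ S) → S = ⊤

variable {k}

theorem Env.of_local {X : Set L} (N : X → X → ℕ) (x y : X) :
    LocalAt k (N x y) (Env.of k N x) (Env.of k N y) :=
  (isHom_mkQ k _).map_local (FreeAssoc.of_local N x y)

theorem Env.exists_rel {X : Set L} (N : X → X → ℕ) (hX : Generates k X) (a : L) :
    ∃ f, EnvRel k N a f := by
  let S : Submodule k L :=
    { carrier := {a | ∃ f, EnvRel k N a f}
      add_mem' := fun ⟨f, hf⟩ ⟨g, hg⟩ => ⟨_, hf.add hg⟩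
      zero_mem' := ⟨0, EnvRel.zero⟩
      smul_mem' := fun c _ ⟨f, hf⟩ => ⟨_, hf.smul c⟩ }
  have hS : S = ⊤ := hX S (fun x hx => ⟨_, EnvRel.gen ⟨x, hx⟩⟩)
    (fun a ⟨f, hf⟩ => ⟨_, hf.del⟩) (fun n a ⟨f, hf⟩ b ⟨g, hg⟩ => ⟨_, hf.prod n hg⟩)
  exact (hS ▸ Submodule.mem_top : a ∈ S)

/-- The canonical homomorphism from `L` to the commutator algebra of its envelope. -/
theorem Env.exists_lieHom {X : Set L} (N : X → X → ℕ) (hX : Generates k X) :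
    ∃ φ : L →ₗ[k] Env k N, IsLieHom φ ∧ ∀ x : X, φ x = Env.of k N x := by
  choose r hr using Env.exists_rel N hX
  let π : FreeAssoc k N →ₗ[k] Env k N := (idealSpan k {f : FreeAssoc k N | EnvRel k N 0 f}).mkQ
  have hπ : IsHom π := isHom_mkQ k _
  have key : ∀ a f, EnvRel k N a f → π (r a) = π f := by
    intro a f hf
    rw [← sub_eq_zero, ← map_sub]
    refine (Submodule.Quotient.mk_eq_zero _).2 (subset_idealSpan k _ ?_)
    have h := (hr a).add (hf.smul (-1))
    rwa [neg_one_smul, neg_one_smul, add_neg_cancel, ← sub_eq_add_neg] at h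
  refine ⟨{ toFun := fun a => π (r a), map_add' := ?_, map_smul' := ?_ }, ⟨?_, ?_⟩, ?_⟩
  · intro a b
    rw [key _ _ ((hr a).add (hr b)), map_add]
  · intro c a
    rw [key _ _ ((hr a).smul c), map_smul, RingHom.id_apply]
  · intro a
    change π (r _) = del k (π (r a))
    rw [key _ _ (hr a).del, hπ.map_del]
  · intro n a b
    change π (r _) = comm k n (π (r a)) (π (r b))
    rw [key _ _ ((hr a).prod n (hr b)), hπ.map_comm]
  · intro x
    exact key _ _ (EnvRel.gen x)

/-- The universal property of the universal associative conformal envelope. -/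
theorem Env.existsUnique_lift {X : Set L} {N : X → X → ℕ} {C : Type*} [AddCommGroup C]
    [Module k C] [Ops k C] [IsConformal k C] [IsAssoc k C] (ψ : L →ₗ[k] C) (hψ : IsLieHom ψ)
    (hN : ∀ x y : X, LocalAt k (N x y) (ψ x) (ψ y)) :
    ∃! g : Env k N →ₗ[k] C, IsHom g ∧ ∀ x : X, g (Env.of k N x) = ψ x := by
  obtain ⟨g, ⟨hg, hgf⟩, -⟩ := FreeAssoc.existsUnique_lift (k := k) (N := N) (fun x => ψ x) hN
  have key : ∀ a f, EnvRel k N a f → g f = ψ a := by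
    intro a f h
    induction h with
    | gen x => exact hgf x
    | zero => simp
    | add _ _ h1 h2 => rw [map_add, map_add, h1, h2]
    | smul c _ h1 => rw [map_smul, map_smul, h1]
    | del _ h1 => rw [hg.map_del, hψ.map_del, h1]
    | prod n _ _ h1 h2 => rw [hg.map_comm, hψ.map_nprod, h1, h2]
  obtain ⟨h, hh, hhg⟩ := exists_lift k (S := {f : FreeAssoc k N | EnvRel k N 0 f}) hg
    (fun f hf => by rw [key 0 f hf, map_zero])
  refine ⟨h, ⟨hh, fun x => by rw [Env.of, hhg, hgf]⟩, ?_⟩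
  rintro h' ⟨hh', hx⟩
  refine Submodule.linearMap_qext _ (FreeAssoc.hom_ext (k := k) (N := N)
    (hh'.comp (isHom_mkQ k _)) (hh.comp (isHom_mkQ k _)) fun x => ?_)
  change h' (Env.of k N x) = h ((Submodule.mkQ _) _)
  rw [hx, hhg, hgf]

end Envelope

/-! ### Lie identities and `∂` -/

section LieIdentities

variable {k : Type*} {C : Type*} [Field k] [AddCommGroup C] [Module k C] [Ops k C]

theorem LocalAt.mono {N M : ℕ} {a b : C} (h : LocalAt k N a b) (hM : N ≤ M) : LocalAt k M a b :=
  fun n hn => h n (hM.trans hn)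

theorem del_pow_comm (s : ℕ) (a : C) :
    ((del k : Module.End k C) ^ s) (del k a) = del k (((del k : Module.End k C) ^ s) a) := by
  rw [← Module.End.mul_apply, ← Module.End.mul_apply, ← pow_succ, pow_succ']

variable (k)

/-- The skew-symmetry identities for a pair of elements. -/
def SkewAt (a b : C) : Prop := ∀ n, nprod k n a b = -rev k n b a

/-- The Jacobi identities for a triple of elements. -/
def JacobiAt (a b c : C) : Prop := ∀ n m, nprod k n a (nprod k m b c) -
  nprod k m b (nprod k n a c) = ∑ s ∈ Finset.range (n + 1),
    (n.choose s : k) • nprod k (n + m - s) (nprod k s a b) c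

variable {k}

theorem JacobiAt.smul_left_index {a b c : C} (h : JacobiAt k a b c) (n m : ℕ) :
    (n : k) • (nprod k (n - 1) a (nprod k m b c) - nprod k m b (nprod k (n - 1) a c)) =
      ∑ s ∈ Finset.range (n + 1), ((n.choose s : k) * ((n : k) - s)) •
        nprod k (n + m - s - 1) (nprod k s a b) c := by
  rcases n with _ | n
  · simp
  · rw [Finset.sum_range_succ, sub_self, mul_zero, zero_smul, add_zero, Nat.add_sub_cancel, h,
      Finset.smul_sum]
    refine Finset.sum_congr rfl fun s hs => ?_
    have hs' : s ≤ n + 1 := by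
      have := Finset.mem_range.1 hs
      omega
    rw [smul_smul, show n + 1 + m - s - 1 = n + m - s by omega, ← Nat.cast_sub hs',
      ← Nat.cast_mul, ← Nat.cast_mul, ← Nat.choose_mul_succ_eq, mul_comm]

theorem JacobiAt.smul_right_index {a b c : C} (h : JacobiAt k a b c) (n m : ℕ) :
    (m : k) • (nprod k n a (nprod k (m - 1) b c) - nprod k (m - 1) b (nprod k n a c)) =
      ∑ s ∈ Finset.range (n + 1), ((n.choose s : k) * (m : k)) •
        nprod k (n + m - s - 1) (nprod k s a b) c := by
  rcases m with _ | m
  · simp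
  · rw [Nat.add_sub_cancel, h, Finset.smul_sum]
    refine Finset.sum_congr rfl fun s hs => ?_
    rw [smul_smul, show n + (m + 1) - s - 1 = n + m - s by omega, mul_comm]

variable [IsConformal k C]

theorem LocalAt.del_left {N : ℕ} {a b : C} (h : LocalAt k N a b) :
    LocalAt k (N + 1) (del k a) b := fun n hn => by
  rw [IsConformal.del_left, h _ (by omega), smul_zero, neg_zero]

theorem LocalAt.del_right {N : ℕ} {a b : C} (h : LocalAt k N a b) :
    LocalAt k (N + 1) a (del k b) := fun n hn => by
  rw [IsConformal.del_right, h _ (by omega), h _ (by omega), smul_zero, map_zero, add_zero]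

theorem rev_add_left (n : ℕ) (a a' b : C) : rev k n (a + a') b = rev k n a b + rev k n a' b := by
  obtain ⟨N, hN⟩ := IsConformal.exists_local (k := k) a b
  obtain ⟨N', hN'⟩ := IsConformal.exists_local (k := k) a' b
  have h1 := hN.mono (le_max_left N N')
  have h2 := hN'.mono (le_max_right N N')
  have h3 : LocalAt k (max N N') (a + a') b := fun n hn => by
    have := h1 n hn
    have := h2 n hn
    simp_all [nprod]
  rw [rev_eq_sum h1, rev_eq_sum h2, rev_eq_sum h3, ← Finset.sum_add_distrib]
  simp [nprod]

theorem rev_add_right (n : ℕ) (a b b' : C) : rev k n a (b + b') = rev k n a b + rev k n a b' := by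
  obtain ⟨N, hN⟩ := IsConformal.exists_local (k := k) a b
  obtain ⟨N', hN'⟩ := IsConformal.exists_local (k := k) a b'
  have h1 := hN.mono (le_max_left N N')
  have h2 := hN'.mono (le_max_right N N')
  have h3 : LocalAt k (max N N') a (b + b') := fun n hn => by
    have := h1 n hn
    have := h2 n hn
    simp_all [nprod]
  rw [rev_eq_sum h1, rev_eq_sum h2, rev_eq_sum h3, ← Finset.sum_add_distrib]
  simp [nprod]

theorem rev_smul_left (n : ℕ) (c : k) (a b : C) : rev k n (c • a) b = c • rev k n a b := by
  obtain ⟨N, hN⟩ := IsConformal.exists_local (k := k) a b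
  have h3 : LocalAt k N (c • a) b := fun n hn => by
    have := hN n hn
    simp_all [nprod]
  rw [rev_eq_sum hN, rev_eq_sum h3, Finset.smul_sum]
  exact Finset.sum_congr rfl fun s _ => by simp only [nprod, map_smul, LinearMap.smul_apply]; rw [smul_comm]

theorem rev_smul_right (n : ℕ) (c : k) (a b : C) : rev k n a (c • b) = c • rev k n a b := by
  obtain ⟨N, hN⟩ := IsConformal.exists_local (k := k) a b
  have h3 : LocalAt k N a (c • b) := fun n hn => by
    have := hN n hn
    simp_all [nprod]
  rw [rev_eq_sum hN, rev_eq_sum h3, Finset.smul_sum]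
  exact Finset.sum_congr rfl fun s _ => by simp only [nprod, map_smul]; rw [smul_comm]

theorem rev_del_left [CharZero k] (n : ℕ) (a b : C) :
    rev k n (del k a) b = del k (rev k n a b) + (n : k) • rev k (n - 1) a b := by
  obtain ⟨N, hN⟩ := IsConformal.exists_local (k := k) a b
  have h1 : (n : k) • rev k (n - 1) a b = ∑ s ∈ Finset.range (N + 1),
      ((-1 : k) ^ (n + s) / (s.factorial : k) * -(n : k)) •
        ((del k : Module.End k C) ^ s) (nprod k (n + s - 1) a b) := by
    rw [rev_eq_sum (hN.mono (Nat.le_succ N)), Finset.smul_sum]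
    refine Finset.sum_congr rfl fun s _ => ?_
    rcases n with _ | n
    · simp
    · rw [smul_smul, show n + 1 + s - 1 = n + s by omega, Nat.add_sub_cancel,
        show n + 1 + s = n + s + 1 by omega, pow_succ]
      congr 1
      ring
  have h2 : del k (rev k n a b) = ∑ s ∈ Finset.range (N + 1),
      ((-1 : k) ^ (n + s) / (s.factorial : k) * -(s : k)) •
        ((del k : Module.End k C) ^ s) (nprod k (n + s - 1) a b) := by
    rw [rev_eq_sum hN, Finset.sum_range_succ', map_sum]
    simp only [Nat.cast_zero, neg_zero, mul_zero, zero_smul, add_zero]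
    refine Finset.sum_congr rfl fun s _ => ?_
    rw [map_smul, ← Module.End.mul_apply, ← pow_succ', show n + (s + 1) - 1 = n + s by omega,
      ← add_assoc, pow_succ, Nat.factorial_succ]
    congr 1
    have h1 : ((s : k) + 1) ≠ 0 := Nat.cast_add_one_ne_zero s
    have h2 : (s.factorial : k) ≠ 0 := Nat.cast_ne_zero.2 s.factorial_ne_zero
    push_cast
    field_simp
    ring
  rw [rev_eq_sum hN.del_left, h1, h2, ← Finset.sum_add_distrib]
  refine Finset.sum_congr rfl fun s _ => ?_
  rw [IsConformal.del_left, map_neg, map_smul, ← neg_smul, smul_smul, ← add_smul]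
  congr 1
  push_cast
  ring

theorem rev_del_right [CharZero k] (n : ℕ) (a b : C) :
    rev k n a (del k b) = -((n : k) • rev k (n - 1) a b) := by
  obtain ⟨N, hN⟩ := IsConformal.exists_local (k := k) a b
  have h : rev k n (del k a) b + rev k n a (del k b) = del k (rev k n a b) := by
    rw [rev_eq_sum hN.del_left, rev_eq_sum hN.del_right, rev_eq_sum (hN.mono (Nat.le_succ N)),
      ← Finset.sum_add_distrib, map_sum]
    refine Finset.sum_congr rfl fun s _ => ?_
    rw [← smul_add, ← map_add, IsConformal.del_left, IsConformal.del_right, map_smul,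
      ← del_pow_comm]
    congr 2
    abel
  rw [rev_del_left] at h
  have h' := sub_eq_zero.2 h
  rw [← sub_eq_zero, ← h']
  abel

theorem SkewAt.del_left [CharZero k] {a b : C} (h : SkewAt k a b) : SkewAt k (del k a) b := by
  intro n
  rw [IsConformal.del_left, rev_del_right, h, smul_neg]

theorem SkewAt.del_right [CharZero k] {a b : C} (h : SkewAt k a b) : SkewAt k a (del k b) := by
  intro n
  rw [IsConformal.del_right, rev_del_left, h, h, map_neg, smul_neg, neg_add]

theorem JacobiAt.del_left {a b c : C} (h : JacobiAt k a b c) : JacobiAt k (del k a) b c := by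
  intro n m
  rcases n with _ | n
  · simp only [nprod, zero_add, Finset.range_one, Finset.sum_singleton]
    have h0 : ∀ y : C, Ops.prod (k := k) 0 (del k a) y = 0 := fun y => by
      have := IsConformal.del_left (k := k) 0 a y
      simpa using this
    simp [h0]
  · have h0 := h n m
    rw [Finset.sum_range_succ']
    have h1 : nprod k 0 (del k a) b = 0 := by
      have := IsConformal.del_left (k := k) 0 a b
      simpa using this
    rw [h1, IsConformal.del_left, IsConformal.del_left, Nat.add_sub_cancel]
    have h2 : nprod k m b (-(((n + 1 : ℕ) : k) • nprod k n a c)) =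
        -(((n + 1 : ℕ) : k) • nprod k m b (nprod k n a c)) := by simp [nprod]
    have h3 : ∀ (j : ℕ), nprod k j (0 : C) c = 0 := fun j => by simp [nprod]
    rw [h2, h3, smul_zero, add_zero, ← neg_sub_neg, neg_neg, neg_neg, ← smul_sub, ← neg_sub,
      smul_neg, h0, Finset.smul_sum, ← Finset.sum_neg_distrib]
    refine Finset.sum_congr rfl fun s _ => ?_
    rw [IsConformal.del_left, Nat.add_sub_cancel, show n + 1 + m - (s + 1) = n + m - s by omega]
    have h4 : nprod k (n + m - s) (-(((s + 1 : ℕ) : k) • nprod k s a b)) c =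
        -(((s + 1 : ℕ) : k) • nprod k (n + m - s) (nprod k s a b) c) := by simp [nprod]
    rw [h4, smul_neg, smul_smul, smul_smul]
    congr 2
    rw [← Nat.cast_mul, ← Nat.cast_mul, Nat.add_one_mul_choose_eq]

theorem JacobiAt.del_middle {a b c : C} (h : JacobiAt k a b c) : JacobiAt k a (del k b) c := by
  intro n m
  have h1 : ∀ y, nprod k n a (-((m : k) • y)) = -((m : k) • nprod k n a y) := fun y => by
    simp [nprod]
  have h2 : ∀ s, nprod k (n + m - s) (nprod k s a (del k b)) c =
      -(((n + m - s : ℕ) : k) • nprod k (n + m - s - 1) (nprod k s a b) c) +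
        (s : k) • nprod k (n + m - s) (nprod k (s - 1) a b) c := fun s => by
    rw [IsConformal.del_right, ← IsConformal.del_left]
    simp [nprod]
  have h3 : ∑ s ∈ Finset.range (n + 1), (n.choose s : k) •
      (s : k) • nprod k (n + m - s) (nprod k (s - 1) a b) c =
      ∑ s ∈ Finset.range (n + 1), ((n.choose s : k) * ((n : k) - s)) •
        nprod k (n + m - s - 1) (nprod k s a b) c := by
    rw [Finset.sum_range_succ', Finset.sum_range_succ, Nat.cast_zero, zero_smul, smul_zero,
      sub_self, mul_zero, zero_smul]
    congr 1
    refine Finset.sum_congr rfl fun s hs => ?_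
    have hs' : s ≤ n := (Finset.mem_range.1 hs).le
    rw [smul_smul, Nat.add_sub_cancel, show n + m - (s + 1) = n + m - s - 1 by omega,
      ← Nat.cast_sub hs', ← Nat.cast_mul, ← Nat.cast_mul, Nat.choose_succ_right_eq]
  rw [IsConformal.del_left, IsConformal.del_left, h1, neg_sub_neg, ← smul_sub, ← neg_sub, smul_neg,
    h.smul_right_index]
  simp only [h2, smul_add]
  rw [Finset.sum_add_distrib, h3, ← Finset.sum_add_distrib, ← Finset.sum_neg_distrib]
  refine Finset.sum_congr rfl fun s hs => ?_
  have hs' : s ≤ n + m := by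
    have := Finset.mem_range.1 hs
    omega
  rw [Nat.cast_sub hs', smul_neg, smul_smul, ← neg_smul, ← neg_smul, ← add_smul]
  congr 1
  push_cast
  ring

theorem JacobiAt.del_right {a b c : C} (h : JacobiAt k a b c) : JacobiAt k a b (del k c) := by
  intro n m
  have h1 : nprod k n a (nprod k m b (del k c)) = del k (nprod k n a (nprod k m b c)) +
      (n : k) • nprod k (n - 1) a (nprod k m b c) +
      (m : k) • nprod k n a (nprod k (m - 1) b c) := by
    rw [IsConformal.del_right (k := k) m b c, nprod, map_add, map_smul, ← nprod,
      IsConformal.del_right]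
  have h2 : nprod k m b (nprod k n a (del k c)) = del k (nprod k m b (nprod k n a c)) +
      (m : k) • nprod k (m - 1) b (nprod k n a c) +
      (n : k) • nprod k m b (nprod k (n - 1) a c) := by
    rw [IsConformal.del_right (k := k) n a c, nprod, map_add, map_smul, ← nprod,
      IsConformal.del_right]
  have h3 : nprod k n a (nprod k m b (del k c)) - nprod k m b (nprod k n a (del k c)) =
      del k (nprod k n a (nprod k m b c) - nprod k m b (nprod k n a c)) +
      ((n : k) • (nprod k (n - 1) a (nprod k m b c) - nprod k m b (nprod k (n - 1) a c)) +
      (m : k) • (nprod k n a (nprod k (m - 1) b c) - nprod k (m - 1) b (nprod k n a c))) := by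
    rw [h1, h2, map_sub, smul_sub, smul_sub]
    abel
  rw [h3, h.smul_left_index, h.smul_right_index, h, map_sum, ← Finset.sum_add_distrib,
    ← Finset.sum_add_distrib]
  refine Finset.sum_congr rfl fun s hs => ?_
  have hs' : s ≤ n + m := by
    have := Finset.mem_range.1 hs
    omega
  rw [IsConformal.del_right, Nat.cast_sub hs', smul_add, map_smul, smul_smul, ← add_smul]
  congr 2
  push_cast
  ring

end LieIdentities

/-! ### Kac--Moody conformal algebras -/

section KacMoody

open scoped Polynomial TensorProduct

variable {k : Type*} [Field k] {g : Type*} [LieRing g] [LieAlgebra k g]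

/-- The underlying space of `K(g) = (k[∂] ⊗ g) ⊕ k e`; the pair `(u, c)` stands for
`u + c e`. -/
def KacMoody (_form : LinearMap.BilinForm k g) : Type _ := (k[X] ⊗[k] g) × k

namespace KacMoody

noncomputable instance (form : LinearMap.BilinForm k g) : AddCommGroup (KacMoody form) :=
  inferInstanceAs (AddCommGroup ((k[X] ⊗[k] g) × k))

noncomputable instance (form : LinearMap.BilinForm k g) : Module k (KacMoody form) :=
  inferInstanceAs (Module k ((k[X] ⊗[k] g) × k))

/-- `n!` times the coefficient at `λⁿ` of `f(-λ) h(∂+λ)`, where the variable of the outer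
polynomial ring is `λ` and that of the inner one is `∂`. -/
noncomputable def curCoeff (n : ℕ) : k[X] →ₗ[k] k[X] →ₗ[k] k[X] :=
  LinearMap.mk₂ k
    (fun f h => (n.factorial : k) •
      (Polynomial.aeval (-Polynomial.X : k[X][X]) f *
        Polynomial.aeval (Polynomial.C Polynomial.X + Polynomial.X : k[X][X]) h).coeff n)
    (fun f f' h => by simp [add_mul])
    (fun c f h => by rw [map_smul, smul_mul_assoc, Polynomial.coeff_smul, smul_comm])
    (fun f h h' => by simp [mul_add])
    (fun c f h => by rw [map_smul, mul_smul_comm, Polynomial.coeff_smul, smul_comm])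

/-- `n!` times the coefficient at `λⁿ` of `λ f(-λ) h(λ)`. -/
noncomputable def formCoeff (n : ℕ) : k[X] →ₗ[k] k[X] →ₗ[k] k :=
  LinearMap.mk₂ k
    (fun f h => (n.factorial : k) •
      (Polynomial.X * (Polynomial.aeval (-Polynomial.X : k[X]) f * h)).coeff n)
    (fun f f' h => by simp [add_mul, mul_add])
    (fun c f h => by rw [map_smul, smul_mul_assoc, mul_smul_comm, Polynomial.coeff_smul, smul_comm])
    (fun f h h' => by simp [mul_add])
    (fun c f h => by rw [mul_smul_comm, mul_smul_comm, Polynomial.coeff_smul, smul_comm])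

/-- The Lie bracket of `g` as a bilinear map. -/
def bracket : g →ₗ[k] g →ₗ[k] g :=
  LinearMap.mk₂ k (fun a b => ⁅a, b⁆) add_lie smul_lie lie_add lie_smul

/-- Multiplication by `∂` on `k[∂] ⊗ g`. -/
noncomputable def curDel : k[X] ⊗[k] g →ₗ[k] k[X] ⊗[k] g :=
  LinearMap.rTensor g (LinearMap.mulLeft k (Polynomial.X : k[X]))

/-- The component in `k[∂] ⊗ g` of the `n`-product: `f ⊗ a, h ⊗ b` go to `n!` times the coefficient
at `λⁿ` of `f(-λ) h(∂+λ) ⊗ [a, b]`. -/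
noncomputable def curPart (n : ℕ) : k[X] ⊗[k] g →ₗ[k] k[X] ⊗[k] g →ₗ[k] k[X] ⊗[k] g :=
  TensorProduct.map₂ (curCoeff n) bracket

/-- The component in `k e` of the `n`-product: `f ⊗ a, h ⊗ b` go to `n!` times the coefficient at
`λⁿ` of `λ f(-λ) h(λ) ⟨a | b⟩`. -/
noncomputable def formPart (form : LinearMap.BilinForm k g) (n : ℕ) :
    k[X] ⊗[k] g →ₗ[k] k[X] ⊗[k] g →ₗ[k] k :=
  (TensorProduct.map₂ (formCoeff n) form).compr₂ (TensorProduct.lid k k).toLinearMap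

/-- The conformal algebra structure of `K(g)` determined by `∂ e = 0`, sesquilinearity,
`[a ₍λ₎ b] = [a, b] + λ ⟨a | b⟩ e` for `a, b ∈ g`, and centrality of `e`; explicitly,
`[f(∂)a ₍λ₎ h(∂)b] = f(-λ) h(∂+λ) [a, b] + λ f(-λ) h(λ) ⟨a | b⟩ e`. -/
noncomputable instance (form : LinearMap.BilinForm k g) : Ops k (KacMoody form) where
  D := (LinearMap.prodMap curDel 0 : (k[X] ⊗[k] g) × k →ₗ[k] (k[X] ⊗[k] g) × k)
  prod n := (((curPart n).compl₁₂ (LinearMap.fst k (k[X] ⊗[k] g) k)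
        (LinearMap.fst k (k[X] ⊗[k] g) k)).compr₂ (LinearMap.inl k (k[X] ⊗[k] g) k) +
      ((formPart form n).compl₁₂ (LinearMap.fst k (k[X] ⊗[k] g) k)
        (LinearMap.fst k (k[X] ⊗[k] g) k)).compr₂ (LinearMap.inr k (k[X] ⊗[k] g) k) :
    (k[X] ⊗[k] g) × k →ₗ[k] (k[X] ⊗[k] g) × k →ₗ[k] (k[X] ⊗[k] g) × k)

/-- The embedding of `g = 1 ⊗ g` into `K(g)`. -/
noncomputable def cur (form : LinearMap.BilinForm k g) (a : g) : KacMoody form :=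
  ((1 : k[X]) ⊗ₜ[k] a, (0 : k))

/-- The torsion element `e` of `K(g)`. -/
noncomputable def e (form : LinearMap.BilinForm k g) : KacMoody form := ((0 : k[X] ⊗[k] g), (1 : k))

variable {form : LinearMap.BilinForm k g}

theorem curDel_tmul (f : k[X]) (a : g) : curDel (f ⊗ₜ[k] a) = (Polynomial.X * f) ⊗ₜ[k] a := rfl

theorem curPart_tmul (n : ℕ) (f h : k[X]) (a b : g) :
    curPart n (f ⊗ₜ[k] a) (h ⊗ₜ[k] b) = curCoeff n f h ⊗ₜ[k] ⁅a, b⁆ := rfl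

theorem formPart_tmul (n : ℕ) (f h : k[X]) (a b : g) :
    formPart form n (f ⊗ₜ[k] a) (h ⊗ₜ[k] b) = formCoeff n f h * form a b := rfl

theorem del_mk (u : k[X] ⊗[k] g) (c : k) :
    del k (C := KacMoody form) (u, c) = ((curDel u, 0) : (k[X] ⊗[k] g) × k) := rfl

theorem nprod_mk (n : ℕ) (u v : k[X] ⊗[k] g) (c d : k) :
    nprod k (C := KacMoody form) n (u, c) (v, d) =
      ((curPart n u v, formPart form n u v) : (k[X] ⊗[k] g) × k) := by
  change ((curPart n u v, (0 : k)) + ((0 : k[X] ⊗[k] g), formPart form n u v) :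
    (k[X] ⊗[k] g) × k) = _
  rw [Prod.mk_add_mk, add_zero, zero_add]

theorem del_e : del k (e form) = 0 := by
  rw [e, del_mk, map_zero]
  rfl

theorem nprod_e_left (n : ℕ) (x : KacMoody form) : nprod k n (e form) x = 0 := by
  obtain ⟨u, c⟩ := x
  rw [e, nprod_mk, map_zero, map_zero]
  rfl

theorem nprod_e_right (n : ℕ) (x : KacMoody form) : nprod k n x (e form) = 0 := by
  obtain ⟨u, c⟩ := x
  rw [e, nprod_mk, map_zero, map_zero]
  rfl

/-- `[a ₍λ₎ b] = [a, b] + λ ⟨a | b⟩ e`. -/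
theorem nprod_cur (n : ℕ) (a b : g) : nprod k n (cur form a) (cur form b) =
    if n = 0 then cur form ⁅a, b⁆ else if n = 1 then form a b • e form else 0 := by
  rw [cur, cur, nprod_mk, curPart_tmul, formPart_tmul]
  simp only [curCoeff, formCoeff, LinearMap.mk₂_apply, map_one, mul_one,
    Polynomial.coeff_one, Polynomial.coeff_X]
  rcases n with _ | _ | n
  · simp [cur]
    rfl
  · have h : form a b • (((0 : k[X] ⊗[k] g), (1 : k)) : (k[X] ⊗[k] g) × k) = (0, form a b) := by
      simp
    refine Eq.trans ?_ h.symm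
    simp
    rfl
  · have h : (((0 : k[X] ⊗[k] g), (0 : k)) : (k[X] ⊗[k] g) × k) = 0 := rfl
    simp only [Nat.add_eq_zero_iff, one_ne_zero, and_false, if_false,
      smul_zero, TensorProduct.zero_tmul]
    refine Eq.trans ?_ h
    simp
    rfl

theorem curCoeff_X_left (n : ℕ) (f h : k[X]) :
    curCoeff n (Polynomial.X * f) h = -((n : k) • curCoeff (n - 1) f h) := by
  simp only [curCoeff, LinearMap.mk₂_apply, map_mul, Polynomial.aeval_X]
  rw [mul_assoc, neg_mul (Polynomial.X : k[X][X]), Polynomial.coeff_neg]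
  rcases n with _ | n
  · simp
  · simp [Polynomial.coeff_X_mul, Nat.factorial_succ, smul_smul]

theorem curCoeff_X_right (n : ℕ) (f h : k[X]) :
    curCoeff n f (Polynomial.X * h) =
      Polynomial.X * curCoeff n f h + (n : k) • curCoeff (n - 1) f h := by
  simp only [curCoeff, LinearMap.mk₂_apply, map_mul, Polynomial.aeval_X]
  rw [mul_left_comm, add_mul, Polynomial.coeff_add, Polynomial.coeff_C_mul, smul_add,
    mul_smul_comm]
  rcases n with _ | n
  · simp
  · simp [Polynomial.coeff_X_mul, Nat.factorial_succ, smul_smul]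

theorem formCoeff_X_left (n : ℕ) (f h : k[X]) :
    formCoeff n (Polynomial.X * f) h = -((n : k) • formCoeff (n - 1) f h) := by
  simp only [formCoeff, LinearMap.mk₂_apply, map_mul, Polynomial.aeval_X]
  rw [mul_assoc, neg_mul, mul_neg, Polynomial.coeff_neg]
  rcases n with _ | n
  · simp
  · rw [Polynomial.coeff_X_mul]
    simp [Nat.factorial_succ, mul_assoc]

theorem formCoeff_X_right (n : ℕ) (f h : k[X]) :
    formCoeff n f (Polynomial.X * h) = (n : k) • formCoeff (n - 1) f h := by
  simp only [formCoeff, LinearMap.mk₂_apply]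
  rw [mul_left_comm (Polynomial.aeval _ f)]
  rcases n with _ | n
  · simp
  · rw [Polynomial.coeff_X_mul]
    simp [Nat.factorial_succ, mul_assoc]

theorem exists_bound (x : k[X] ⊗[k] g) (y : k[X] ⊗[k] g) : ∃ N, ∀ n, N ≤ n →
    curPart n x y = 0 ∧ formPart form n x y = 0 := by
  induction x with
  | zero => exact ⟨0, fun n _ => by simp⟩
  | add x x' hx hx' =>
    obtain ⟨N, hN⟩ := hx
    obtain ⟨N', hN'⟩ := hx'
    refine ⟨max N N', fun n hn => ?_⟩
    have h1 := hN n (by omega)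
    have h2 := hN' n (by omega)
    simp [h1.1, h1.2, h2.1, h2.2]
  | tmul f a =>
    induction y with
    | zero => exact ⟨0, fun n _ => by simp⟩
    | add x x' hx hx' =>
      obtain ⟨N, hN⟩ := hx
      obtain ⟨N', hN'⟩ := hx'
      refine ⟨max N N', fun n hn => ?_⟩
      have h1 := hN n (by omega)
      have h2 := hN' n (by omega)
      simp [h1.1, h1.2, h2.1, h2.2]
    | tmul h b =>
      refine ⟨max
        ((Polynomial.aeval (-Polynomial.X : k[X][X]) f *
          Polynomial.aeval (Polynomial.C Polynomial.X + Polynomial.X : k[X][X]) h).natDegree + 1)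
        ((Polynomial.X * (Polynomial.aeval (-Polynomial.X : k[X]) f * h)).natDegree + 1),
        fun n hn => ?_⟩
      constructor
      · rw [curPart_tmul, curCoeff, LinearMap.mk₂_apply,
          Polynomial.coeff_eq_zero_of_natDegree_lt (by omega), smul_zero, TensorProduct.zero_tmul]
      · rw [formPart_tmul, formCoeff, LinearMap.mk₂_apply,
          Polynomial.coeff_eq_zero_of_natDegree_lt (by omega), smul_zero, zero_mul]

theorem curPart_del_left (n : ℕ) (x y : k[X] ⊗[k] g) :
    curPart n (curDel x) y = -((n : k) • curPart (n - 1) x y) := by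
  have h : (curPart n).comp curDel = (-(n : k)) • curPart (k := k) (g := g) (n - 1) := by
    ext1
    refine LinearMap.ext fun f => LinearMap.ext fun a => TensorProduct.ext' fun h b => ?_
    change curPart n (curDel (f ⊗ₜ[k] a)) (h ⊗ₜ[k] b) =
      (-(n : k)) • curPart (n - 1) (f ⊗ₜ[k] a) (h ⊗ₜ[k] b)
    rw [curDel_tmul, curPart_tmul, curPart_tmul, curCoeff_X_left, ← neg_smul,
      TensorProduct.smul_tmul']
  exact Eq.trans (LinearMap.congr_fun (LinearMap.congr_fun h x) y)
    (neg_smul (n : k) (curPart (n - 1) x y))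

theorem formPart_del_left (n : ℕ) (x y : k[X] ⊗[k] g) :
    formPart form n (curDel x) y = -((n : k) • formPart form (n - 1) x y) := by
  have h : (formPart form n).comp curDel = -((n : k) • formPart form (n - 1)) := by
    ext1
    refine LinearMap.ext fun f => LinearMap.ext fun a => TensorProduct.ext' fun h b => ?_
    change formPart form n (curDel (f ⊗ₜ[k] a)) (h ⊗ₜ[k] b) =
      -((n : k) • formPart form (n - 1) (f ⊗ₜ[k] a) (h ⊗ₜ[k] b))
    rw [curDel_tmul, formPart_tmul, formPart_tmul, formCoeff_X_left, neg_mul, smul_mul_assoc]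
  exact LinearMap.congr_fun (LinearMap.congr_fun h x) y

theorem curPart_del_right (n : ℕ) (x y : k[X] ⊗[k] g) :
    curPart n x (curDel y) = curDel (curPart n x y) + (n : k) • curPart (n - 1) x y := by
  have h : (curPart n).compl₂ curDel =
      (curPart n).compr₂ curDel + (n : k) • curPart (k := k) (g := g) (n - 1) := by
    ext1
    refine LinearMap.ext fun f => LinearMap.ext fun a => TensorProduct.ext' fun h b => ?_
    change curPart n (f ⊗ₜ[k] a) (curDel (h ⊗ₜ[k] b)) =
      curDel (curPart n (f ⊗ₜ[k] a) (h ⊗ₜ[k] b)) +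
        (n : k) • curPart (n - 1) (f ⊗ₜ[k] a) (h ⊗ₜ[k] b)
    rw [curDel_tmul, curPart_tmul, curPart_tmul, curPart_tmul, curCoeff_X_right, curDel_tmul,
      TensorProduct.add_tmul, TensorProduct.smul_tmul']
  exact LinearMap.congr_fun (LinearMap.congr_fun h x) y

theorem formPart_del_right (n : ℕ) (x y : k[X] ⊗[k] g) :
    formPart form n x (curDel y) = (n : k) • formPart form (n - 1) x y := by
  have h : (formPart form n).compl₂ curDel = (n : k) • formPart form (n - 1) := by
    ext1
    refine LinearMap.ext fun f => LinearMap.ext fun a => TensorProduct.ext' fun h b => ?_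
    change formPart form n (f ⊗ₜ[k] a) (curDel (h ⊗ₜ[k] b)) =
      (n : k) • formPart form (n - 1) (f ⊗ₜ[k] a) (h ⊗ₜ[k] b)
    rw [curDel_tmul, formPart_tmul, formPart_tmul, formCoeff_X_right, smul_mul_assoc]
  exact LinearMap.congr_fun (LinearMap.congr_fun h x) y

/-- `K(g)` is a conformal algebra. -/
instance : IsConformal k (KacMoody form) where
  exists_local x y := by
    obtain ⟨u, c⟩ := x
    obtain ⟨v, d⟩ := y
    obtain ⟨N, hN⟩ := exists_bound (form := form) u v
    refine ⟨N, fun n hn => ?_⟩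
    rw [nprod_mk, (hN n hn).1, (hN n hn).2]
    rfl
  del_left n x y := by
    obtain ⟨u, c⟩ := x
    obtain ⟨v, d⟩ := y
    rw [del_mk, nprod_mk, nprod_mk, curPart_del_left, formPart_del_left]
    rfl
  del_right n x y := by
    obtain ⟨u, c⟩ := x
    obtain ⟨v, d⟩ := y
    rw [del_mk, nprod_mk, nprod_mk, nprod_mk, del_mk, curPart_del_right, formPart_del_right]
    refine Eq.trans ?_ (Prod.mk_add_mk _ _ _ _).symm
    simp
    rfl

/-- Every property of elements of `K(g)` that is linear and stable under `∂` follows from the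
cases `1 ⊗ a` and `e`. -/
theorem induction_gen {p : KacMoody form → Prop} (hcur : ∀ a, p (cur form a)) (he : p (e form))
    (hadd : ∀ x y, p x → p y → p (x + y)) (hsmul : ∀ (c : k) x, p x → p (c • x))
    (hdel : ∀ x, p x → p (del k x)) (x : KacMoody form) : p x := by
  have hX : ∀ (i : ℕ) (a : g), p ((((Polynomial.X : k[X]) ^ i) ⊗ₜ[k] a, (0 : k)) :
      (k[X] ⊗[k] g) × k) := by
    intro i a
    induction i with
    | zero => rw [pow_zero]; exact hcur a
    | succ i ih =>
      have h := hdel _ ih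
      have h2 : del k (C := KacMoody form)
          ((((Polynomial.X : k[X]) ^ i) ⊗ₜ[k] a, (0 : k)) : (k[X] ⊗[k] g) × k) =
          ((((Polynomial.X : k[X]) ^ (i + 1)) ⊗ₜ[k] a, (0 : k)) : (k[X] ⊗[k] g) × k) := by
        rw [del_mk, curDel_tmul, pow_succ']
      rwa [h2] at h
  have hzero : p 0 := by
    have h := hsmul 0 _ he
    rwa [zero_smul] at h
  have hfst : ∀ u : k[X] ⊗[k] g, p ((u, (0 : k)) : (k[X] ⊗[k] g) × k) := by
    intro u
    induction u with
    | zero => exact hzero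
    | add u v hu hv =>
      have h := hadd _ _ hu hv
      have h2 : ((u, (0 : k)) : (k[X] ⊗[k] g) × k) + (v, (0 : k)) = (u + v, (0 : k)) := by simp
      exact h2 ▸ h
    | tmul f a =>
      induction f using Polynomial.induction_on' with
      | add f f' hf hf' =>
        have h := hadd _ _ hf hf'
        have h2 : ((f ⊗ₜ[k] a, (0 : k)) : (k[X] ⊗[k] g) × k) + (f' ⊗ₜ[k] a, (0 : k)) =
          ((f + f') ⊗ₜ[k] a, (0 : k)) := by simp [TensorProduct.add_tmul]
        exact h2 ▸ h
      | monomial i c =>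
        have h := hsmul c _ (hX i a)
        have h2 : c • ((((Polynomial.X : k[X]) ^ i) ⊗ₜ[k] a, (0 : k)) : (k[X] ⊗[k] g) × k) =
            (Polynomial.monomial i c ⊗ₜ[k] a, (0 : k)) := by
          rw [Prod.smul_mk, smul_zero, TensorProduct.smul_tmul', ← Polynomial.C_mul_X_pow_eq_monomial,
            Polynomial.smul_eq_C_mul]
        exact h2 ▸ h
  obtain ⟨u, c⟩ := x
  have h := hadd _ _ (hfst u) (hsmul c _ he)
  have h2 : ((u, (0 : k)) : (k[X] ⊗[k] g) × k) + c • ((0 : k[X] ⊗[k] g), (1 : k)) = (u, c) := by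
    simp
  exact h2 ▸ h

theorem cur_add (a b : g) : cur form (a + b) = cur form a + cur form b := by
  refine Eq.trans ?_ (Prod.mk_add_mk _ _ _ _).symm
  rw [← TensorProduct.tmul_add, add_zero]
  rfl

theorem cur_smul (c : k) (a : g) : cur form (c • a) = c • cur form a := by
  refine Eq.trans ?_ (Prod.smul_mk _ _ _).symm
  rw [smul_zero, ← TensorProduct.tmul_smul]
  rfl

theorem rev_cur (n : ℕ) (a b : g) : rev k n (cur form a) (cur form b) =
    if n = 0 then cur form ⁅a, b⁆ else if n = 1 then -(form a b • e form) else 0 := by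
  have h : LocalAt k 2 (cur form a) (cur form b) := fun n hn => by
    rw [nprod_cur, if_neg (by omega), if_neg (by omega)]
  rw [rev_eq_sum h, Finset.sum_range_succ, Finset.sum_range_one]
  rcases n with _ | _ | n
  · simp [nprod_cur, del_e]
  · simp [nprod_cur]
  · simp [nprod_cur]

theorem rev_e_left (n : ℕ) (x : KacMoody form) : rev k n (e form) x = 0 := by
  have h : LocalAt k 0 (e form) x := fun n _ => nprod_e_left n x
  rw [rev_eq_sum h, Finset.sum_range_zero]

theorem rev_e_right (n : ℕ) (x : KacMoody form) : rev k n x (e form) = 0 := by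
  have h : LocalAt k 0 x (e form) := fun n _ => nprod_e_right n x
  rw [rev_eq_sum h, Finset.sum_range_zero]

theorem nprod_cur_succ (n : ℕ) (a b : g) : nprod k (n + 1) (cur form a) (cur form b) =
    (if n = 0 then form a b else 0) • e form := by
  rw [nprod_cur, if_neg (by omega)]
  rcases n with _ | n <;> simp

theorem jacobi_cur (hinv : ∀ a b c, form ⁅a, b⁆ c = form a ⁅b, c⁆)
    (a b c : g) : JacobiAt k (cur form a) (cur form b) (cur form c) := by
  have hr : ∀ (j : ℕ) (w : KacMoody form) (t : k), nprod k j w (t • e form) = 0 := fun j w t => by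
    have := nprod_e_right j w
    simp_all [nprod]
  have hl : ∀ (j : ℕ) (w : KacMoody form) (t : k), nprod k j (t • e form) w = 0 := fun j w t => by
    have := nprod_e_left j w
    simp_all [nprod]
  have h0 : ∀ a b : g, nprod k 0 (cur form a) (cur form b) = cur form ⁅a, b⁆ := fun a b => by
    rw [nprod_cur, if_pos rfl]
  intro n m
  rw [Finset.sum_range_succ']
  have hsum : ∑ s ∈ Finset.range n, (n.choose (s + 1) : k) • nprod k (n + m - (s + 1))
      (nprod k (s + 1) (cur form a) (cur form b)) (cur form c) = 0 :=
    Finset.sum_eq_zero fun s _ => by rw [nprod_cur_succ, hl, smul_zero]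
  rw [hsum, zero_add, Nat.choose_zero_right, Nat.cast_one, one_smul, Nat.sub_zero, h0]
  rcases n with _ | n
  · rcases m with _ | m
    · simp only [h0, add_zero]
      rw [leibniz_lie a b c, ← sub_eq_zero, add_comm, cur_add]
      abel
    · rw [h0, zero_add, nprod_cur_succ, hr, nprod_cur_succ, nprod_cur_succ, zero_sub, ← neg_smul]
      have h1 : form ⁅a, b⁆ c = -form b ⁅a, c⁆ := by
        rw [← lie_skew, map_neg, LinearMap.neg_apply, hinv]
      rcases m with _ | m <;> simp [h1]
  · rcases m with _ | m
    · rw [h0, add_zero, nprod_cur_succ, nprod_cur_succ, hr, sub_zero, nprod_cur_succ, hinv]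
    · rw [nprod_cur_succ, nprod_cur_succ, hr, hr, show n + 1 + (m + 1) = (n + m + 1) + 1 by omega,
        nprod_cur_succ, if_neg (by omega), zero_smul, sub_zero]

/-- `K(g)` is a Lie conformal algebra if the form is symmetric and invariant. -/
theorem isLie [CharZero k] (hsymm : form.IsSymm) (hinv : ∀ a b c, form ⁅a, b⁆ c = form a ⁅b, c⁆) :
    IsLie k (KacMoody form) where
  skew n x y := by
    have H : SkewAt k x y := by
      induction x using induction_gen with
      | hadd x x' h h' =>
        intro n
        have h1 := h n
        have h2 := h' n
        simp only [nprod, map_add, LinearMap.add_apply, rev_add_right, neg_add] at *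
        rw [h1, h2]
      | hsmul c x h =>
        intro n
        have h1 := h n
        simp only [nprod, map_smul, LinearMap.smul_apply, rev_smul_right] at *
        rw [h1, smul_neg]
      | hdel x h => exact h.del_left
      | he => intro n; rw [nprod_e_left, rev_e_right, neg_zero]
      | hcur a =>
        induction y using induction_gen with
        | hadd x x' h h' =>
          intro n
          have h1 := h n
          have h2 := h' n
          simp only [nprod, map_add, rev_add_left, neg_add] at *
          rw [h1, h2]
        | hsmul c x h =>
          intro n
          have h1 := h n
          simp only [nprod, map_smul, rev_smul_left] at *
          rw [h1, smul_neg]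
        | hdel x h => exact h.del_right
        | he => intro n; rw [nprod_e_right, rev_e_left, neg_zero]
        | hcur b =>
          intro n
          rw [nprod_cur, rev_cur]
          rcases n with _ | _ | n
          · rw [if_pos rfl, if_pos rfl, ← lie_skew, ← neg_one_smul k ⁅b, a⁆, cur_smul, neg_one_smul]
          · have := hsymm.eq a b
            simp_all
          · simp
    exact H n
  jacobi n m x y z := by
    have H : JacobiAt k x y z := by
      induction x using induction_gen with
      | hadd x x' h h' =>
        intro n m
        have h1 := h n m
        have h2 := h' n m
        simp only [nprod, map_add, LinearMap.add_apply, smul_add, Finset.sum_add_distrib] at *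
        rw [← h1, ← h2]
        abel
      | hsmul c x h =>
        intro n m
        have h1 := h n m
        simp only [nprod, map_smul, LinearMap.smul_apply, smul_comm _ c, ← Finset.smul_sum,
          ← smul_sub] at *
        rw [h1]
      | hdel x h => exact h.del_left
      | he =>
        intro n m
        have h0 : ∀ (j : ℕ) (w : KacMoody form), nprod k j 0 w = 0 := fun j w => by simp [nprod]
        have h1 : ∀ (j : ℕ) (w : KacMoody form), nprod k j w 0 = 0 := fun j w => by simp [nprod]
        simp [nprod_e_left, h0, h1]
      | hcur a =>
        induction y using induction_gen with
        | hadd x x' h h' =>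
          intro n m
          have h1 := h n m
          have h2 := h' n m
          simp only [nprod, map_add, LinearMap.add_apply, smul_add, Finset.sum_add_distrib] at *
          rw [← h1, ← h2]
          abel
        | hsmul c x h =>
          intro n m
          have h1 := h n m
          simp only [nprod, map_smul, LinearMap.smul_apply, smul_comm _ c, ← Finset.smul_sum,
            ← smul_sub] at *
          rw [h1]
        | hdel x h => exact h.del_middle
        | he =>
          intro n m
          have h0 : ∀ (j : ℕ) (w : KacMoody form), nprod k j 0 w = 0 := fun j w => by simp [nprod]
          have h1 : ∀ (j : ℕ) (w : KacMoody form), nprod k j w 0 = 0 := fun j w => by simp [nprod]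
          simp [nprod_e_left, nprod_e_right, h0, h1]
        | hcur b =>
          induction z using induction_gen with
          | hadd x x' h h' =>
            intro n m
            have h1 := h n m
            have h2 := h' n m
            simp only [nprod, map_add, smul_add, Finset.sum_add_distrib] at *
            rw [← h1, ← h2]
            abel
          | hsmul c x h =>
            intro n m
            have h1 := h n m
            simp only [nprod, map_smul, smul_comm _ c, ← Finset.smul_sum, ← smul_sub] at *
            rw [h1]
          | hdel x h => exact h.del_right
          | he =>
            intro n m
            have h1 : ∀ (j : ℕ) (w : KacMoody form), nprod k j w 0 = 0 := fun j w => by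
              simp [nprod]
            simp [nprod_e_right, h1]
          | hcur c => exact jacobi_cur hinv a b c
    exact H n m

/-- The generating set `X = X₁ ∪ {e}` of `K(g)` given by a linear basis `X₁` of `g`. -/
def gens (form : LinearMap.BilinForm k g) {Y : Type*} (X₁ : Module.Basis Y k g) :
    Set (KacMoody form) :=
  Set.range (fun y => cur form (X₁ y)) ∪ {e form}

/-- `X₁ ∪ {e}` generates `K(g)`. -/
theorem generates_gens {Y : Type*} (X₁ : Module.Basis Y k g) : Generates k (gens form X₁) := by
  intro S hX hD _
  refine eq_top_iff.2 fun x _ => ?_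
  clear * - hX hD
  induction x using induction_gen with
  | hcur a =>
    induction X₁.mem_span a using Submodule.span_induction with
    | zero =>
      have h := cur_smul (form := form) 0 (0 : g)
      rw [zero_smul, zero_smul] at h
      rw [h]
      exact S.zero_mem
    | add a b _ _ ha hb => rw [cur_add]; exact S.add_mem ha hb
    | smul c a _ ha => rw [cur_smul]; exact S.smul_mem c ha
    | mem a ha =>
      obtain ⟨y, rfl⟩ := ha
      exact hX (Or.inl ⟨y, rfl⟩)
  | he => exact hX (Or.inr rfl)
  | hadd x y hx hy => exact S.add_mem hx hy
  | hsmul c x hx => exact S.smul_mem c hx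
  | hdel x hx => exact hD x hx

end KacMoody

end KacMoody

/-! ### Ordered conformal monomials -/

/-- The four families of ordered conformal monomials over a linearly ordered alphabet `Y`;
`xs = [x₁, …, xₙ]` and `ys = [y₁, …, yₘ]` are the superscripts of the operators `L₀` and `L₁`. -/
inductive Monomial (Y : Type*) [LinearOrder Y]
  /-- `L₀^{x₁} … L₀^{xₙ} L₁^{y₁} … L₁^{yₘ} L₂^z u` with `xᵢ ≤ xᵢ₊₁` and
  `y₁ ≤ … ≤ yₘ ≤ z ≤ u`. -/
  | fam₁ (xs ys : List Y) (z u : Y) (hx : xs.Pairwise (· ≤ ·))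
      (hy : (ys ++ [z, u]).Pairwise (· ≤ ·))
  /-- `L₀^{x₁} … L₀^{xₙ} L₁^{y₁} … L₁^{yₘ} ∂^s z` with `xᵢ ≤ xᵢ₊₁`, `y₁ ≤ … ≤ yₘ ≤ z`
  and `s ≥ 1`. -/
  | fam₂ (xs ys : List Y) (s : ℕ) (z : Y) (hx : xs.Pairwise (· ≤ ·))
      (hy : (ys ++ [z]).Pairwise (· ≤ ·)) (hs : 1 ≤ s)
  /-- `L₀^{x₁} … L₀^{xₙ} L₁^{y₁} … L₁^{yₘ} z` with `xᵢ ≤ xᵢ₊₁`, `y₁ ≤ … ≤ yₘ ≤ z`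
  and `m = 0` or `m ≥ 2`. -/
  | fam₃ (xs ys : List Y) (z : Y) (hx : xs.Pairwise (· ≤ ·))
      (hy : (ys ++ [z]).Pairwise (· ≤ ·)) (hm : ys.length = 0 ∨ 2 ≤ ys.length)
  /-- `L₀^{x₁} … L₀^{xₙ} L₁^y z` with `xᵢ ≤ xᵢ₊₁` and (`xₙ ≤ y` or `y ≤ z`); there is no
  condition on `y`, `z` if `n = 0`. -/
  | fam₄ (xs : List Y) (y z : Y) (hx : xs.Pairwise (· ≤ ·))
      (hy : (∀ x ∈ xs.getLast?, x ≤ y) ∨ y ≤ z)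

section Eval

variable (k : Type*) {C : Type*} [Field k] [AddCommGroup C] [Module k C] [Ops k C]
  {Y : Type*}

/-- `L_n^{x₁} … L_n^{xᵣ} v`, where `L_n^x v = x ₍ₙ₎ v` and letters `x` act through `ι : Y → C`. -/
def opL (ι : Y → C) (n : ℕ) (xs : List Y) (v : C) : C :=
  xs.foldr (fun x w => nprod k n (ι x) w) v

/-- The value of a monomial in a conformal algebra `C`, given the values `ι : Y → C` of the
letters. -/
noncomputable def Monomial.eval [LinearOrder Y] (ι : Y → C) : Monomial Y → C
  | .fam₁ xs ys z u _ _ => opL k ι 0 xs (opL k ι 1 ys (nprod k 2 (ι z) (ι u)))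
  | .fam₂ xs ys s z _ _ _ =>
      opL k ι 0 xs (opL k ι 1 ys (((del k : Module.End k C) ^ s) (ι z)))
  | .fam₃ xs ys z _ _ _ => opL k ι 0 xs (opL k ι 1 ys (ι z))
  | .fam₄ xs y z _ _ => opL k ι 0 xs (nprod k 1 (ι y) (ι z))

end Eval

section KacMoodyEnv

variable {k : Type*} [Field k] {g : Type*} [LieRing g] [LieAlgebra k g]

/-- The universal associative conformal envelope `U(K(g); X₁ ∪ {e}, N = 3)` for a linear basis
`X₁` of `g`. -/
abbrev KacMoody.Env₃ (form : LinearMap.BilinForm k g) {Y : Type*} (X₁ : Module.Basis Y k g) :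
    Type _ :=
  Env k (X := KacMoody.gens form X₁) fun _ _ => 3

/-- The generator of `U(K(g); X₁ ∪ {e}, N = 3)` corresponding to a basis element of `g`. -/
noncomputable def KacMoody.Env₃.of (form : LinearMap.BilinForm k g) {Y : Type*}
    (X₁ : Module.Basis Y k g) (y : Y) : KacMoody.Env₃ form X₁ :=
  Env.of k _ ⟨KacMoody.cur form (X₁ y), Or.inl ⟨y, rfl⟩⟩

/-- The generator `e` of `U(K(g); X₁ ∪ {e}, N = 3)`. -/
noncomputable def KacMoody.Env₃.e (form : LinearMap.BilinForm k g) {Y : Type*}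
    (X₁ : Module.Basis Y k g) : KacMoody.Env₃ form X₁ :=
  Env.of k _ ⟨KacMoody.e form, Or.inr rfl⟩

end KacMoodyEnv

end ConformalAlg

/-! Spanning and linear independence have separate proofs.

Spanning. Both algebras are generated by elements that are pairwise local of order three and whose
commutators are combinations of generators and of a torsion element e (`IsCurrent`; e = 0 in the
commutative case). In characteristic 0 all products with a torsion element vanish. Filter by the
number of letters. By the commutator formula `nprod_commutator` the operators L_n^x commute up to
shorter words. Locality then eliminates L_n for n ≥ 2 except in L_2^z u, leaving words with
operators L_0 in front, then operators L_1, applied to ∂^s z or L_2^z u. What remains is sorting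
modulo shorter words. The letters after the L_0's are sorted by `rel_two` and `high_symm` if L_2
occurs, by `rel_swap` if ∂ occurs, by `low_swap` for at least three letters without ∂. For two
letters L_1^y z only the three-term relation `cyclic`, which involves a preceding L_0^x, is
available; this produces the condition in the fourth family.

Independence in the commutative algebra. Over the polynomial ring in a_y, b_y the sequences n ↦ a_y
- n b_y are local of order three, because a product of two linear functions is quadratic, and they
generate a commutative algebra. A monomial becomes a polynomial in n whose leading coefficient is,
up to a nonzero scalar, the product of the a's of the L_0 letters and the b's of the others. Degree
and leading coefficient separate all monomials except L_1^y z from L_1^z y, and these differ in the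
antisymmetric constant coefficient a_y b_z - a_z b_y.

Independence in the envelope. This is a Poincaré–Birkhoff–Witt argument. The modes x(n) act on
functionals on the free algebra in the symbols x(n) that respect the affine commutation relations
and are quadratic under opposite shifts of two modes. A functional given on short words is extended
one length at a time (`Compat.exists_succ`): a new word receives the total of the commutator terms
met while sorting its letters, and the Jacobi and cocycle identities make this independent of the
path (`IsIncrement.sortCost_sub`). The sort compares only the letters in Y, so it does not depend on
the modes and locality is inherited. In the longest words the extension may start from any
functional of the commutative model, which reduces independence to the previous case; a functional
of level 1 detects e. -/

namespace ConformalAlg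

/-! ### Homomorphisms from the free associative conformal algebra without locality of the target -/

section RawLift

variable {k : Type*} [Field k]

/-- A map on generators extends to the free associative conformal algebra as soon as the target
satisfies sesquilinearity and associativity and the images of the generators are local. -/
theorem FreeAssoc.exists_hom {X : Type*} {N : X → X → ℕ} {C : Type*} [AddCommGroup C] [Module k C]
    [Ops k C] [IsAssoc k C]
    (hl : ∀ (n : ℕ) (a b : C), nprod k n (del k a) b = -((n : k) • nprod k (n - 1) a b))
    (hr : ∀ (n : ℕ) (a b : C),
      nprod k n a (del k b) = del k (nprod k n a b) + (n : k) • nprod k (n - 1) a b)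
    (f : X → C) (hf : ∀ x y, LocalAt k (N x y) (f x) (f y)) :
    ∃ g : FreeAssoc k N →ₗ[k] C, IsHom g ∧ ∀ x, g (FreeAssoc.of k N x) = f x := by
  let ev : Word X → C := fun u =>
    Word.rec (motive := fun _ => C) f (fun _ a => del k a) (fun n _ _ a b => nprod k n a b) u
  let F : (Word X →₀ k) →ₗ[k] C := Finsupp.linearCombination k ev
  have hF : IsHom F := by
    constructor
    · intro a
      induction a using Finsupp.induction_linear with
      | zero => simp
      | add a b ha hb => simp only [map_add, ha, hb]
      | single u c =>
        rw [del_single]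
        simp [F, ev]
    · intro n a b
      induction a using Finsupp.induction_linear with
      | zero => simp [nprod]
      | add a a' ha hb =>
        simp only [nprod, map_add, LinearMap.add_apply] at *
        rw [ha, hb]
      | single u c =>
        induction b using Finsupp.induction_linear with
        | zero => simp [nprod]
        | add a a' ha hb =>
          simp only [nprod, map_add] at *
          rw [ha, hb]
        | single v d =>
          rw [nprod_single]
          simp only [F, ev, nprod, Finsupp.linearCombination_single, map_smul,
            LinearMap.smul_apply, smul_smul]
          rw [mul_comm]
  have hgen : ∀ x, F (Finsupp.single (Word.gen x) 1) = f x := fun x => by simp [F, ev]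
  -- The defining relations ask for locality of the generators only. This matters for spaces of all
  -- distributions, where arbitrary pairs are not local.
  obtain ⟨g, hg, hgF⟩ := exists_lift k (S := {f | AssocRel k N f}) hF (by
    rintro _ (⟨n, a, b⟩ | ⟨n, a, b⟩ | ⟨n, m, a, b, c⟩ | ⟨x, y, n, h⟩)
    · rw [map_add, map_smul, hF.map_nprod, hF.map_nprod, hF.map_del, hl, neg_add_cancel]
    · rw [map_sub, map_add, map_smul, hF.map_del, hF.map_nprod, hF.map_nprod, hF.map_nprod,
        hF.map_del, hr, sub_self]
    · simp only [map_sub, map_sum, map_smul, hF.map_nprod]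
      rw [IsAssoc.assoc, sub_self]
    · rw [hF.map_nprod, hgen, hgen]
      exact hf x y n h)
  exact ⟨g, hg, fun x => by rw [FreeAssoc.of, hgF, hgen]⟩

/-- The free associative conformal algebra is generated by its generators. -/
theorem FreeAssoc.induction {X : Type*} {N : X → X → ℕ} {p : FreeAssoc k N → Prop}
    (hof : ∀ x, p (FreeAssoc.of k N x)) (hzero : p 0) (hadd : ∀ a b, p a → p b → p (a + b))
    (hsmul : ∀ (c : k) a, p a → p (c • a)) (hdel : ∀ a, p a → p (del k a))
    (hprod : ∀ n a b, p a → p b → p (nprod k n a b)) (a : FreeAssoc k N) : p a := by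
  obtain ⟨a, rfl⟩ := Submodule.mkQ_surjective _ a
  induction a using Finsupp.induction_linear with
  | zero => rw [map_zero]; exact hzero
  | add a b ha hb => rw [map_add]; exact hadd _ _ ha hb
  | single u c =>
    have hu : p ((idealSpan k {f | AssocRel k N f}).mkQ (Finsupp.single u 1)) := by
      induction u with
      | gen x => exact hof x
      | del u ih =>
        have h : (Finsupp.single (Word.del u) 1 : Word X →₀ k) = del k (Finsupp.single u 1) :=
          (del_single k u 1).symm
        rw [h, (isHom_mkQ k _).map_del]
        exact hdel _ ih
      | prod n u v ihu ihv =>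
        have h : (Finsupp.single (Word.prod n u v) 1 : Word X →₀ k) =
            nprod k n (Finsupp.single u 1) (Finsupp.single v 1) := by rw [nprod_single, one_mul]
        rw [h, (isHom_mkQ k _).map_nprod]
        exact hprod _ _ _ ihu ihv
    rw [← mul_one c, ← smul_eq_mul, ← Finsupp.smul_single, map_smul]
    exact hsmul _ _ hu

end RawLift

/-! ### Formal distributions -/

/-- Formal distributions `∑ a(n) z^(-n-1)` over `A`, given by their modes. -/
def Dist (A : Type*) : Type _ := ℤ → A

namespace Dist

variable (k : Type*) (A : Type*)

@[ext] theorem ext {A : Type*} {a b : Dist A} (h : ∀ m : ℤ, a m = b m) : a = b := funext h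

variable [Field k] [Ring A] [Algebra k A]

instance : AddCommGroup (Dist A) := inferInstanceAs (AddCommGroup (ℤ → A))

instance : Module k (Dist A) := inferInstanceAs (Module k (ℤ → A))

variable {A}

theorem add_apply (a b : Dist A) (m : ℤ) : (a + b) m = a m + b m := rfl
theorem sub_apply (a b : Dist A) (m : ℤ) : (a - b) m = a m - b m := rfl
theorem neg_apply (a : Dist A) (m : ℤ) : (-a) m = -a m := rfl
theorem zero_apply (m : ℤ) : (0 : Dist A) m = 0 := rfl
theorem smul_apply (c : k) (a : Dist A) (m : ℤ) : (c • a) m = c • a m := rfl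

theorem sum_apply {ι : Type*} (s : Finset ι) (f : ι → Dist A) (m : ℤ) :
    (∑ i ∈ s, f i) m = ∑ i ∈ s, f i m := Finset.sum_apply (M := fun _ : ℤ => A) m s f

/-- The derivation `-(d/dz)` up to sign conventions: `(∂a)(m) = -m a(m-1)`; and the products
`(a ₍ₙ₎ b)(m) = ∑ₛ (-1)^s (n choose s) a(n-s) b(m+s)`. -/
noncomputable instance : Ops k (Dist A) where
  D :=
    { toFun := fun a m => (-m : k) • a (m - 1)
      map_add' := fun a b => funext fun m => smul_add (-m : k) (a (m - 1)) (b (m - 1))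
      map_smul' := fun c a => funext fun m => smul_comm (-m : k) c (a (m - 1)) }
  prod n := LinearMap.mk₂ k
    (fun a b m => ∑ s ∈ Finset.range (n + 1),
      ((-1 : k) ^ s * (n.choose s : k)) • (a (n - s) * b (m + s)))
    (fun a a' b => funext fun m => by
      refine Eq.trans ?_ Finset.sum_add_distrib
      simp only [add_apply, add_mul, smul_add])
    (fun c a b => funext fun m => by
      change _ = c • ∑ s ∈ Finset.range (n + 1),
        ((-1 : k) ^ s * (n.choose s : k)) • (a (n - s) * b (m + s))
      rw [Finset.smul_sum]
      refine Finset.sum_congr rfl fun s _ => ?_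
      change _ • ((c • a (n - s)) * b (m + s)) = _
      rw [smul_mul_assoc, smul_comm])
    (fun a b b' => funext fun m => by
      refine Eq.trans ?_ Finset.sum_add_distrib
      simp only [add_apply, mul_add, smul_add])
    (fun c a b => funext fun m => by
      change _ = c • ∑ s ∈ Finset.range (n + 1),
        ((-1 : k) ^ s * (n.choose s : k)) • (a (n - s) * b (m + s))
      rw [Finset.smul_sum]
      refine Finset.sum_congr rfl fun s _ => ?_
      change _ • (a (n - s) * (c • b (m + s))) = _
      rw [mul_smul_comm, smul_comm])

theorem del_apply (a : Dist A) (m : ℤ) : (del k a) m = (-m : k) • a (m - 1) := rfl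

theorem nprod_apply (n : ℕ) (a b : Dist A) (m : ℤ) : (nprod k n a b) m =
    ∑ s ∈ Finset.range (n + 1), ((-1 : k) ^ s * (n.choose s : k)) • (a (n - s) * b (m + s)) :=
  rfl

theorem nprod_del_left (n : ℕ) (a b : Dist A) :
    nprod k n (del k a) b = -((n : k) • nprod k (n - 1) a b) := by
  ext m
  rw [neg_apply, smul_apply, nprod_apply, nprod_apply]
  rcases n with _ | n
  · simp [del_apply]
  · rw [Finset.sum_range_succ, Nat.add_sub_cancel, Finset.smul_sum, ← Finset.sum_neg_distrib]
    rw [del_apply]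
    simp only [Nat.cast_add, Nat.cast_one, sub_self, Int.cast_zero, neg_zero, zero_smul, zero_mul,
      smul_zero, add_zero]
    refine Finset.sum_congr rfl fun s hs => ?_
    have hs' : s ≤ n := by have := Finset.mem_range.1 hs; omega
    rw [del_apply, smul_mul_assoc, smul_smul, smul_smul, ← neg_smul]
    have h : ((n + 1 : ℕ) : k) * (n.choose s : k) = ((n + 1).choose s : k) * ((n : k) + 1 - s) := by
      have := Nat.choose_mul_succ_eq n s
      have h2 : ((n + 1 - s : ℕ) : k) = (n : k) + 1 - s := by
        rw [Nat.cast_sub (by omega)]; push_cast; ring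
      rw [← h2, ← Nat.cast_mul, ← Nat.cast_mul, mul_comm, this]
    congr 1
    · push_cast at h ⊢
      linear_combination (-1 : k) ^ s * h
    · congr 2
      ring

theorem nprod_del_right (n : ℕ) (a b : Dist A) :
    nprod k n a (del k b) = del k (nprod k n a b) + (n : k) • nprod k (n - 1) a b := by
  ext m
  rw [add_apply, smul_apply, del_apply, nprod_apply, nprod_apply, nprod_apply, ← sub_eq_iff_eq_add',
    Finset.smul_sum, ← Finset.sum_sub_distrib]
  rcases n with _ | n
  · simp [del_apply]
  · rw [Finset.sum_range_succ', Nat.add_sub_cancel, Finset.smul_sum]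
    have h0 : ((-1 : k) ^ 0 * ((n + 1).choose 0 : k)) • (a ((n + 1 : ℕ) - (0 : ℕ)) *
        (del k b) (m + (0 : ℕ))) - (-m : k) • ((-1 : k) ^ 0 * ((n + 1).choose 0 : k)) •
        (a ((n + 1 : ℕ) - (0 : ℕ)) * b (m - 1 + (0 : ℕ))) = 0 := by
      rw [del_apply]
      simp
    rw [h0, add_zero]
    refine Finset.sum_congr rfl fun s hs => ?_
    rw [del_apply, mul_smul_comm, smul_smul, smul_smul]
    have e1 : m + ((s + 1 : ℕ) : ℤ) - 1 = m + s := by push_cast; ring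
    have e2 : m - 1 + ((s + 1 : ℕ) : ℤ) = m + s := by push_cast; ring
    have e3 : ((n + 1 : ℕ) : ℤ) - ((s + 1 : ℕ) : ℤ) = n - s := by push_cast; ring
    rw [e1, e2, e3, ← sub_smul, smul_smul]
    congr 1
    have h : ((n + 1 : ℕ) : k) * (n.choose s : k) = ((n + 1).choose (s + 1) : k) * ((s + 1 : ℕ) : k) := by
      rw [← Nat.cast_mul, ← Nat.cast_mul, Nat.add_one_mul_choose_eq]
    push_cast at h ⊢
    rw [pow_succ]
    linear_combination -(-1 : k) ^ s * h

/-- The linear functional with prescribed values on the monomials in three variables. -/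
noncomputable def trilin (f : ℕ → ℕ → ℕ → A) : MvPolynomial (Fin 3) k →ₗ[k] A :=
  (MvPolynomial.basisMonomials (Fin 3) k).constr k fun d => f (d 0) (d 1) (d 2)

theorem trilin_monomial (f : ℕ → ℕ → ℕ → A) (i j l : ℕ) :
    trilin k f (MvPolynomial.X 0 ^ i * MvPolynomial.X 1 ^ j * MvPolynomial.X 2 ^ l) = f i j l := by
  have h : (MvPolynomial.X 0 ^ i * MvPolynomial.X 1 ^ j * MvPolynomial.X 2 ^ l :
      MvPolynomial (Fin 3) k) = MvPolynomial.basisMonomials (Fin 3) k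
        (Finsupp.single 0 i + Finsupp.single 1 j + Finsupp.single 2 l) := by
    simp [MvPolynomial.X_pow_eq_monomial, MvPolynomial.monomial_mul]
  rw [h, trilin, Module.Basis.constr_basis]
  simp

/-- The coefficients of the `n`-product of distributions are those of (x - y)^n, so that identities
between iterated products reduce to identities between polynomials. -/
theorem sub_pow_eq {R : Type*} [CommRing R] [Algebra k R] (x y : R) (n : ℕ) :
    (x - y) ^ n = ∑ s ∈ Finset.range (n + 1),
      ((-1 : k) ^ s * (n.choose s : k)) • (x ^ (n - s) * y ^ s) := by
  rw [sub_eq_neg_add, add_pow]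
  refine Finset.sum_congr rfl fun s _ => ?_
  rw [Algebra.smul_def, map_mul, map_pow, map_neg, map_one, map_natCast, neg_pow]
  ring

/-- Let x₀^i x₁^j x₂^l stand for a(i) b(j) c(p + l). Both sides are then the value of one linear map
at (x₀ - x₁)^n (x₁ - x₂)^m, expanded directly for the left side and after writing x₀ - x₁ = (x₀ -
x₂) - (x₁ - x₂) for the right side. -/
instance : IsAssoc k (Dist A) where
  assoc n m a b c := by
    ext p
    let f : ℕ → ℕ → ℕ → A := fun i j l => a i * b j * c (p + l)
    let x : Fin 3 → MvPolynomial (Fin 3) k := MvPolynomial.X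
    have h1 : trilin k f ((x 0 - x 1) ^ n * (x 1 - x 2) ^ m) = nprod k m (nprod k n a b) c p := by
      rw [sub_pow_eq k (x 0), sub_pow_eq k (x 1), Finset.sum_mul_sum, Finset.sum_comm, map_sum,
        nprod_apply]
      refine Finset.sum_congr rfl fun t ht => ?_
      have ht' : t ≤ m := by have := Finset.mem_range.1 ht; omega
      rw [map_sum, nprod_apply, Finset.sum_mul, Finset.smul_sum]
      refine Finset.sum_congr rfl fun s hs => ?_
      have hs' : s ≤ n := by have := Finset.mem_range.1 hs; omega
      have : x 0 ^ (n - s) * x 1 ^ s * (x 1 ^ (m - t) * x 2 ^ t) =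
          x 0 ^ (n - s) * x 1 ^ (m - t + s) * x 2 ^ t := by ring
      rw [smul_mul_smul_comm, this, map_smul, trilin_monomial, smul_mul_assoc, smul_smul, mul_comm]
      simp only [f]
      rw [Nat.cast_sub hs', Nat.cast_add, Nat.cast_sub ht']
    have h2 : trilin k f ((x 0 - x 1) ^ n * (x 1 - x 2) ^ m) =
        ∑ s ∈ Finset.range (n + 1), ((-1 : k) ^ s * (n.choose s : k)) •
          nprod k (n - s) a (nprod k (m + s) b c) p := by
      have e : (x 0 - x 1) ^ n * (x 1 - x 2) ^ m =
          ((x 0 - x 2) - (x 1 - x 2)) ^ n * (x 1 - x 2) ^ m := by ring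
      rw [e, sub_pow_eq k (x 0 - x 2), Finset.sum_mul, map_sum]
      refine Finset.sum_congr rfl fun s hs => ?_
      rw [smul_mul_assoc, map_smul, mul_assoc, ← pow_add, add_comm s m, sub_pow_eq k (x 0),
        sub_pow_eq k (x 1), Finset.sum_mul_sum, map_sum, nprod_apply]
      congr 1
      refine Finset.sum_congr rfl fun j hj => ?_
      have hj' : j ≤ n - s := by have := Finset.mem_range.1 hj; omega
      rw [map_sum, nprod_apply, Finset.mul_sum, Finset.smul_sum]
      refine Finset.sum_congr rfl fun i hi => ?_
      have hi' : i ≤ m + s := by have := Finset.mem_range.1 hi; omega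
      have : x 0 ^ (n - s - j) * x 2 ^ j * (x 1 ^ (m + s - i) * x 2 ^ i) =
          x 0 ^ (n - s - j) * x 1 ^ (m + s - i) * x 2 ^ (j + i) := by ring
      rw [smul_mul_smul_comm, this, map_smul, trilin_monomial, mul_smul_comm, smul_smul]
      simp only [f]
      rw [Nat.cast_sub hj', Nat.cast_sub hi', Nat.cast_add, mul_assoc (a _), Nat.cast_add,
        add_assoc p]
    rw [sum_apply, ← h1, h2]
    rfl

end Dist

end ConformalAlg

namespace ConformalAlg

/-! ### Potentials on words

A function `D u a b v` prescribing the increments of a function on words under the transposition of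
two adjacent letters, `u a b v ↦ u b a v`, is integrable as soon as it is compatible with the
Coxeter relations. -/

section Potential

variable {α Y M : Type*} [LinearOrder Y] [AddCommGroup M]

/-- Insertion of a letter into a list sorted by the values of `key`. -/
def insertKey (key : α → Y) (a : α) : List α → List α
  | [] => [a]
  | b :: s => if key a ≤ key b then a :: b :: s else b :: insertKey key a s

/-- Insertion sort by the values of `key`. -/
def sortKey (key : α → Y) : List α → List α
  | [] => []
  | a :: v => insertKey key a (sortKey key v)

/-- The total increment of the transpositions in the insertion of `a` into `s` after the
prefix `u`. -/
def insertCost (key : α → Y) (D : List α → α → α → List α → M) (u : List α) (a : α) : List α → M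
  | [] => 0
  | b :: s => if key a ≤ key b then 0 else D u a b s + insertCost key D (u ++ [b]) a s

/-- The total increment of the transpositions in the insertion sort of `w` after the
prefix `u`. -/
def sortCost (key : α → Y) (D : List α → α → α → List α → M) (u : List α) : List α → M
  | [] => 0
  | a :: v => sortCost key D (u ++ [a]) v + insertCost key D u a (sortKey key v)

theorem insertKey_perm (key : α → Y) (a : α) (s : List α) : (insertKey key a s).Perm (a :: s) := by
  induction s with
  | nil => exact List.Perm.refl _
  | cons b s ih =>
    rw [insertKey]
    split_ifs
    · exact List.Perm.refl _
    · exact (ih.cons b).trans (List.Perm.swap a b s)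

theorem sortKey_perm (key : α → Y) (s : List α) : (sortKey key s).Perm s := by
  induction s with
  | nil => exact List.Perm.refl _
  | cons b s ih => exact (insertKey_perm key b _).trans (ih.cons b)

/-- The compatibility of increments with the Coxeter relations. -/
structure IsIncrement (key : α → Y) (D : List α → α → α → List α → M) : Prop where
  anti : ∀ u a b v, D u a b v = -D u b a v
  tie : ∀ u a b v, key a = key b → D u a b v = 0
  -- Each side adds the increments along one way around the square of two disjoint transpositions.
  -- In `braid` the two sides are the two shortest paths from a b c to c b a.
  far : ∀ u a b x c d w, D u a b (x ++ c :: d :: w) + D (u ++ b :: a :: x) c d w =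
    D (u ++ a :: b :: x) c d w + D u a b (x ++ d :: c :: w)
  braid : ∀ u a b c v, D u a b (c :: v) + D (u ++ [b]) a c v + D u b c (a :: v) =
    D (u ++ [a]) b c v + D u a c (b :: v) + D (u ++ [c]) a b v

/-- Lists that differ at most by a transposition of adjacent letters with equal keys. -/
inductive TieSwap (key : α → Y) : List α → List α → Prop
  | refl (s) : TieSwap key s s
  | swap (a b s) (h : key a = key b) : TieSwap key (a :: b :: s) (b :: a :: s)
  | cons (c) {s s'} (h : TieSwap key s s') : TieSwap key (c :: s) (c :: s')

variable {key : α → Y} {D : List α → α → α → List α → M}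

theorem TieSwap.insertKey {s s' : List α} (h : TieSwap key s s') (c : α) :
    TieSwap key (insertKey key c s) (ConformalAlg.insertKey key c s') := by
  induction h with
  | refl s => exact TieSwap.refl _
  | swap a b s h =>
    simp only [ConformalAlg.insertKey, h]
    split_ifs
    · exact (TieSwap.swap a b s h).cons c
    · exact TieSwap.swap a b _ h
  | cons d h ih =>
    simp only [ConformalAlg.insertKey]
    split_ifs
    · exact (h.cons d).cons c
    · exact ih.cons d

/-- A letter is inserted in front of those with the same key, so two insertions commute unless the
two keys agree, and then the results differ by that tie. -/
theorem tieSwap_insertKey (a b : α) (s : List α) :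
    TieSwap key (insertKey key a (insertKey key b s)) (insertKey key b (insertKey key a s)) := by
  have base : ∀ s : List α, TieSwap key (if key a ≤ key b then a :: b :: s else b :: a :: s)
      (if key b ≤ key a then b :: a :: s else a :: b :: s) := by
    intro s
    split_ifs with h1 h2 h2
    · exact TieSwap.swap a b s (le_antisymm h1 h2)
    · exact TieSwap.refl _
    · exact TieSwap.refl _
    · exact absurd (le_of_not_ge h1) h2
  induction s with
  | nil => exact base []
  | cons d s ih =>
    by_cases ha : key a ≤ key d <;> by_cases hb : key b ≤ key d
    · simpa [insertKey, ha, hb] using base (d :: s)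
    · have : ¬ key b ≤ key a := fun h => hb (h.trans ha)
      simp only [insertKey, ha, hb, this, if_true, if_false]
      exact TieSwap.refl _
    · have : ¬ key a ≤ key b := fun h => ha (h.trans hb)
      simp only [insertKey, ha, hb, this, if_true, if_false]
      exact TieSwap.refl _
    · simp only [insertKey, ha, hb, if_false]
      exact ih.cons d

theorem tieSwap_sortKey (v : List α) (a b : α) (w : List α) :
    TieSwap key (sortKey key (v ++ a :: b :: w)) (sortKey key (v ++ b :: a :: w)) := by
  induction v with
  | nil => exact tieSwap_insertKey a b _
  | cons c v ih => exact ih.insertKey c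

namespace IsIncrement

variable (h : IsIncrement key D)
include h

/-- Every letter that c passes contributes one `far` square, and the sum over the passage
telescopes. -/
theorem insertCost_swap_prefix (u : List α) (a b c : α) (s : List α) : ∀ x : List α,
    insertCost key D (u ++ a :: b :: x) c s - insertCost key D (u ++ b :: a :: x) c s =
      D u a b (x ++ c :: s) - D u a b (x ++ insertKey key c s) := by
  induction s with
  | nil => intro x; simp [insertCost, insertKey]
  | cons d s ih =>
    intro x
    rw [insertCost, insertCost, insertKey]
    split_ifs with hc
    · simp
    · have h1 := h.far u a b x c d s
      have h2 := ih (x ++ [d])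
      simp only [List.append_assoc, List.cons_append, List.nil_append] at h2 ⊢
      rw [add_sub_add_comm, h2, ← sub_eq_zero]
      have h3 := sub_eq_zero.2 h1
      rw [← neg_eq_zero, ← h3]
      abel

theorem sortCost_swap_prefix (u : List α) (a b : α) (w : List α) : ∀ x : List α,
    sortCost key D (u ++ a :: b :: x) w - sortCost key D (u ++ b :: a :: x) w =
      D u a b (x ++ w) - D u a b (x ++ sortKey key w) := by
  induction w with
  | nil => intro x; simp [sortCost, sortKey]
  | cons c w ih =>
    intro x
    have h1 := ih (x ++ [c])
    have h2 := h.insertCost_swap_prefix u a b c (sortKey key w) x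
    rw [sortCost, sortCost, sortKey, add_sub_add_comm, h2]
    simp only [List.append_assoc, List.cons_append, List.nil_append] at h1 ⊢
    rw [h1]
    abel

/-- If both letters pass the head c of the list, `braid` for a, b, c together with two applications
of the prefix lemma reduces the claim to the tail. If only one of them passes, the transposition of
a and b is itself one of the steps counted by the cost. -/
theorem insertCost_comm (a b : α) (s : List α) : ∀ u : List α,
    insertCost key D (u ++ [a]) b s + insertCost key D u a (insertKey key b s) -
      (insertCost key D (u ++ [b]) a s + insertCost key D u b (insertKey key a s)) = D u a b s := by
  have base : ∀ (u s : List α), insertCost key D (u ++ [a]) b s = 0 →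
      insertCost key D (u ++ [b]) a s = 0 →
      insertCost key D u a (b :: s) - insertCost key D u b (a :: s) = D u a b s := by
    intro u s h1 h2
    simp only [insertCost]
    split_ifs with h3 h4 h4
    · rw [h.tie u a b s (le_antisymm h3 h4), sub_zero]
    · rw [h1, h.anti u a b]; abel
    · rw [h2]; abel
    · exact absurd (le_of_not_ge h3) h4
  induction s with
  | nil =>
    intro u
    rw [← base u [] rfl rfl]
    simp [insertCost, insertKey]
  | cons c s ih =>
    intro u
    by_cases ha : key a ≤ key c <;> by_cases hb : key b ≤ key c
    · have h1 : ∀ u, insertCost key D u a (c :: s) = 0 := fun u => by simp [insertCost, ha]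
      have h2 : ∀ u, insertCost key D u b (c :: s) = 0 := fun u => by simp [insertCost, hb]
      have h3 : insertKey key a (c :: s) = a :: c :: s := by simp [insertKey, ha]
      have h4 : insertKey key b (c :: s) = b :: c :: s := by simp [insertKey, hb]
      rw [← base u (c :: s) (h2 _) (h1 _), h1, h2, h3, h4]
      abel
    · have hab : ¬ key b ≤ key a := fun h => hb (h.trans ha)
      have h3 : insertKey key a (c :: s) = a :: c :: s := by simp [insertKey, ha]
      have h4 : insertKey key b (c :: s) = c :: insertKey key b s := by simp [insertKey, hb]
      have h1 : ∀ u t, insertCost key D u a (c :: t) = 0 := fun u t => by simp [insertCost, ha]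
      have h2 : insertCost key D u b (a :: c :: s) =
          D u b a (c :: s) + insertCost key D (u ++ [a]) b (c :: s) := by
        rw [insertCost, if_neg hab]
      rw [h3, h4, h1, h1, h2, h.anti u a b]
      abel
    · have hab : ¬ key a ≤ key b := fun h => ha (h.trans hb)
      have h3 : insertKey key b (c :: s) = b :: c :: s := by simp [insertKey, hb]
      have h4 : insertKey key a (c :: s) = c :: insertKey key a s := by simp [insertKey, ha]
      have h1 : ∀ u t, insertCost key D u b (c :: t) = 0 := fun u t => by simp [insertCost, hb]
      have h2 : insertCost key D u a (b :: c :: s) =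
          D u a b (c :: s) + insertCost key D (u ++ [b]) a (c :: s) := by
        rw [insertCost, if_neg hab]
      rw [h3, h4, h1, h1, h2]
      abel
    · have h3 : insertKey key b (c :: s) = c :: insertKey key b s := by simp [insertKey, hb]
      have h4 : insertKey key a (c :: s) = c :: insertKey key a s := by simp [insertKey, ha]
      have h1 : ∀ u t, insertCost key D u a (c :: t) =
          D u a c t + insertCost key D (u ++ [c]) a t := fun u t => by
        rw [insertCost, if_neg ha]
      have h2 : ∀ u t, insertCost key D u b (c :: t) =
          D u b c t + insertCost key D (u ++ [c]) b t := fun u t => by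
        rw [insertCost, if_neg hb]
      have e1 := h.insertCost_swap_prefix u a c b s []
      have e2 := h.insertCost_swap_prefix u b c a s []
      have e3 := ih (u ++ [c])
      have e4 := h.braid u a b c s
      rw [h3, h4, h1, h1, h2, h2]
      simp only [List.append_assoc, List.cons_append, List.nil_append] at *
      have z1 := sub_eq_zero.2 e1
      have z2 := sub_eq_zero.2 e2
      have z3 := sub_eq_zero.2 e3
      have z4 := sub_eq_zero.2 e4
      rw [← sub_eq_zero]
      -- Only an additive group is available, so the four relations are substituted for four zeros.
      have : (0 : M) = 0 - 0 + 0 - 0 := by abel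
      rw [this]
      nth_rewrite 1 [← z1]
      nth_rewrite 1 [← z2]
      nth_rewrite 1 [← z3]
      nth_rewrite 1 [← z4]
      abel

-- A `far` square in which one transposition is a tie: two of its sides vanish, so the other two
-- agree.
omit [LinearOrder Y] in
theorem eq_of_tieSwap {s s' : List α} (hs : TieSwap key s s') : ∀ u c d x,
    D u c d (x ++ s) = D u c d (x ++ s') := by
  induction hs with
  | refl s => intros; rfl
  | swap a b s hab =>
    intro u c d x
    have h1 := h.far u c d x a b s
    rwa [h.tie _ a b s hab, h.tie _ a b s hab, add_zero, zero_add] at h1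
  | cons e _ ih =>
    intro u c d x
    have := ih u c d (x ++ [e])
    simpa using this

theorem insertCost_tieSwap {s s' : List α} (hs : TieSwap key s s') : ∀ u c,
    insertCost key D u c s = insertCost key D u c s' := by
  induction hs with
  | refl s => intros; rfl
  | swap a b s hab =>
    intro u c
    simp only [insertCost, hab]
    split_ifs
    · rfl
    · have h1 := h.insertCost_swap_prefix u a b c s []
      rw [h.tie _ a b _ hab, h.tie _ a b _ hab, sub_zero, sub_eq_zero] at h1
      have h2 := h.braid u c a b s
      rw [h.tie _ a b _ hab, h.tie _ a b _ hab, add_zero, zero_add] at h2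
      simp only [List.append_assoc, List.cons_append, List.nil_append]
      rw [← add_assoc, ← add_assoc, h1, h2]
  | cons d hs ih =>
    intro u c
    simp only [insertCost]
    split_ifs
    · rfl
    · have := h.eq_of_tieSwap hs u c d []
      simp only [List.nil_append] at this
      rw [ih, this]

/-- The cost of sorting is a potential of the increments. -/
theorem sortCost_sub (a b : α) (w : List α) (v : List α) : ∀ u : List α,
    sortCost key D u (v ++ a :: b :: w) - sortCost key D u (v ++ b :: a :: w) =
      D (u ++ v) a b w := by
  induction v with
  | nil =>
    intro u
    have h1 := h.sortCost_swap_prefix u a b w []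
    have h2 := h.insertCost_comm a b (sortKey key w) u
    simp only [List.nil_append, sortCost, sortKey, List.append_assoc, List.cons_append,
      List.append_nil] at h1 h2 ⊢
    rw [add_assoc, add_assoc, add_sub_add_comm, h1, h2]
    abel
  | cons c v ih =>
    intro u
    have h1 := ih (u ++ [c])
    -- The two sorted tails agree only up to the order of letters with equal keys, which does not
    -- affect the cost of inserting c.
    have h2 := h.insertCost_tieSwap (tieSwap_sortKey (key := key) v a b w) u c
    simp only [List.cons_append, sortCost, h2, List.append_assoc, List.nil_append] at h1 ⊢
    rw [add_sub_add_right_eq_sub, h1]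

end IsIncrement

/-! ### Naturality of sorting costs -/

section Naturality

variable {α' M' : Type*} [AddCommGroup M'] {key' : α' → Y} {D' : List α' → α' → α' → List α' → M'}
  {ev : α' → α} {φ : M' →+ M}

theorem map_insertKey (hk : ∀ a, key (ev a) = key' a) (a : α') (s : List α') :
    (insertKey key' a s).map ev = insertKey key (ev a) (s.map ev) := by
  induction s with
  | nil => rfl
  | cons b s ih =>
    simp only [insertKey, List.map_cons, hk]
    split_ifs
    · rfl
    · rw [List.map_cons, ih]

theorem map_sortKey (hk : ∀ a, key (ev a) = key' a) (s : List α') :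
    (sortKey key' s).map ev = sortKey key (s.map ev) := by
  induction s with
  | nil => rfl
  | cons b s ih => rw [sortKey, map_insertKey hk, ih]; rfl

theorem map_insertCost (hk : ∀ a, key (ev a) = key' a)
    (hD : ∀ u a b v, φ (D' u a b v) = D (u.map ev) (ev a) (ev b) (v.map ev)) (a : α')
    (s : List α') : ∀ u, φ (insertCost key' D' u a s) =
      insertCost key D (u.map ev) (ev a) (s.map ev) := by
  induction s with
  | nil => intro u; exact map_zero φ
  | cons b s ih =>
    intro u
    simp only [insertCost, List.map_cons, hk]
    split_ifs
    · exact map_zero φ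
    · rw [map_add, hD, ih, List.map_append]; rfl

/-- The path of the sort depends on the keys alone, so a substitution that preserves keys carries
one cost to the other. It serves for the evaluation of moving letters at a time t, which leaves the
key fixed. -/
theorem map_sortCost (hk : ∀ a, key (ev a) = key' a)
    (hD : ∀ u a b v, φ (D' u a b v) = D (u.map ev) (ev a) (ev b) (v.map ev))
    (s : List α') : ∀ u, φ (sortCost key' D' u s) = sortCost key D (u.map ev) (s.map ev) := by
  induction s with
  | nil => intro u; exact map_zero φ
  | cons b s ih =>
    intro u
    simp only [sortCost, List.map_cons]
    rw [map_add, ih, map_insertCost hk hD, map_sortKey hk, List.map_append]; rfl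

end Naturality

theorem insertCost_mem (S : AddSubgroup M) (w₀ : List α)
    (hS : ∀ u a b v, (u ++ a :: b :: v).Perm w₀ → D u a b v ∈ S) (a : α) (s : List α) :
    ∀ u, (u ++ a :: s).Perm w₀ → insertCost key D u a s ∈ S := by
  induction s with
  | nil => intro u _; exact S.zero_mem
  | cons b s ih =>
    intro u hu
    rw [insertCost]
    split_ifs
    · exact S.zero_mem
    · refine S.add_mem (hS u a b s hu) (ih _ (List.Perm.trans ?_ hu))
      rw [List.append_assoc]
      exact List.Perm.append_left u (List.Perm.swap a b s)

/-- Sorting only passes through rearrangements of the given word, so increments need to be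
controlled on these alone. -/
theorem sortCost_mem (S : AddSubgroup M) (w₀ : List α)
    (hS : ∀ u a b v, (u ++ a :: b :: v).Perm w₀ → D u a b v ∈ S) (s : List α) :
    ∀ u, (u ++ s).Perm w₀ → sortCost key D u s ∈ S := by
  induction s with
  | nil => intro u _; exact S.zero_mem
  | cons b s ih =>
    intro u hu
    refine S.add_mem (ih _ (by simpa using hu)) (insertCost_mem S w₀ hS b _ u
      (List.Perm.trans (List.Perm.append_left u ((sortKey_perm key s).cons b)) hu))

end Potential

end ConformalAlg

namespace ConformalAlg

/-! ### Functionals on words in the modes of a Lie algebra -/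

section Loop

variable {k : Type*} [Field k] {g : Type*} [LieRing g] [LieAlgebra k g] {Y : Type*}

/-- Polynomial functions of degree at most two of an integer argument. -/
def quad (k : Type*) [Field k] : Submodule k (ℤ → k) where
  carrier := {f | ∃ a b c : k, ∀ t : ℤ, f t = a + b * t + c * t ^ 2}
  add_mem' := by
    rintro f f' ⟨a, b, c, h⟩ ⟨a', b', c', h'⟩
    refine ⟨a + a', b + b', c + c', fun t => ?_⟩
    rw [Pi.add_apply, h, h']
    ring
  zero_mem' := ⟨0, 0, 0, fun t => by simp⟩
  smul_mem' := by
    rintro d f ⟨a, b, c, h⟩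
    refine ⟨d * a, d * b, d * c, fun t => ?_⟩
    rw [Pi.smul_apply, h, smul_eq_mul]
    ring

/-- The word with the given letters in the free algebra. -/
def wd (k : Type*) [Field k] {α : Type*} (w : List α) : FreeAlgebra k α :=
  (w.map (FreeAlgebra.ι k)).prod

/-! ### Words and homogeneous elements of the free algebra -/

section Words

variable {α : Type*}

theorem wd_nil : wd k ([] : List α) = 1 := rfl

theorem wd_cons (a : α) (w : List α) : wd k (a :: w) = FreeAlgebra.ι k a * wd k w := by
  simp [wd]

theorem wd_append (v w : List α) : wd k (v ++ w) = wd k v * wd k w := by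
  simp [wd]

theorem basis_ofList (w : List α) :
    FreeAlgebra.basisFreeMonoid k α (FreeMonoid.ofList w) = wd k w := by
  simp [FreeAlgebra.basisFreeMonoid, FreeAlgebra.equivMonoidAlgebraFreeMonoid,
    FreeMonoid.lift_apply, wd]

/-- The linear functional with prescribed values on words. -/
noncomputable def wordFun {M : Type*} [AddCommGroup M] [Module k M] (f : List α → M) :
    FreeAlgebra k α →ₗ[k] M :=
  (FreeAlgebra.basisFreeMonoid k α).constr k fun w => f w.toList

theorem wordFun_wd {M : Type*} [AddCommGroup M] [Module k M] (f : List α → M) (w : List α) :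
    wordFun f (wd k w) = f w := by
  rw [← basis_ofList, wordFun, Module.Basis.constr_basis]
  rfl

variable (k α) in
/-- The span of the words of length `n`. -/
def homog (n : ℕ) : Submodule k (FreeAlgebra k α) :=
  Submodule.span k {P | ∃ w : List α, w.length = n ∧ P = wd k w}

theorem wd_mem_homog (w : List α) : wd k w ∈ homog k α w.length :=
  Submodule.subset_span ⟨w, rfl, rfl⟩

theorem homog_induction {n : ℕ} {p : ∀ P, P ∈ homog k α n → Prop}
    (hw : ∀ (w : List α) (hl : w.length = n), p (wd k w) (hl ▸ wd_mem_homog w))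
    (hzero : p 0 (zero_mem _))
    (hadd : ∀ P Q hP hQ, p P hP → p Q hQ → p (P + Q) (add_mem hP hQ))
    (hsmul : ∀ (c : k) P hP, p P hP → p (c • P) (Submodule.smul_mem _ c hP))
    {P : FreeAlgebra k α} (hP : P ∈ homog k α n) : p P hP := by
  induction hP using Submodule.span_induction with
  | mem P h =>
    obtain ⟨w, hl, rfl⟩ := h
    exact hw w hl
  | zero => exact hzero
  | add P Q hP hQ h1 h2 => exact hadd _ _ hP hQ h1 h2
  | smul c P hP h => exact hsmul c P hP h

theorem mul_mem_homog {i j : ℕ} {P Q : FreeAlgebra k α} (hP : P ∈ homog k α i)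
    (hQ : Q ∈ homog k α j) : P * Q ∈ homog k α (i + j) := by
  induction hP using homog_induction with
  | hw w hl =>
    induction hQ using homog_induction with
    | hw v hl' => exact Submodule.subset_span ⟨w ++ v, by simp [hl, hl'], (wd_append w v).symm⟩
    | hzero => rw [mul_zero]; exact zero_mem _
    | hadd P Q _ _ h1 h2 => rw [mul_add]; exact add_mem h1 h2
    | hsmul c P _ h => rw [mul_smul_comm]; exact Submodule.smul_mem _ c h
  | hzero => rw [zero_mul]; exact zero_mem _
  | hadd P Q _ _ h1 h2 => rw [add_mul]; exact add_mem h1 h2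
  | hsmul c P _ h => rw [smul_mul_assoc]; exact Submodule.smul_mem _ c h

theorem one_mem_homog : (1 : FreeAlgebra k α) ∈ homog k α 0 := wd_mem_homog (k := k) []

/-- The augmentation of the free algebra. -/
noncomputable abbrev aug (k : Type*) [Field k] {α : Type*} : FreeAlgebra k α →ₐ[k] k :=
  FreeAlgebra.algebraMapInv

theorem aug_ι (a : α) : aug k (FreeAlgebra.ι k a) = 0 := by
  simp [FreeAlgebra.algebraMapInv]

theorem aug_homog {n : ℕ} (hn : n ≠ 0) {P : FreeAlgebra k α} (hP : P ∈ homog k α n) :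
    aug k P = 0 := by
  induction hP using homog_induction with
  | hw w hl =>
    rcases w with _ | ⟨a, w⟩
    · exact absurd hl.symm hn
    · rw [wd_cons, map_mul, aug_ι, zero_mul]
  | hzero => exact map_zero _
  | hadd P Q _ _ h1 h2 => rw [map_add, h1, h2, add_zero]
  | hsmul c P _ h => rw [map_smul, h, smul_zero]

end Words

variable (form : LinearMap.BilinForm k g) (X₁ : Module.Basis Y k g)

/-- The mode `p(m)` of an element of the Lie algebra. -/
noncomputable def modeOf (m : ℤ) : g →ₗ[k] FreeAlgebra k (Y × ℤ) :=
  X₁.constr k fun y => FreeAlgebra.ι k (y, m)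

theorem modeOf_basis (m : ℤ) (y : Y) : modeOf X₁ m (X₁ y) = FreeAlgebra.ι k (y, m) :=
  Module.Basis.constr_basis _ _ _ _

theorem modeOf_mem (m : ℤ) (p : g) : modeOf X₁ m p ∈ homog k (Y × ℤ) 1 := by
  induction X₁.mem_span p using Submodule.span_induction with
  | mem p h =>
    obtain ⟨y, rfl⟩ := h
    rw [modeOf_basis]
    simpa [wd] using wd_mem_homog (k := k) [(y, m)]
  | zero => rw [map_zero]; exact zero_mem _
  | add p q _ _ h1 h2 => rw [map_add]; exact add_mem h1 h2
  | smul c p _ h => rw [map_smul]; exact Submodule.smul_mem _ c h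

/-- The cocycle `m δ_{m+n,0} ⟨p | q⟩`. -/
def cocyc (m : ℤ) (p : g) (n : ℤ) (q : g) : k := if m + n = 0 then (m : k) * form p q else 0

/-- The defect `p(m) q(n) - q(n) p(m) - [p, q](m+n)`. -/
noncomputable def defect (m n : ℤ) : g →ₗ[k] g →ₗ[k] FreeAlgebra k (Y × ℤ) :=
  (LinearMap.mul k (FreeAlgebra k (Y × ℤ))).compl₁₂ (modeOf X₁ m) (modeOf X₁ n) -
    ((LinearMap.mul k (FreeAlgebra k (Y × ℤ))).flip.compl₁₂ (modeOf X₁ m) (modeOf X₁ n)) -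
    KacMoody.bracket.compr₂ (modeOf X₁ (m + n))

theorem defect_apply (m n : ℤ) (p q : g) : defect X₁ m n p q =
    modeOf X₁ m p * modeOf X₁ n q - modeOf X₁ n q * modeOf X₁ m p - modeOf X₁ (m + n) ⁅p, q⁆ := rfl

/-- The letter at time `t` of a moving letter `(y, m, σ)`. -/
def atTime (t : ℤ) (a : Y × ℤ × ℤ) : Y × ℤ := (a.1, a.2.1 + a.2.2 * t)

/-- The slopes of the moving letters of a word have sum `0`, and the sum of their absolute values
is at most `2`. -/
def Balanced (w : List (Y × ℤ × ℤ)) : Prop :=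
  (w.map fun a => a.2.2).sum = 0 ∧ (w.map fun a => a.2.2.natAbs).sum ≤ 2

theorem Balanced.perm {w w' : List (Y × ℤ × ℤ)} (h : Balanced w) (hp : w'.Perm w) : Balanced w' :=
  ⟨(hp.map _).sum_eq.trans h.1, (hp.map _).sum_eq.trans_le h.2⟩

/-- The bracket of two moving letters moves with the sum of their slopes: the total slope is
unchanged and the sum of absolute values does not grow. Hence the shorter words that arise in
reordering are again subject to locality. -/
theorem Balanced.contract {u v : List (Y × ℤ × ℤ)} {a b : Y × ℤ × ℤ}
    (h : Balanced (u ++ a :: b :: v)) (z : Y) (m : ℤ) :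
    Balanced (u ++ (z, m, a.2.2 + b.2.2) :: v) := by
  obtain ⟨h1, h2⟩ := h
  simp only [List.map_append, List.map_cons, List.sum_append, List.sum_cons] at h1 h2
  constructor
  · simp only [List.map_append, List.map_cons, List.sum_append, List.sum_cons]
    omega
  · simp only [List.map_append, List.map_cons, List.sum_append, List.sum_cons]
    have := Int.natAbs_add_le a.2.2 b.2.2
    omega

/-- A functional on words which, on words of length at most `N`, is compatible with the commutation
relations of the affine algebra of `g` (with central terms weighted by `γ` and killed in products
of positive length) and with locality of order three. -/
structure Compat (γ : k) (N : ℕ) (F : FreeAlgebra k (Y × ℤ) →ₗ[k] k) : Prop where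
  comm : ∀ i j, i + j + 2 ≤ N → ∀ P ∈ homog k (Y × ℤ) i, ∀ Q ∈ homog k (Y × ℤ) j, ∀ m n p q,
    F (P * defect X₁ m n p q * Q) = γ * cocyc form m p n q * (aug k P * aug k Q)
  -- The moving letters need not be adjacent; this stronger form of locality is the one that
  -- survives reordering.
  loc : ∀ w : List (Y × ℤ × ℤ), w.length ≤ N → Balanced w →
    (fun t => F (wd k (w.map (atTime t)))) ∈ quad k

variable {form X₁}

/-- It suffices to check the commutation relations on words. -/
theorem comm_of_words {γ : k} {F : FreeAlgebra k (Y × ℤ) →ₗ[k] k} {i j : ℕ}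
    (h : ∀ u v : List (Y × ℤ), u.length = i → v.length = j → ∀ (m n : ℤ) x y,
      F (wd k u * defect X₁ m n (X₁ x) (X₁ y) * wd k v) =
        γ * cocyc form m (X₁ x) n (X₁ y) * (aug k (wd k u) * aug k (wd k v)))
    {P : FreeAlgebra k (Y × ℤ)} (hP : P ∈ homog k (Y × ℤ) i) {Q : FreeAlgebra k (Y × ℤ)}
    (hQ : Q ∈ homog k (Y × ℤ) j) (m n : ℤ) (p q : g) :
    F (P * defect X₁ m n p q * Q) = γ * cocyc form m p n q * (aug k P * aug k Q) := by
  induction hP using homog_induction with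
  | hw u hu =>
    induction hQ using homog_induction with
    | hw v hv =>
      let B : g →ₗ[k] g →ₗ[k] k := (defect X₁ m n).compr₂
        (F ∘ₗ LinearMap.mulRight k (wd k v) ∘ₗ LinearMap.mulLeft k (wd k u))
      let B' : g →ₗ[k] g →ₗ[k] k :=
        (γ * (if m + n = 0 then (m : k) else 0) * (aug k (wd k u) * aug k (wd k v))) • form
      have hB' : ∀ p q, B' p q = γ * cocyc form m p n q * (aug k (wd k u) * aug k (wd k v)) := by
        intro p q
        simp only [B', cocyc, LinearMap.smul_apply, smul_eq_mul]
        split_ifs <;> ring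
      have hBB : B = B' := LinearMap.ext_basis X₁ X₁ fun x y => by
        rw [hB', ← h u v hu hv]
        rfl
      rw [← hB', ← hBB]
      rfl
    | hzero => simp
    | hadd P Q _ _ h1 h2 => simp only [mul_add, map_add, h1, h2]
    | hsmul c P _ h => simp only [mul_smul_comm, map_smul, h, smul_eq_mul]; ring
  | hzero => simp
  | hadd P Q _ _ h1 h2 => simp only [add_mul, map_add, h1, h2]; ring
  | hsmul c P _ h => simp only [smul_mul_assoc, map_smul, h, smul_eq_mul]; ring

/-- The increments of the extension of a functional to the words of length `N + 1`. -/
noncomputable def increment (X₁ : Module.Basis Y k g) (F : FreeAlgebra k (Y × ℤ) →ₗ[k] k) (N : ℕ)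
    (u : List (Y × ℤ)) (a b : Y × ℤ) (v : List (Y × ℤ)) : k :=
  -- The word being reordered has length `N + 1`; its contraction has length `N`, where the
  -- functional is already constrained.
  if u.length + v.length + 1 = N then
    F (wd k u * modeOf X₁ (a.2 + b.2) ⁅X₁ a.1, X₁ b.1⁆ * wd k v) else 0

/-- All conditions follow from the commutation relations in length `N`. For `far`, both differences
equal the value on the word with both pairs contracted. For `braid`, moving the third letter past
the bracket leaves the Jacobi identity and, as central term, the cocycle identity. Ties cost nothing
because [x, x] = 0. -/
theorem isIncrement [LinearOrder Y] (hsymm : form.IsSymm)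
    (hinv : ∀ a b c, form ⁅a, b⁆ c = form a ⁅b, c⁆) {γ : k} {N : ℕ}
    {F : FreeAlgebra k (Y × ℤ) →ₗ[k] k} (hF : Compat form X₁ γ N F) :
    IsIncrement (Prod.fst : Y × ℤ → Y) (increment X₁ F N) where
  anti u a b v := by
    rw [increment, increment]
    split_ifs
    · rw [← lie_skew (X₁ a.1), map_neg, mul_neg, neg_mul, map_neg, add_comm a.2]
    · rw [neg_zero]
  tie u a b v h := by
    rw [increment, h, lie_self, map_zero, mul_zero, zero_mul, map_zero, ite_self]
  far u a b x c d w := by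
    by_cases hN : u.length + x.length + w.length + 3 = N
    · simp only [increment, List.length_append, List.length_cons]
      rw [if_pos (by omega), if_pos (by omega), if_pos (by omega), if_pos (by omega)]
      have h1 := hF.comm (u.length + 1 + x.length) w.length (by omega)
        (wd k u * modeOf X₁ (a.2 + b.2) ⁅X₁ a.1, X₁ b.1⁆ * wd k x)
        (mul_mem_homog (mul_mem_homog (wd_mem_homog u) (modeOf_mem _ _ _)) (wd_mem_homog x))
        (wd k w) (wd_mem_homog w) c.2 d.2 (X₁ c.1) (X₁ d.1)
      have h2 := hF.comm u.length (x.length + 1 + w.length) (by omega) (wd k u) (wd_mem_homog u)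
        (wd k x * modeOf X₁ (c.2 + d.2) ⁅X₁ c.1, X₁ d.1⁆ * wd k w)
        (mul_mem_homog (mul_mem_homog (wd_mem_homog x) (modeOf_mem _ _ _)) (wd_mem_homog w))
        a.2 b.2 (X₁ a.1) (X₁ b.1)
      have e : ∀ m p, aug k (modeOf X₁ m p) = 0 := fun m p =>
        aug_homog one_ne_zero (modeOf_mem X₁ m p)
      simp only [map_mul, e, mul_zero, zero_mul, defect_apply, modeOf_basis, Prod.mk.eta, mul_sub,
        sub_mul, map_sub, mul_assoc] at h1 h2
      simp only [wd_append, wd_cons, mul_assoc]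
      linear_combination h1 - h2
    · simp only [increment, List.length_append, List.length_cons]
      rw [if_neg (by omega), if_neg (by omega), if_neg (by omega), if_neg (by omega)]
  braid u a b c v := by
    by_cases hN : u.length + v.length + 2 = N
    · simp only [increment, List.length_append, List.length_cons, List.length_nil]
      rw [if_pos (by omega), if_pos (by omega), if_pos (by omega), if_pos (by omega),
        if_pos (by omega), if_pos (by omega)]
      have h := fun (m : ℤ) (p : g) (c : Y × ℤ) => hF.comm u.length v.length (by omega) (wd k u)
        (wd_mem_homog u) (wd k v) (wd_mem_homog v) m c.2 p (X₁ c.1)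
      have h1 := h (a.2 + b.2) ⁅X₁ a.1, X₁ b.1⁆ c
      have h2 := h (a.2 + c.2) ⁅X₁ a.1, X₁ c.1⁆ b
      have h3 := h (b.2 + c.2) ⁅X₁ b.1, X₁ c.1⁆ a
      have hj : ⁅⁅X₁ a.1, X₁ b.1⁆, X₁ c.1⁆ - ⁅⁅X₁ a.1, X₁ c.1⁆, X₁ b.1⁆ +
          ⁅⁅X₁ b.1, X₁ c.1⁆, X₁ a.1⁆ = 0 := by
        have e1 : ⁅⁅X₁ a.1, X₁ b.1⁆, X₁ c.1⁆ = -⁅X₁ c.1, ⁅X₁ a.1, X₁ b.1⁆⁆ := (lie_skew _ _).symm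
        have e2 : ⁅⁅X₁ a.1, X₁ c.1⁆, X₁ b.1⁆ = ⁅X₁ b.1, ⁅X₁ c.1, X₁ a.1⁆⁆ := by
          rw [← lie_skew, ← lie_skew (X₁ a.1) (X₁ c.1), lie_neg, neg_neg]
        have e3 : ⁅⁅X₁ b.1, X₁ c.1⁆, X₁ a.1⁆ = -⁅X₁ a.1, ⁅X₁ b.1, X₁ c.1⁆⁆ := (lie_skew _ _).symm
        rw [e1, e2, e3, ← neg_eq_zero, ← lie_jacobi (X₁ a.1) (X₁ b.1) (X₁ c.1)]
        abel
      -- By invariance and symmetry the three values of the form are ± ⟨[a, b] | c⟩, and with these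
      -- signs the coefficient is twice the total mode, which is zero where the cocycle is
      -- supported.
      have hc : cocyc form (a.2 + b.2) ⁅X₁ a.1, X₁ b.1⁆ c.2 (X₁ c.1) -
          cocyc form (a.2 + c.2) ⁅X₁ a.1, X₁ c.1⁆ b.2 (X₁ b.1) +
          cocyc form (b.2 + c.2) ⁅X₁ b.1, X₁ c.1⁆ a.2 (X₁ a.1) = 0 := by
        have e1 : a.2 + c.2 + b.2 = a.2 + b.2 + c.2 := by ring
        have e2 : b.2 + c.2 + a.2 = a.2 + b.2 + c.2 := by ring
        simp only [cocyc, e1, e2]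
        split_ifs with h0
        · have hc2 : c.2 = -(a.2 + b.2) := by omega
          have f1 : form ⁅X₁ a.1, X₁ c.1⁆ (X₁ b.1) = -form ⁅X₁ a.1, X₁ b.1⁆ (X₁ c.1) := by
            rw [hinv, hinv, ← lie_skew, map_neg]
          have f2 : form ⁅X₁ b.1, X₁ c.1⁆ (X₁ a.1) = form ⁅X₁ a.1, X₁ b.1⁆ (X₁ c.1) := by
            rw [hinv (X₁ a.1)]
            exact (hsymm.eq _ _).symm
          rw [f1, f2, hc2]
          push_cast
          ring
        · ring
      have e1 : a.2 + c.2 + b.2 = a.2 + b.2 + c.2 := by ring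
      have e2 : b.2 + c.2 + a.2 = a.2 + b.2 + c.2 := by ring
      have hj' : F (wd k u * (modeOf X₁ (a.2 + b.2 + c.2) ⁅⁅X₁ a.1, X₁ b.1⁆, X₁ c.1⁆ * wd k v)) -
          F (wd k u * (modeOf X₁ (a.2 + b.2 + c.2) ⁅⁅X₁ a.1, X₁ c.1⁆, X₁ b.1⁆ * wd k v)) +
          F (wd k u * (modeOf X₁ (a.2 + b.2 + c.2) ⁅⁅X₁ b.1, X₁ c.1⁆, X₁ a.1⁆ * wd k v)) = 0 := by
        rw [← map_sub, ← map_add, ← mul_sub, ← mul_add, ← sub_mul, ← add_mul, ← map_sub,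
          ← map_add, hj, map_zero, zero_mul, mul_zero, map_zero]
      simp only [defect_apply, modeOf_basis, Prod.mk.eta, mul_sub, sub_mul, map_sub, mul_assoc,
        e1, e2] at h1 h2 h3
      simp only [wd_append, wd_cons, wd_nil, mul_assoc, one_mul]
      linear_combination h1 - h2 + h3 + hj' +
        γ * (aug k (wd k u) * aug k (wd k v)) * hc
    · simp only [increment, List.length_append, List.length_cons, List.length_nil]
      rw [if_neg (by omega), if_neg (by omega), if_neg (by omega), if_neg (by omega),
        if_neg (by omega), if_neg (by omega)]

/-- A compatible functional extends to longer words. -/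
theorem Compat.exists_succ [LinearOrder Y] (hsymm : form.IsSymm)
    (hinv : ∀ a b c, form ⁅a, b⁆ c = form a ⁅b, c⁆) {γ : k} {N : ℕ} (hN : γ = 0 ∨ 2 ≤ N)
    {F : FreeAlgebra k (Y × ℤ) →ₗ[k] k} (hF : Compat form X₁ γ N F) :
    ∃ F' : FreeAlgebra k (Y × ℤ) →ₗ[k] k, Compat form X₁ γ (N + 1) F' ∧
      ∀ i ≤ N, ∀ P ∈ homog k (Y × ℤ) i, F' P = F P := by
  have hI := isIncrement hsymm hinv hF
  -- Sorted words of the new length receive the value 0, every other one the sum of the bracket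
  -- terms met while sorting it by its letters in `Y`.
  let F' : FreeAlgebra k (Y × ℤ) →ₗ[k] k := wordFun fun w =>
    if w.length = N + 1 then sortCost Prod.fst (increment X₁ F N) [] w else F (wd k w)
  have hF' : ∀ i ≤ N, ∀ P ∈ homog k (Y × ℤ) i, F' P = F P := by
    intro i hi P hP
    induction hP using homog_induction with
    | hw w hl => rw [wordFun_wd, if_neg (by omega)]
    | hzero => rw [map_zero, map_zero]
    | hadd P Q _ _ h1 h2 => rw [map_add, map_add, h1, h2]
    | hsmul c P _ h => rw [map_smul, map_smul, h]
  have hF'' : ∀ w : List (Y × ℤ), w.length = N + 1 →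
      F' (wd k w) = sortCost Prod.fst (increment X₁ F N) [] w := by
    intro w hw
    rw [wordFun_wd, if_pos hw]
  refine ⟨F', ⟨?_, ?_⟩, hF'⟩
  · intro i j hij P hP Q hQ m n p q
    refine comm_of_words (fun u v hu hv m n x y => ?_) hP hQ m n p q
    have hu' := wd_mem_homog (k := k) u
    have hv' := wd_mem_homog (k := k) v
    rw [hu] at hu'
    rw [hv] at hv'
    have hM := modeOf_mem X₁ (m + n) ⁅X₁ x, X₁ y⁆
    have hX := modeOf_mem X₁ m (X₁ x)
    have hY := modeOf_mem X₁ n (X₁ y)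
    have hb : F' (wd k u * modeOf X₁ (m + n) ⁅X₁ x, X₁ y⁆ * wd k v) =
        F (wd k u * modeOf X₁ (m + n) ⁅X₁ x, X₁ y⁆ * wd k v) :=
      hF' _ (by omega) _ (mul_mem_homog (mul_mem_homog hu' hM) hv')
    by_cases hlt : i + j + 2 ≤ N
    · rw [← hF.comm i j hlt _ hu' _ hv']
      simp only [defect_apply, mul_sub, sub_mul, map_sub]
      rw [hb, hF' (i + (1 + 1) + j) (by omega) _ (mul_mem_homog (mul_mem_homog hu'
        (mul_mem_homog hX hY)) hv'), hF' (i + (1 + 1) + j) (by omega) _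
        (mul_mem_homog (mul_mem_homog hu' (mul_mem_homog hY hX)) hv')]
    -- In the new length `N + 1` ≥ 3 some letter lies outside the commuted pair, and its
    -- augmentation kills the central term.
    · have h0 : γ * cocyc form m (X₁ x) n (X₁ y) * (aug k (wd k u) * aug k (wd k v)) = 0 := by
        rcases hN with rfl | hN
        · ring
        · by_cases hi : i = 0
          · rw [aug_homog (n := j) (by omega) hv']; ring
          · rw [aug_homog (n := i) hi hu']; ring
      have h1 := hI.sortCost_sub (x, m) (y, n) v u []
      rw [← hF'' _ (by simp; omega), ← hF'' _ (by simp; omega), List.nil_append, increment,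
        if_pos (by omega), ← hb] at h1
      rw [h0]
      simp only [wd_append, wd_cons, defect_apply, modeOf_basis, mul_sub, sub_mul, map_sub,
        mul_assoc] at h1 ⊢
      linear_combination h1
  · intro w hw hbal
    by_cases hlt : w.length ≤ N
    · have : (fun t => F' (wd k (w.map (atTime t)))) = fun t => F (wd k (w.map (atTime t))) := by
        funext t
        refine hF' w.length hlt _ ?_
        have := wd_mem_homog (k := k) (w.map (atTime t))
        rwa [List.length_map] at this
      rw [this]
      exact hF.loc w hlt hbal
    -- The sort ignores the modes and so follows the same path for all t. Its cost as a function of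
    -- t is thus a sum of increments that are themselves functions of t.
    · let D' : List (Y × ℤ × ℤ) → (Y × ℤ × ℤ) → (Y × ℤ × ℤ) → List (Y × ℤ × ℤ) → ℤ → k :=
        fun u a b v t => increment X₁ F N (u.map (atTime t)) (atTime t a) (atTime t b)
          (v.map (atTime t))
      have h1 : (fun t => F' (wd k (w.map (atTime t)))) = sortCost Prod.fst D' [] w := by
        funext t
        rw [hF'' _ (by simp; omega)]
        exact (map_sortCost (key := Prod.fst) (ev := atTime t) (D := increment X₁ F N) (D' := D')
          (φ := Pi.evalAddMonoidHom _ t)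
          (fun a => rfl) (fun u a b v => rfl) w []).symm
      rw [h1]
      refine sortCost_mem (quad k).toAddSubgroup w (fun u a b v hp => ?_) w [] (List.Perm.refl _)
      have hlen : u.length + v.length + 1 = N := by
        have := hp.length_eq
        simp only [List.length_append, List.length_cons] at this
        omega
      have h2 : D' u a b v = fun t => F (wd k (u.map (atTime t)) *
          modeOf X₁ (a.2.1 + b.2.1 + (a.2.2 + b.2.2) * t) ⁅X₁ a.1, X₁ b.1⁆ *
            wd k (v.map (atTime t))) := by
        funext t
        simp only [D', increment, List.length_map, hlen, if_true]
        congr 3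
        simp only [atTime]
        congr 2
        ring
      change D' u a b v ∈ quad k
      rw [h2]
      -- The bracket is a combination of basis letters, each giving a balanced word of length `N`,
      -- to which locality of the old functional applies.
      generalize ⁅X₁ a.1, X₁ b.1⁆ = r
      have h4 := fun z => (hbal.perm hp).contract z (a.2.1 + b.2.1)
      generalize a.2.2 + b.2.2 = σ at h4
      induction X₁.mem_span r using Submodule.span_induction with
      | mem p h =>
        obtain ⟨z, rfl⟩ := h
        have h3 := hF.loc (u ++ (z, a.2.1 + b.2.1, σ) :: v)
          (by simp only [List.length_append, List.length_cons]; omega) (h4 z)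
        simpa only [List.map_append, List.map_cons, wd_append, wd_cons, modeOf_basis, atTime,
          mul_assoc] using h3
      | zero =>
        simp only [map_zero, mul_zero, zero_mul]
        exact zero_mem _
      | add p q _ _ h1 h2 =>
        simp only [map_add, mul_add, add_mul]
        exact add_mem h1 h2
      | smul c p _ h =>
        simp only [map_smul, mul_smul_comm, smul_mul_assoc]
        exact Submodule.smul_mem _ c h

/-- A compatible functional extends to all words. -/
theorem Compat.exists_extension [LinearOrder Y] (hsymm : form.IsSymm)
    (hinv : ∀ a b c, form ⁅a, b⁆ c = form a ⁅b, c⁆) {γ : k} {N : ℕ} (hN : γ = 0 ∨ 2 ≤ N)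
    {F : FreeAlgebra k (Y × ℤ) →ₗ[k] k} (hF : Compat form X₁ γ N F) :
    ∃ F' : FreeAlgebra k (Y × ℤ) →ₗ[k] k, (∀ M, Compat form X₁ γ M F') ∧
      ∀ i ≤ N, ∀ P ∈ homog k (Y × ℤ) i, F' P = F P := by
  have step : ∀ (M : ℕ) (G : {G // Compat form X₁ γ (N + M) G}),
      ∃ G' : {G // Compat form X₁ γ (N + (M + 1)) G},
        ∀ i ≤ N + M, ∀ P ∈ homog k (Y × ℤ) i, G'.1 P = G.1 P := by
    rintro M ⟨G, hG⟩
    obtain ⟨G', h1, h2⟩ := hG.exists_succ hsymm hinv (hN.imp_right fun h => by omega)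
    exact ⟨⟨G', h1⟩, h2⟩
  choose next hnext using step
  let G : ∀ M : ℕ, {G // Compat form X₁ γ (N + M) G} := fun M => Nat.rec ⟨F, hF⟩ next M
  have hG : ∀ M M', M ≤ M' → ∀ i ≤ N + M, ∀ P ∈ homog k (Y × ℤ) i, (G M').1 P = (G M).1 P := by
    intro M M' hM
    induction M', hM using Nat.le_induction with
    | base => intros; rfl
    | succ M' hM ih =>
      intro i hi P hP
      rw [← ih i hi P hP]
      exact hnext M' (G M') i (by omega) P hP
  -- The extensions stabilize in each length, and the stage indexed by the length of a word is late
  -- enough.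
  let F' : FreeAlgebra k (Y × ℤ) →ₗ[k] k := wordFun fun w => (G w.length).1 (wd k w)
  have hF' : ∀ M, ∀ i ≤ N + M, ∀ P ∈ homog k (Y × ℤ) i, F' P = (G M).1 P := by
    intro M i hi P hP
    induction hP using homog_induction with
    | hw w hl =>
      rw [wordFun_wd, ← hG w.length (max w.length M) (le_max_left _ _) w.length (by omega) _
        (wd_mem_homog w), ← hG M (max w.length M) (le_max_right _ _) w.length (by omega) _
        (wd_mem_homog w)]
    | hzero => rw [map_zero, map_zero]
    | hadd P Q _ _ h1 h2 => rw [map_add, map_add, h1, h2]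
    | hsmul c P _ h => rw [map_smul, map_smul, h]
  refine ⟨F', fun M => ⟨?_, ?_⟩, fun i hi P hP => hF' 0 i (by omega) P hP⟩
  · intro i j hij P hP Q hQ m n p q
    have hX := modeOf_mem X₁ m p
    have hY := modeOf_mem X₁ n q
    rw [← (G M).2.comm i j (by omega) P hP Q hQ]
    simp only [defect_apply, mul_sub, sub_mul, map_sub]
    rw [hF' M (i + (1 + 1) + j) (by omega) _ (mul_mem_homog (mul_mem_homog hP
      (mul_mem_homog hX hY)) hQ), hF' M (i + (1 + 1) + j) (by omega) _
      (mul_mem_homog (mul_mem_homog hP (mul_mem_homog hY hX)) hQ), hF' M (i + 1 + j) (by omega) _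
      (mul_mem_homog (mul_mem_homog hP (modeOf_mem X₁ (m + n) ⁅p, q⁆)) hQ)]
  · intro w hw hbal
    have : (fun t => F' (wd k (w.map (atTime t)))) =
        fun t => (G M).1 (wd k (w.map (atTime t))) := by
      funext t
      refine hF' M w.length (by omega) _ ?_
      have := wd_mem_homog (k := k) (w.map (atTime t))
      rwa [List.length_map] at this
    rw [this]
    exact (G M).2.loc w (by omega) hbal

end Loop

end ConformalAlg

namespace ConformalAlg

/-! ### Polynomial distributions over a commutative algebra -/

section Alternating

variable {k : Type*} [Field k]

/-- The alternating binomial sums of order `≥ 3` annihilate quadratic functions. -/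
theorem sum_alternating_quadratic {M : Type*} [AddCommGroup M] [Module k M] (u v w : M) {n : ℕ}
    (hn : 3 ≤ n) : ∑ s ∈ Finset.range (n + 1),
      ((-1 : k) ^ s * (n.choose s : k)) • (u + (s : k) • v + ((s : k) ^ 2) • w) = 0 := by
  -- Pascal's rule lowers the order by one and replaces f by its difference; three applications
  -- annihilate a quadratic function.
  have step : ∀ (f : ℕ → M) (n : ℕ), ∑ s ∈ Finset.range (n + 2),
      ((-1 : k) ^ s * ((n + 1).choose s : k)) • f s = ∑ s ∈ Finset.range (n + 1),
      ((-1 : k) ^ s * (n.choose s : k)) • (f s - f (s + 1)) := by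
    intro f n
    simp only [smul_sub]
    rw [Finset.sum_sub_distrib, Finset.sum_range_succ' _ (n + 1),
      Finset.sum_range_succ' (fun s => ((-1 : k) ^ s * (n.choose s : k)) • f s) n]
    have h : ∑ s ∈ Finset.range (n + 1), ((-1 : k) ^ (s + 1) * ((n + 1).choose (s + 1) : k)) •
        f (s + 1) = ∑ s ∈ Finset.range (n + 1), ((-1 : k) ^ (s + 1) * (n.choose (s + 1) : k)) •
        f (s + 1) - ∑ s ∈ Finset.range (n + 1), ((-1 : k) ^ s * (n.choose s : k)) • f (s + 1) := by
      rw [← Finset.sum_sub_distrib]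
      refine Finset.sum_congr rfl fun s _ => ?_
      rw [← sub_smul, Nat.choose_succ_succ']
      congr 1
      push_cast
      ring
    rw [h, Finset.sum_range_succ (fun s => ((-1 : k) ^ (s + 1) * (n.choose (s + 1) : k)) •
        f (s + 1)) n]
    simp
    abel
  obtain ⟨n, rfl⟩ : ∃ m, n = m + 3 := ⟨n - 3, by omega⟩
  rw [step, step, step]
  refine Finset.sum_eq_zero fun s _ => ?_
  rw [smul_eq_zero]
  right
  push_cast
  module

end Alternating

namespace Dist

open Polynomial

variable {k : Type*} [Field k] {R : Type*} [CommRing R] [Algebra k R]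

variable (k R) in
/-- The distribution `m ↦ p(m)` attached to a polynomial. -/
noncomputable def ofPoly : R[X] →ₗ[k] Dist R where
  toFun p m := p.eval (m : R)
  map_add' p q := funext fun m => eval_add
  map_smul' c p := funext fun m => by
    change (c • p).eval (m : R) = c • p.eval (m : R)
    rw [eval_smul]

theorem ofPoly_apply (p : R[X]) (m : ℤ) : ofPoly k R p m = p.eval (m : R) := rfl

/-- Applying a linear functional to the coefficients gives a polynomial over the field with all
natural numbers as roots. -/
theorem eval_nat_eq_zero [CharZero k] {p : R[X]} (h : ∀ n : ℕ, p.eval (n : R) = 0) : p = 0 := by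
  ext i
  rw [coeff_zero, ← Module.forall_dual_apply_eq_zero_iff k]
  intro φ
  let q : k[X] := ∑ j ∈ Finset.range (max p.natDegree i + 1), monomial j (φ (p.coeff j))
  have hq : q = 0 := by
    refine eq_zero_of_infinite_isRoot q (Set.Infinite.mono ?_
      (Set.infinite_range_of_injective (Nat.cast_injective (R := k))))
    rintro _ ⟨n, rfl⟩
    have hn := congrArg φ (h n)
    rw [map_zero, eval_eq_sum_range' (Nat.lt_succ_of_le (le_max_left _ i)), map_sum] at hn
    change q.eval (n : k) = 0
    rw [eval_finsetSum, ← hn]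
    refine Finset.sum_congr rfl fun j _ => ?_
    have e : p.coeff j * (n : R) ^ j = ((n : k) ^ j) • p.coeff j := by
      rw [Algebra.smul_def, map_pow, map_natCast, mul_comm]
    rw [e, map_smul, eval_monomial, smul_eq_mul, mul_comm]
  have hc := congrArg (fun r => coeff r i) hq
  simpa [q, finsetSum_coeff, coeff_monomial, Nat.lt_succ_iff] using hc

theorem ofPoly_injective [CharZero k] : Function.Injective (ofPoly k R) := by
  rw [← LinearMap.ker_eq_bot, LinearMap.ker_eq_bot']
  intro p hp
  refine eval_nat_eq_zero (k := k) fun n => ?_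
  have := congrFun hp n
  rwa [ofPoly_apply, Int.cast_natCast] at this

theorem del_ofPoly (p : R[X]) : del k (ofPoly k R p) = ofPoly k R (-X * taylor (-1) p) := by
  ext m
  rw [del_apply, ofPoly_apply, ofPoly_apply, Algebra.smul_def, map_neg, map_intCast, eval_mul,
    taylor_eval]
  push_cast
  rw [eval_neg, eval_X, sub_eq_add_neg, add_comm (m : R)]

theorem nprod_ofPoly (n : ℕ) (p q : R[X]) : nprod k n (ofPoly k R p) (ofPoly k R q) =
    ofPoly k R (∑ s ∈ Finset.range (n + 1), ((-1 : k) ^ s * (n.choose s : k)) •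
      (C (p.eval (((n - s : ℤ)) : R)) * taylor (s : R) q)) := by
  ext m
  rw [nprod_apply, ofPoly_apply, eval_finsetSum]
  refine Finset.sum_congr rfl fun s _ => ?_
  rw [eval_smul, eval_mul, eval_C, taylor_eval, ofPoly_apply, ofPoly_apply]
  push_cast
  rw [add_comm (m : R)]

theorem eq_of_nat [CharZero k] {a b : Dist R} (ha : a ∈ LinearMap.range (ofPoly k R))
    (hb : b ∈ LinearMap.range (ofPoly k R)) (h : ∀ m : ℕ, a m = b m) : a = b := by
  obtain ⟨p, rfl⟩ := ha
  obtain ⟨q, rfl⟩ := hb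
  rw [← sub_eq_zero, ← map_sub]
  have : p - q = 0 := eval_nat_eq_zero (k := k) fun n => by
    have := h n
    rw [ofPoly_apply, ofPoly_apply, Int.cast_natCast] at this
    rw [eval_sub, this, sub_self]
  rw [this, map_zero]

/-- At a natural mode m the falling factorial vanishes for j > m, which truncates the reversed
product at m independently of the locality bound. -/
theorem del_pow_apply (c : Dist R) (j : ℕ) : ∀ m : ℕ, (((del k : Module.End k (Dist R)) ^ j) c) m =
    ((-1 : k) ^ j * (m.descFactorial j : k)) • c (m - j) := by
  induction j generalizing c with
  | zero => intro m; simp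
  | succ j ih =>
    intro m
    rw [pow_succ, Module.End.mul_apply, ih, del_apply, smul_smul, Nat.descFactorial_succ]
    have e : (m : ℤ) - j - 1 = m - (j + 1 : ℕ) := by push_cast; ring
    rw [e]
    congr 1
    rcases le_or_gt j m with h | h
    · push_cast [Nat.cast_sub h]
      ring
    · rw [Nat.descFactorial_eq_zero_iff_lt.2 h]
      simp

/-- Polynomial distributions over a commutative algebra commute. -/
theorem comm_eq_zero [CharZero k] {a b : Dist R} (ha : a ∈ LinearMap.range (ofPoly k R))
    (hb : b ∈ LinearMap.range (ofPoly k R)) {N : ℕ} (hN : LocalAt k N b a) (n : ℕ) :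
    comm k n a b = 0 := by
  have hdel : ∀ c ∈ LinearMap.range (ofPoly k R), del k c ∈ LinearMap.range (ofPoly k R) := by
    rintro _ ⟨p, rfl⟩
    exact ⟨_, (del_ofPoly p).symm⟩
  have hprod : ∀ (n : ℕ), ∀ c ∈ LinearMap.range (ofPoly k R), ∀ d ∈ LinearMap.range (ofPoly k R),
      nprod k n c d ∈ LinearMap.range (ofPoly k R) := by
    rintro n _ ⟨p, rfl⟩ _ ⟨q, rfl⟩
    exact ⟨_, (nprod_ofPoly n p q).symm⟩
  have hpow : ∀ (j : ℕ), ∀ c ∈ LinearMap.range (ofPoly k R),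
      ((del k : Module.End k (Dist R)) ^ j) c ∈ LinearMap.range (ofPoly k R) := by
    intro j
    induction j with
    | zero => intro c hc; simpa using hc
    | succ j ih => intro c hc; rw [pow_succ, Module.End.mul_apply]; exact ih _ (hdel c hc)
  rw [comm, sub_eq_zero]
  refine eq_of_nat (k := k) (hprod n a ha b hb) ?_ fun m => ?_
  · rw [rev_eq_sum hN]
    exact Submodule.sum_mem _ fun s _ => Submodule.smul_mem _ _ (hpow _ _ (hprod _ b hb a ha))
  have h1 : rev k n b a m = ∑ j ∈ Finset.range (m + 1), ((-1 : k) ^ n * (m.choose j : k)) •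
      nprod k (n + j) b a (m - j) := by
    rw [rev_eq_sum (hN.mono (le_max_left N (m + 1))), sum_apply]
    symm
    rw [← Finset.sum_subset (Finset.range_mono (le_max_right N (m + 1)))]
    · refine Finset.sum_congr rfl fun j _ => ?_
      rw [smul_apply, del_pow_apply, smul_smul, Nat.descFactorial_eq_factorial_mul_choose]
      congr 1
      have : (j.factorial : k) ≠ 0 := Nat.cast_ne_zero.2 j.factorial_ne_zero
      have h2 : ((-1 : k) ^ j) * (-1) ^ j = 1 := by rw [← mul_pow]; simp
      push_cast
      rw [pow_add]
      field_simp
      linear_combination -(m.choose j : k) * h2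
    · intro j _ hj
      have hj' : m < j := by simpa using hj
      rw [smul_apply, del_pow_apply, Nat.descFactorial_eq_zero_iff_lt.2 hj']
      simp
  -- Here x₀^i x₁^j stands for b(i) a(j). The mode m of the `n`-product of a and b corresponds to
  -- (-1)^n (x₀ - x₁)^n x₀^m, and expanding x₀ = (x₀ - x₁) + x₁ gives the reversed product term by
  -- term.
  let f : ℕ → ℕ → ℕ → R := fun i j _ => b i * a j
  let x : Fin 3 → MvPolynomial (Fin 3) k := MvPolynomial.X
  have hf : ∀ i j : ℕ, trilin k f (x 0 ^ i * x 1 ^ j) = b i * a j := fun i j => by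
    have := trilin_monomial k f i j 0
    rwa [pow_zero, mul_one] at this
  have h2 : ∀ j ∈ Finset.range (m + 1), nprod k (n + j) b a (m - j) =
      trilin k f ((x 0 - x 1) ^ (n + j) * x 1 ^ (m - j)) := by
    intro j hj
    have hj' : j ≤ m := by have := Finset.mem_range.1 hj; omega
    rw [sub_pow_eq k (x 0), Finset.sum_mul, map_sum, nprod_apply]
    refine Finset.sum_congr rfl fun s hs => ?_
    have hs' : s ≤ n + j := by have := Finset.mem_range.1 hs; omega
    rw [smul_mul_assoc, map_smul, mul_assoc, ← pow_add, hf]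
    congr 3
    · rw [Nat.cast_sub hs']
    · rw [Nat.cast_add, Nat.cast_sub hj']; ring
  have h3 : nprod k n a b m = ((-1 : k) ^ n) • trilin k f ((x 0 - x 1) ^ n * x 0 ^ m) := by
    have e : ((-1 : k) ^ n) • ((x 0 - x 1) ^ n * x 0 ^ m) = (x 1 - x 0) ^ n * x 0 ^ m := by
      rw [Algebra.smul_def, map_pow, map_neg, map_one, ← mul_assoc, ← mul_pow]
      ring
    rw [← map_smul, e, sub_pow_eq k (x 1), Finset.sum_mul, map_sum, nprod_apply]
    refine Finset.sum_congr rfl fun s hs => ?_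
    have hs' : s ≤ n := by have := Finset.mem_range.1 hs; omega
    have e2 : x 1 ^ (n - s) * x 0 ^ s * x 0 ^ m = x 0 ^ (m + s) * x 1 ^ (n - s) := by ring
    rw [smul_mul_assoc, map_smul, e2, hf, mul_comm (b _)]
    congr 3
    rw [Nat.cast_sub hs']
  have h4 : (x 0 - x 1) ^ n * x 0 ^ m = ∑ j ∈ Finset.range (m + 1),
      (m.choose j : k) • ((x 0 - x 1) ^ (n + j) * x 1 ^ (m - j)) := by
    have e : x 0 ^ m = ((x 0 - x 1) + x 1) ^ m := by ring
    rw [e, add_pow, Finset.mul_sum]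
    refine Finset.sum_congr rfl fun j _ => ?_
    rw [Algebra.smul_def, map_natCast]
    ring
  rw [h1, h3, h4, map_sum, Finset.smul_sum]
  refine Finset.sum_congr rfl fun j hj => ?_
  rw [h2 j hj, map_smul, smul_smul]

end Dist

end ConformalAlg

namespace ConformalAlg

/-! ### The commutative model -/

/-- A family is linearly independent if it is triangular with respect to a family of
functionals. -/
theorem linearIndependent_of_triangular {k ι V : Type*} [Field k] [AddCommGroup V] [Module k V]
    (v : ι → V) (φ : ι → V →ₗ[k] k) (r : ι → ℕ) (h1 : ∀ i, φ i (v i) ≠ 0)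
    (h2 : ∀ i j, φ i (v j) ≠ 0 → j ≠ i → r i < r j) : LinearIndependent k v := by
  rw [linearIndependent_iff]
  intro l hl
  by_contra hne
  -- At an index of largest rank in the support, the functional kills all other terms of the
  -- relation.
  obtain ⟨i, hi, hmax⟩ := l.support.exists_max_image r (Finsupp.support_nonempty_iff.2 hne)
  have h := congrArg (φ i) hl
  rw [map_zero, Finsupp.linearCombination_apply, Finsupp.sum, map_sum,
    Finset.sum_eq_single_of_mem i hi, map_smul, smul_eq_mul] at h
  · exact mul_ne_zero (Finsupp.mem_support_iff.1 hi) (h1 i) h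
  · intro j hj hji
    rw [map_smul]
    by_contra hc
    have := h2 i j (fun h0 => hc (by rw [h0, smul_zero])) hji
    exact absurd (hmax j hj) (by omega)

section Model

open Polynomial

variable (k : Type*) [Field k] {Y : Type*}

/-- The polynomial algebra in the variables `a_y`, `b_y`, `y ∈ Y`. -/
abbrev BiPoly (k : Type*) [Field k] (Y : Type*) : Type _ :=
  AddMonoidAlgebra k (Multiset Y × Multiset Y)

/-- The monomial `∏_{x ∈ A} a_x ∏_{y ∈ B} b_y`. -/
noncomputable def biMono (A B : Multiset Y) : BiPoly k Y := AddMonoidAlgebra.single (A, B) 1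

theorem biMono_mul (A B A' B' : Multiset Y) :
    biMono k A B * biMono k A' B' = biMono k (A + A') (B + B') := by
  rw [biMono, biMono, AddMonoidAlgebra.single_mul_single, one_mul]
  rfl

theorem biMono_zero : biMono k (0 : Multiset Y) 0 = 1 := rfl

/-- The coefficient of a polynomial at the monomial `biMono k A B`. -/
noncomputable def biCoeff (A B : Multiset Y) : BiPoly k Y →ₗ[k] k :=
  (Finsupp.lapply (A, B)) ∘ₗ (AddMonoidAlgebra.coeffLinearEquiv k).toLinearMap

theorem biCoeff_biMono_self (A B : Multiset Y) : biCoeff k A B (biMono k A B) = 1 := by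
  change (AddMonoidAlgebra.single (A, B) (1 : k)).coeff (A, B) = 1
  rw [AddMonoidAlgebra.coeff_single, Finsupp.single_eq_same]

theorem biCoeff_biMono_of_ne {A B A' B' : Multiset Y} (h : (A, B) ≠ (A', B')) :
    biCoeff k A B (biMono k A' B') = 0 := by
  change (AddMonoidAlgebra.single (A', B') (1 : k)).coeff (A, B) = 0
  rw [AddMonoidAlgebra.coeff_single, Finsupp.single_eq_of_ne h]

/-- The linear map with prescribed values on the monomials. -/
noncomputable def biLin {M : Type*} [AddCommGroup M] [Module k M]
    (f : Multiset Y → Multiset Y → M) : BiPoly k Y →ₗ[k] M :=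
  (Finsupp.linearCombination k fun p : Multiset Y × Multiset Y => f p.1 p.2) ∘ₗ
    (AddMonoidAlgebra.coeffLinearEquiv k).toLinearMap

theorem biLin_biMono {M : Type*} [AddCommGroup M] [Module k M]
    (f : Multiset Y → Multiset Y → M) (A B : Multiset Y) : biLin k f (biMono k A B) = f A B := by
  change Finsupp.linearCombination k (fun p : Multiset Y × Multiset Y => f p.1 p.2)
    (AddMonoidAlgebra.single (A, B) (1 : k)).coeff = _
  rw [AddMonoidAlgebra.coeff_single, Finsupp.linearCombination_single, one_smul]

/-- The polynomial `a_y - b_y X`. -/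
noncomputable def biGen (y : Y) : (BiPoly k Y)[X] := C (biMono k {y} 0) - X * C (biMono k 0 {y})

/-- The distribution `n ↦ a_y - n b_y`. -/
noncomputable def biDist (y : Y) : Dist (BiPoly k Y) := Dist.ofPoly k _ (biGen k y)

theorem biDist_apply (y : Y) (m : ℤ) :
    biDist k y m = biMono k {y} 0 - (m : k) • biMono k 0 {y} := by
  rw [biDist, Dist.ofPoly_apply, biGen, eval_sub, eval_C, eval_mul, eval_X, eval_C,
    Algebra.smul_def, map_intCast]

/-- The product of two linear functions of s is quadratic, so alternating binomial sums of order at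
least three vanish on it. -/
theorem biDist_local (x y : Y) : LocalAt k 3 (biDist k x) (biDist k y) := by
  intro n hn
  refine Dist.ext fun m => ?_
  rw [Dist.nprod_apply, Dist.zero_apply]
  simp only [biDist_apply]
  refine Eq.trans (Finset.sum_congr rfl fun s _ => ?_) (sum_alternating_quadratic (k := k)
    (M := BiPoly k Y)
    ((biMono k {x} 0 - (n : k) • biMono k 0 {x}) * (biMono k {y} 0 - (m : k) • biMono k 0 {y}))
    (biMono k 0 {x} * (biMono k {y} 0 - (m : k) • biMono k 0 {y}) -
      (biMono k {x} 0 - (n : k) • biMono k 0 {x}) * biMono k 0 {y})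
    (-(biMono k 0 {x} * biMono k 0 {y})) hn)
  congr 1
  push_cast
  simp only [Algebra.smul_def, map_sub, map_add, map_pow]
  ring

theorem nprod_zero_biDist (x : Y) (p : (BiPoly k Y)[X]) :
    nprod k 0 (biDist k x) (Dist.ofPoly k _ p) = Dist.ofPoly k _ (C (biMono k {x} 0) * p) := by
  rw [biDist, Dist.nprod_ofPoly]
  simp [biGen]

/-- The variable a_x multiplies only the difference p(X) - p(X + 1), which has smaller degree. On
leading coefficients L_1^x therefore acts as multiplication by -b_x. -/
theorem nprod_one_biDist (x : Y) (p : (BiPoly k Y)[X]) :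
    nprod k 1 (biDist k x) (Dist.ofPoly k _ p) = Dist.ofPoly k _
      (C (biMono k {x} 0) * (p - taylor 1 p) - C (biMono k 0 {x}) * p) := by
  rw [biDist, Dist.nprod_ofPoly]
  congr 1
  simp [biGen, Finset.sum_range_succ]
  ring

theorem taylor_biGen (r : BiPoly k Y) (y : Y) :
    taylor r (biGen k y) = biGen k y - C (r * biMono k 0 {y}) := by
  simp [biGen, taylor_apply]
  ring

theorem nprod_two_biDist (z u : Y) : nprod k 2 (biDist k z) (biDist k u) =
    Dist.ofPoly k _ (C ((-2 : k) • biMono k 0 (([z, u] : List Y) : Multiset Y))) := by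
  have e : biMono k 0 (([z, u] : List Y) : Multiset Y) = biMono k 0 {z} * biMono k 0 {u} := by
    rw [biMono_mul]; rfl
  rw [biDist, biDist, Dist.nprod_ofPoly]
  congr 1
  have c0 : (-1 : k) ^ 0 * (Nat.choose 2 0 : k) = 1 := by simp
  have c1 : (-1 : k) ^ 1 * (Nat.choose 2 1 : k) = -2 := by simp
  have c2 : (-1 : k) ^ 2 * (Nat.choose 2 2 : k) = 1 := by simp
  have h : ∀ p : (BiPoly k Y)[X], (-2 : k) • p = -2 * p := fun p => by
    rw [neg_smul, ← one_add_one_eq_two, add_smul, one_smul]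
    ring
  simp only [taylor_biGen, Finset.sum_range_succ, Finset.sum_range_zero, c0, c1, c2, one_smul, h]
  rw [e, ← smul_C, h, biGen, biGen]
  have h2 : (C 2 : (BiPoly k Y)[X]) = 2 := map_ofNat C 2
  simp [h2]
  ring

/-- `p` has degree at most `N`, with coefficient `r` at `X ^ N`. -/
def Lead {R : Type*} [CommRing R] (N : ℕ) (r : R) (p : R[X]) : Prop :=
  p.natDegree ≤ N ∧ p.coeff N = r

theorem Lead.taylor {R : Type*} [CommRing R] {N : ℕ} {r : R} {p : R[X]} (h : Lead N r p) (t : R) :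
    Lead N r (taylor t p) := by
  refine ⟨by rw [natDegree_taylor]; exact h.1, ?_⟩
  rcases h.1.lt_or_eq with h1 | h1
  · rw [coeff_eq_zero_of_natDegree_lt (by rwa [natDegree_taylor]), ← h.2,
      coeff_eq_zero_of_natDegree_lt h1]
  · rw [← h1, coeff_taylor_natDegree, ← h.2, ← h1]; rfl

theorem Lead.C_mul {R : Type*} [CommRing R] {N : ℕ} {r : R} {p : R[X]} (h : Lead N r p) (t : R) :
    Lead N (t * r) (C t * p) :=
  ⟨(natDegree_C_mul_le t p).trans h.1, by rw [coeff_C_mul, h.2]⟩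

theorem Lead.sub {R : Type*} [CommRing R] {N : ℕ} {r s : R} {p q : R[X]} (h : Lead N r p)
    (h' : Lead N s q) : Lead N (r - s) (p - q) :=
  ⟨(natDegree_sub_le p q).trans (max_le h.1 h'.1), by rw [coeff_sub, h.2, h'.2]⟩

theorem Lead.X_mul {R : Type*} [CommRing R] {N : ℕ} {r : R} {p : R[X]} (h : Lead N r p) :
    Lead (N + 1) (-r) (-X * p) := by
  refine ⟨?_, by rw [neg_mul, coeff_neg, coeff_X_mul, h.2]⟩
  rw [neg_mul, natDegree_neg]
  refine natDegree_mul_le.trans ?_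
  have := natDegree_X_le (R := R)
  have := h.1
  omega

theorem lead_biGen (y : Y) : Lead 1 ((-1 : k) • biMono k 0 {y}) (biGen k y) := by
  constructor
  · rw [biGen]
    compute_degree
  · simp [biGen]

theorem opL_zero_biDist (xs : List Y) (p : (BiPoly k Y)[X]) :
    opL k (biDist k) 0 xs (Dist.ofPoly k _ p) = Dist.ofPoly k _ (C (biMono k (xs : Multiset Y) 0) * p) := by
  induction xs with
  | nil => simp [opL, biMono_zero]
  | cons x xs ih =>
    have : opL k (biDist k) 0 (x :: xs) (Dist.ofPoly k _ p) =
      nprod k 0 (biDist k x) (opL k (biDist k) 0 xs (Dist.ofPoly k _ p)) := rfl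
    rw [this, ih, nprod_zero_biDist, ← mul_assoc, ← C_mul, biMono_mul]
    rfl

theorem exists_opL_one_biDist (ys : List Y) {N : ℕ} {c : k} (hc : c ≠ 0) {B : List Y}
    {p : (BiPoly k Y)[X]} (hp : Lead N (c • biMono k 0 (B : Multiset Y)) p) :
    ∃ c' : k, c' ≠ 0 ∧ ∃ q, opL k (biDist k) 1 ys (Dist.ofPoly k _ p) = Dist.ofPoly k _ q ∧
      Lead N (c' • biMono k 0 ((ys ++ B : List Y) : Multiset Y)) q := by
  induction ys with
  | nil => exact ⟨c, hc, p, rfl, hp⟩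
  | cons y ys ih =>
    obtain ⟨c', hc', q, hq, hl⟩ := ih
    refine ⟨-c', neg_ne_zero.2 hc', _,
      (congrArg (nprod k 1 (biDist k y)) hq).trans (nprod_one_biDist k y q), ?_⟩
    have h := ((hl.sub (hl.taylor 1)).C_mul (biMono k {y} 0)).sub (hl.C_mul (biMono k 0 {y}))
    have e : biMono k 0 ((y :: ys ++ B : List Y) : Multiset Y) =
        biMono k 0 {y} * biMono k 0 ((ys ++ B : List Y) : Multiset Y) := by
      rw [biMono_mul]; rfl
    rwa [sub_self, mul_zero, zero_sub, mul_smul_comm, ← e, ← neg_smul] at h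

theorem exists_del_pow_biDist (z : Y) (s : ℕ) : ∃ c : k, c ≠ 0 ∧ ∃ q,
    ((del k : Module.End k (Dist (BiPoly k Y))) ^ s) (biDist k z) = Dist.ofPoly k _ q ∧
      Lead (s + 1) (c • biMono k 0 (([z] : List Y) : Multiset Y)) q := by
  induction s with
  | zero => exact ⟨-1, by simp, _, rfl, lead_biGen k z⟩
  | succ s ih =>
    obtain ⟨c, hc, q, hq, hl⟩ := ih
    refine ⟨-c, neg_ne_zero.2 hc, -X * taylor (-1) q, ?_, ?_⟩
    · rw [pow_succ', Module.End.mul_apply, hq, Dist.del_ofPoly]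
    · rw [neg_smul]
      exact (hl.taylor (-1)).X_mul

theorem Lead.biMono_mul {N : ℕ} {c : k} {B : List Y} {p : (BiPoly k Y)[X]}
    (hp : Lead N (c • biMono k 0 (B : Multiset Y)) p) (xs : List Y) :
    Lead N (c • biMono k (xs : Multiset Y) (B : Multiset Y)) (C (biMono k (xs : Multiset Y) 0) * p) := by
  have h := hp.C_mul (biMono k (xs : Multiset Y) 0)
  rwa [mul_smul_comm, ConformalAlg.biMono_mul, add_zero, zero_add] at h

/-- The full value is needed: exchanging y and z fixes the coefficient at X and changes the sign of
the constant one, and only the latter distinguishes the two monomials. -/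
theorem eval_biDist_fam₄ [LinearOrder Y] (xs : List Y) (y z : Y) (hx : xs.Pairwise (· ≤ ·))
    (hy : (∀ x ∈ xs.getLast?, x ≤ y) ∨ y ≤ z) :
    (Monomial.fam₄ xs y z hx hy).eval k (biDist k) = Dist.ofPoly k _
      (C (biMono k (y ::ₘ (xs : Multiset Y)) {z} - biMono k (z ::ₘ (xs : Multiset Y)) {y}) +
        X * C (biMono k (xs : Multiset Y) (([y, z] : List Y) : Multiset Y))) := by
  have e1 : biMono k (y ::ₘ (xs : Multiset Y)) {z} = biMono k xs 0 * (biMono k {y} 0 * biMono k 0 {z}) := by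
    rw [biMono_mul, biMono_mul]
    simp [add_comm, ← Multiset.singleton_add]
  have e2 : biMono k (z ::ₘ (xs : Multiset Y)) {y} = biMono k xs 0 * (biMono k {z} 0 * biMono k 0 {y}) := by
    rw [biMono_mul, biMono_mul]
    simp [add_comm, ← Multiset.singleton_add]
  have e3 : biMono k (xs : Multiset Y) (([y, z] : List Y) : Multiset Y) =
      biMono k xs 0 * (biMono k 0 {y} * biMono k 0 {z}) := by
    rw [biMono_mul, biMono_mul, add_zero, add_zero, zero_add]
    rfl
  change opL k (biDist k) 0 xs (nprod k 1 (biDist k y) (Dist.ofPoly k _ (biGen k z))) = _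
  rw [nprod_one_biDist, opL_zero_biDist, taylor_biGen]
  congr 1
  rw [e1, e2, e3, biGen]
  simp only [map_sub, map_mul, map_one]
  ring

/-- The degree in `X` of the image of a monomial in the commutative model. -/
def Monomial.polyDegree [LinearOrder Y] : Monomial Y → ℕ
  | .fam₁ .. => 0
  | .fam₂ _ _ s _ _ _ _ => s + 1
  | .fam₃ .. => 1
  | .fam₄ .. => 1

/-- The superscripts of the operators `L₀` in a monomial. -/
def Monomial.leftLetters [LinearOrder Y] : Monomial Y → List Y
  | .fam₁ xs .. => xs
  | .fam₂ xs .. => xs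
  | .fam₃ xs .. => xs
  | .fam₄ xs .. => xs

/-- The letters of a monomial that are not superscripts of the operators `L₀`. -/
def Monomial.rightLetters [LinearOrder Y] : Monomial Y → List Y
  | .fam₁ _ ys z u _ _ => ys ++ [z, u]
  | .fam₂ _ ys _ z _ _ _ => ys ++ [z]
  | .fam₃ _ ys z _ _ _ => ys ++ [z]
  | .fam₄ _ y z _ _ => [y, z]

/-- Each L_0^x multiplies by a_x. Each other letter contributes its b to the leading coefficient up
to a nonzero scalar, ∂ raises the degree by one, and L_2^z u is the constant -2 b_z b_u. -/
theorem exists_eval_biDist [CharZero k] [LinearOrder Y] (w : Monomial Y) : ∃ c : k, c ≠ 0 ∧ ∃ p,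
    w.eval k (biDist k) = Dist.ofPoly k _ p ∧ Lead w.polyDegree
      (c • biMono k (w.leftLetters : Multiset Y) (w.rightLetters : Multiset Y)) p := by
  match w with
  | .fam₁ xs ys z u hx hy =>
    have hp : Lead 0 ((-2 : k) • biMono k 0 (([z, u] : List Y) : Multiset Y))
        (C ((-2 : k) • biMono k 0 (([z, u] : List Y) : Multiset Y))) := ⟨by simp, by simp⟩
    obtain ⟨c, hc, q, hq, hl⟩ := exists_opL_one_biDist k ys (by simp) hp
    refine ⟨c, hc, _, ?_, hl.biMono_mul k xs⟩
    rw [← opL_zero_biDist, ← hq, ← nprod_two_biDist]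
    rfl
  | .fam₂ xs ys s z hx hy hs =>
    obtain ⟨c, hc, q, hq, hl⟩ := exists_del_pow_biDist k z s
    obtain ⟨c, hc, q', hq', hl⟩ := exists_opL_one_biDist k ys hc hl
    refine ⟨c, hc, _, ?_, hl.biMono_mul k xs⟩
    rw [← opL_zero_biDist, ← hq', ← hq]
    rfl
  | .fam₃ xs ys z hx hy hm =>
    obtain ⟨c, hc, q', hq', hl⟩ := exists_opL_one_biDist k ys (B := [z])
      (neg_ne_zero.2 (one_ne_zero (α := k))) (lead_biGen k z)
    refine ⟨c, hc, _, ?_, hl.biMono_mul k xs⟩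
    rw [← opL_zero_biDist, ← hq']
    rfl
  | .fam₄ xs y z hx hy =>
    refine ⟨1, one_ne_zero, _, eval_biDist_fam₄ k xs y z hx hy, ?_⟩
    constructor
    · change natDegree _ ≤ 1
      compute_degree
    · rw [one_smul]
      change coeff _ 1 = biMono k (xs : Multiset Y) (([y, z] : List Y) : Multiset Y)
      simp [coeff_C]

end Model

end ConformalAlg

namespace ConformalAlg

/-! ### Linear independence of the monomials in the commutative model -/

section Independence

open Polynomial

variable (k : Type*) [Field k] {Y : Type*} [LinearOrder Y]

theorem eq_of_coe_eq {l l' : List Y} (h : l.Pairwise (· ≤ ·)) (h' : l'.Pairwise (· ≤ ·))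
    (e : (l : Multiset Y) = l') : l = l' :=
  List.Perm.eq_of_pairwise' h h' (Multiset.coe_eq_coe.1 e)

/-- The constant coefficient of the image of `L₀^{x₁} … L₀^{xₙ} L₁^y z`, `y ≤ z`, as a function of
its coefficient at `X`. -/
noncomputable def fam₄Correction : BiPoly k Y →ₗ[k] BiPoly k Y :=
  biLin k fun A B => match B.sort (· ≤ ·) with
    | [y, z] => biMono k (y ::ₘ A) {z} - biMono k (z ::ₘ A) {y}
    | _ => 0

theorem fam₄Correction_of_le (xs : List Y) {y z : Y} (h : y ≤ z) :
    fam₄Correction k (biMono k (xs : Multiset Y) (([y, z] : List Y) : Multiset Y)) =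
      biMono k (y ::ₘ (xs : Multiset Y)) {z} - biMono k (z ::ₘ (xs : Multiset Y)) {y} := by
  rw [fam₄Correction, biLin_biMono]
  have : (([y, z] : List Y) : Multiset Y).sort (· ≤ ·) = [y, z] :=
    eq_of_coe_eq (Multiset.pairwise_sort _ _) (by simpa using h) (Multiset.sort_eq _ _)
  rw [this]

/-- A functional detecting a monomial among the monomials of smaller or equal rank. -/
noncomputable def Monomial.detect : Monomial Y → (BiPoly k Y)[X] →ₗ[k] k
  | .fam₄ xs y z _ _ =>
      -- For y ≤ z the leading coefficient is read. For y > z it agrees with that of the monomial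
      -- with y and z exchanged, so the constant coefficient is read instead, after subtracting the
      -- constant coefficient that the sorted monomial would have.
      if y ≤ z then biCoeff k (xs : Multiset Y) (([y, z] : List Y) : Multiset Y) ∘ₗ
        (lcoeff (BiPoly k Y) 1).restrictScalars k
      else biCoeff k (y ::ₘ (xs : Multiset Y)) {z} ∘ₗ
        ((lcoeff (BiPoly k Y) 0).restrictScalars k -
          fam₄Correction k ∘ₗ (lcoeff (BiPoly k Y) 1).restrictScalars k)
  | w => biCoeff k (w.leftLetters : Multiset Y) (w.rightLetters : Multiset Y) ∘ₗ
      (lcoeff (BiPoly k Y) w.polyDegree).restrictScalars k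

/-- The rank of a monomial. -/
def Monomial.rank : Monomial Y → ℕ
  | .fam₁ .. => 1
  | .fam₂ _ _ s _ _ _ _ => s + 3
  | .fam₃ .. => 2
  | .fam₄ _ y z _ _ => if y ≤ z then 0 else 1

variable {k}

theorem le_of_getLast {xs : List Y} (hx : xs.Pairwise (· ≤ ·)) {y : Y}
    (h : ∀ x ∈ xs.getLast?, x ≤ y) : ∀ x ∈ xs, x ≤ y := by
  intro x hxs
  rcases List.eq_nil_or_concat xs with rfl | ⟨l, b, rfl⟩
  · simp at hxs
  · have hb : b ≤ y := h b (by simp)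
    rw [List.concat_eq_append] at hx hxs
    rcases List.mem_append.1 hxs with h1 | h1
    · exact ((List.pairwise_append.1 hx).2.2 x h1 b (by simp)).trans hb
    · rw [List.mem_singleton.1 h1]; exact hb

theorem biCoeff_smul_biMono_ne {A B A' B' : Multiset Y} {c : k}
    (h : biCoeff k A B (c • biMono k A' B') ≠ 0) : A = A' ∧ B = B' := by
  by_contra hc
  rw [map_smul, biCoeff_biMono_of_ne k (fun e => hc (Prod.mk.injEq _ _ _ _ ▸ e)), smul_zero] at h
  exact h rfl

theorem Monomial.leftLetters_pairwise (w : Monomial Y) : w.leftLetters.Pairwise (· ≤ ·) := by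
  cases w <;> assumption

/-- The monomials of the first three families and those of the fourth with `y ≤ z`. -/
def Monomial.IsSorted (w : Monomial Y) : Prop := w.rightLetters.Pairwise (· ≤ ·)

theorem Monomial.letters_eq {w w' : Monomial Y} (h : w.IsSorted) (h' : w'.IsSorted)
    (hA : (w.leftLetters : Multiset Y) = w'.leftLetters)
    (hB : (w.rightLetters : Multiset Y) = w'.rightLetters) :
    w.leftLetters = w'.leftLetters ∧ w.rightLetters = w'.rightLetters :=
  ⟨eq_of_coe_eq w.leftLetters_pairwise w'.leftLetters_pairwise hA, eq_of_coe_eq h h' hB⟩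

/-- The representatives of the values of the monomials, by polynomials. -/
theorem exists_eval_poly [CharZero k] : ∃ P : Monomial Y → (BiPoly k Y)[X],
    (∀ w, w.eval k (biDist k) = Dist.ofPoly k _ (P w)) ∧
    (∀ w, ∃ c : k, c ≠ 0 ∧ Lead w.polyDegree
      (c • biMono k (w.leftLetters : Multiset Y) (w.rightLetters : Multiset Y)) (P w)) ∧
    ∀ xs y z hx hy, P (.fam₄ xs y z hx hy) =
      C (biMono k (y ::ₘ (xs : Multiset Y)) {z} - biMono k (z ::ₘ (xs : Multiset Y)) {y}) +
        X * C (biMono k (xs : Multiset Y) (([y, z] : List Y) : Multiset Y)) := by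
  choose c hc P hP hl using fun w : Monomial Y => exists_eval_biDist k w
  exact ⟨P, hP, fun w => ⟨c w, hc w, hl w⟩, fun xs y z hx hy => Dist.ofPoly_injective (k := k)
    ((hP _).symm.trans (eval_biDist_fam₄ k xs y z hx hy))⟩

theorem Lead.coeff_lt {R : Type*} [CommRing R] {N M : ℕ} {r : R} {p : R[X]} (h : Lead N r p)
    (hM : N < M) : p.coeff M = 0 :=
  coeff_eq_zero_of_natDegree_lt (h.1.trans_lt hM)

theorem detect_generic {P : Monomial Y → (BiPoly k Y)[X]} {w w' : Monomial Y}
    (hw' : ∃ c : k, c ≠ 0 ∧ Lead w'.polyDegree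
      (c • biMono k (w'.leftLetters : Multiset Y) (w'.rightLetters : Multiset Y)) (P w'))
    (h : biCoeff k (w.leftLetters : Multiset Y) (w.rightLetters : Multiset Y)
      ((P w').coeff w.polyDegree) ≠ 0) :
    w.polyDegree < w'.polyDegree ∨ w.polyDegree = w'.polyDegree ∧
      (w.leftLetters : Multiset Y) = w'.leftLetters ∧
      (w.rightLetters : Multiset Y) = w'.rightLetters := by
  obtain ⟨c, hc, hl⟩ := hw'
  rcases lt_trichotomy w.polyDegree w'.polyDegree with h1 | h1 | h1
  · exact Or.inl h1
  · rw [h1, hl.2] at h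
    exact Or.inr ⟨h1, biCoeff_smul_biMono_ne h⟩
  · rw [hl.coeff_lt h1, map_zero] at h
    exact absurd rfl h

theorem detect_self [CharZero k] {P : Monomial Y → (BiPoly k Y)[X]}
    (hP : ∀ w, ∃ c : k, c ≠ 0 ∧ Lead w.polyDegree
      (c • biMono k (w.leftLetters : Multiset Y) (w.rightLetters : Multiset Y)) (P w))
    (hP4 : ∀ xs y z hx hy, P (.fam₄ xs y z hx hy) =
      C (biMono k (y ::ₘ (xs : Multiset Y)) {z} - biMono k (z ::ₘ (xs : Multiset Y)) {y}) +
        X * C (biMono k (xs : Multiset Y) (([y, z] : List Y) : Multiset Y))) (w : Monomial Y) :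
    w.detect k (P w) ≠ 0 := by
  have gen : ∀ w : Monomial Y, biCoeff k (w.leftLetters : Multiset Y)
      (w.rightLetters : Multiset Y) ((P w).coeff w.polyDegree) ≠ 0 := by
    intro w
    obtain ⟨c, hc, hl⟩ := hP w
    rw [hl.2, map_smul, biCoeff_biMono_self, smul_eq_mul, mul_one]
    exact hc
  rcases w with ⟨xs, ys, z, u, hx, hy⟩ | ⟨xs, ys, s, z, hx, hy, hs⟩ | ⟨xs, ys, z, hx, hy, hm⟩ |
    ⟨xs, y, z, hx, hy⟩
  · exact gen (.fam₁ xs ys z u hx hy)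
  · exact gen (.fam₂ xs ys s z hx hy hs)
  · exact gen (.fam₃ xs ys z hx hy hm)
  · by_cases hyz : y ≤ z
    · rw [Monomial.detect, if_pos hyz]
      exact gen (.fam₄ xs y z hx hy)
    · have hyz' := (not_le.1 hyz).le
      rw [Monomial.detect, if_neg hyz, hP4]
      have e : (([y, z] : List Y) : Multiset Y) = ([z, y] : List Y) :=
        Multiset.coe_eq_coe.2 (List.Perm.swap z y [])
      simp only [LinearMap.comp_apply, LinearMap.sub_apply, LinearMap.coe_restrictScalars,
        lcoeff_apply, coeff_add, coeff_C_zero, coeff_X_mul_zero, add_zero]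
      rw [coeff_C, if_neg one_ne_zero, zero_add, coeff_X_mul, coeff_C_zero, e,
        fam₄Correction_of_le k xs hyz', map_sub, map_sub, map_sub, biCoeff_biMono_self,
        biCoeff_biMono_of_ne k (B' := {y})]
      -- The subtracted term is the negative of the constant coefficient, so the value is 2.
      · norm_num
      · intro h
        have := (Prod.mk.inj h).2
        rw [Multiset.singleton_inj] at this
        exact hyz this.ge

/-- Degree and leading coefficient determine a monomial within its family, since its letters are
sorted; unsorted pairs are recognized by the corrected constant coefficient. The rank accounts for
what else may be seen: a functional reading a coefficient at X^N also sees monomials of larger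
degree, and that of a sorted pair also sees the unsorted pair with the same letters. -/
theorem detect_lt [CharZero k] {P : Monomial Y → (BiPoly k Y)[X]}
    (hP : ∀ w, ∃ c : k, c ≠ 0 ∧ Lead w.polyDegree
      (c • biMono k (w.leftLetters : Multiset Y) (w.rightLetters : Multiset Y)) (P w))
    (hP4 : ∀ xs y z hx hy, P (.fam₄ xs y z hx hy) =
      C (biMono k (y ::ₘ (xs : Multiset Y)) {z} - biMono k (z ::ₘ (xs : Multiset Y)) {y}) +
        X * C (biMono k (xs : Multiset Y) (([y, z] : List Y) : Multiset Y))) (w w' : Monomial Y)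
    (h : w.detect k (P w') ≠ 0) (hne : w' ≠ w) : w.rank < w'.rank := by
  rcases w with ⟨xs, ys, z, u, hx, hy⟩ | ⟨xs, ys, s, z, hx, hy, hs⟩ | ⟨xs, ys, z, hx, hy, hm⟩ |
    ⟨xs, y, z, hx, hy⟩
  · have key := detect_generic (w := .fam₁ xs ys z u hx hy) (hP w') h
    rcases w' with ⟨xs', ys', z', u', hx', hy'⟩ | ⟨xs', ys', s', z', hx', hy', hs'⟩ |
      ⟨xs', ys', z', hx', hy', hm'⟩ | ⟨xs', y', z', hx', hy'⟩
    · rcases key with key | ⟨-, hA, hB⟩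
      · exact absurd key (lt_irrefl 0)
      · obtain ⟨h1, h2⟩ := Monomial.letters_eq (w := .fam₁ xs ys z u hx hy)
          (w' := .fam₁ xs' ys' z' u' hx' hy') hy hy' hA hB
        simp only [Monomial.leftLetters, Monomial.rightLetters] at h1 h2
        obtain ⟨h3, h4⟩ := List.append_inj' h2 rfl
        simp only [List.cons.injEq, and_true] at h4
        obtain ⟨rfl, rfl⟩ := h4
        subst h1 h3
        exact absurd rfl hne
    · simp [Monomial.rank]
    · simp [Monomial.rank]
    -- The constant coefficient of a monomial of the fourth family has a single b, while at least
    -- two occur in the first family.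
    · exfalso
      change biCoeff k (xs : Multiset Y) ((ys ++ [z, u] : List Y) : Multiset Y)
        ((P (.fam₄ xs' y' z' hx' hy')).coeff 0) ≠ 0 at h
      rw [hP4, coeff_add, coeff_C_zero, coeff_X_mul_zero, add_zero, map_sub,
        biCoeff_biMono_of_ne, biCoeff_biMono_of_ne, sub_self] at h
      · exact h rfl
      all_goals
        intro e
        have := congrArg Multiset.card (Prod.mk.inj e).2
        simp at this
  · have key := detect_generic (w := .fam₂ xs ys s z hx hy hs) (hP w') h
    rcases w' with ⟨xs', ys', z', u', hx', hy'⟩ | ⟨xs', ys', s', z', hx', hy', hs'⟩ |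
      ⟨xs', ys', z', hx', hy', hm'⟩ | ⟨xs', y', z', hx', hy'⟩
    · simp only [Monomial.polyDegree] at key
      omega
    · rcases key with key | ⟨hs2, hA, hB⟩
      · simpa [Monomial.rank, Monomial.polyDegree] using key
      · obtain ⟨h1, h2⟩ := Monomial.letters_eq (w := .fam₂ xs ys s z hx hy hs)
          (w' := .fam₂ xs' ys' s' z' hx' hy' hs') hy hy' hA hB
        simp only [Monomial.leftLetters, Monomial.rightLetters] at h1 h2
        obtain ⟨h3, h4⟩ := List.append_inj' h2 rfl
        simp only [List.cons.injEq, and_true] at h4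
        simp only [Monomial.polyDegree, add_left_inj] at hs2
        subst h1 h3 h4 hs2
        exact absurd rfl hne
    · simp only [Monomial.polyDegree] at key
      omega
    · simp only [Monomial.polyDegree] at key
      omega
  · have key := detect_generic (w := .fam₃ xs ys z hx hy hm) (hP w') h
    rcases w' with ⟨xs', ys', z', u', hx', hy'⟩ | ⟨xs', ys', s', z', hx', hy', hs'⟩ |
      ⟨xs', ys', z', hx', hy', hm'⟩ | ⟨xs', y', z', hx', hy'⟩
    · simp only [Monomial.polyDegree] at key
      omega
    · simp [Monomial.rank]
    · rcases key with key | ⟨-, hA, hB⟩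
      · exact absurd key (lt_irrefl 1)
      · obtain ⟨h1, h2⟩ := Monomial.letters_eq (w := .fam₃ xs ys z hx hy hm)
          (w' := .fam₃ xs' ys' z' hx' hy' hm') hy hy' hA hB
        simp only [Monomial.leftLetters, Monomial.rightLetters] at h1 h2
        obtain ⟨h3, h4⟩ := List.append_inj' h2 rfl
        simp only [List.cons.injEq, and_true] at h4
        subst h1 h3 h4
        exact absurd rfl hne
    · rcases key with key | ⟨-, hA, hB⟩
      · exact absurd key (lt_irrefl 1)
      -- The condition m = 0 or m ≥ 2 enters here: the third family has one or at least three
      -- letters b, the fourth has exactly two.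
      · have := congrArg Multiset.card hB
        simp [Monomial.rightLetters] at this
        omega
  · by_cases hyz : y ≤ z
    · rw [Monomial.detect, if_pos hyz] at h
      have key := detect_generic (w := .fam₄ xs y z hx hy) (hP w') h
      rw [Monomial.rank, if_pos hyz]
      rcases w' with ⟨xs', ys', z', u', hx', hy'⟩ | ⟨xs', ys', s', z', hx', hy', hs'⟩ |
        ⟨xs', ys', z', hx', hy', hm'⟩ | ⟨xs', y', z', hx', hy'⟩
      · simp [Monomial.rank]
      · simp [Monomial.rank]
      · simp [Monomial.rank]
      · by_cases hyz' : y' ≤ z'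
        · rcases key with key | ⟨-, hA, hB⟩
          · exact absurd key (lt_irrefl 1)
          · obtain ⟨h1, h2⟩ := Monomial.letters_eq (w := .fam₄ xs y z hx hy)
              (w' := .fam₄ xs' y' z' hx' hy') (by simpa [Monomial.IsSorted, Monomial.rightLetters]
                using hyz) (by simpa [Monomial.IsSorted, Monomial.rightLetters] using hyz') hA hB
            simp only [Monomial.leftLetters, Monomial.rightLetters, List.cons.injEq,
              and_true] at h1 h2
            obtain ⟨rfl, rfl⟩ := h2
            subst h1
            exact absurd rfl hne
        · simp [Monomial.rank, hyz']
    · rw [Monomial.detect, if_neg hyz] at h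
      simp only [LinearMap.comp_apply, LinearMap.sub_apply, LinearMap.coe_restrictScalars,
        lcoeff_apply] at h
      rw [Monomial.rank, if_neg hyz]
      rcases w' with ⟨xs', ys', z', u', hx', hy'⟩ | ⟨xs', ys', s', z', hx', hy', hs'⟩ |
        ⟨xs', ys', z', hx', hy', hm'⟩ | ⟨xs', y', z', hx', hy'⟩
      · exfalso
        obtain ⟨c, hc, hl⟩ := hP (.fam₁ xs' ys' z' u' hx' hy')
        rw [hl.coeff_lt (show _ < 1 from Nat.one_pos), map_zero, sub_zero] at h
        have h0 := hl.2
        simp only [Monomial.polyDegree] at h0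
        rw [h0] at h
        have := congrArg Multiset.card (biCoeff_smul_biMono_ne h).2
        simp [Monomial.rightLetters] at this
      · simp [Monomial.rank]
      · simp [Monomial.rank]
      · exfalso
        rw [hP4] at h
        simp only [coeff_add, coeff_C_zero, coeff_X_mul_zero, add_zero] at h
        rw [coeff_C, if_neg one_ne_zero, zero_add, coeff_X_mul, coeff_C_zero] at h
        -- For y' ≤ z' the correction cancels the constant coefficient; for y' > z' it doubles it.
        by_cases hyz' : y' ≤ z'
        · rw [fam₄Correction_of_le k xs' hyz', sub_self, map_zero] at h
          exact h rfl
        · have e : (([y', z'] : List Y) : Multiset Y) = ([z', y'] : List Y) :=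
            Multiset.coe_eq_coe.2 (List.Perm.swap z' y' [])
          rw [e, fam₄Correction_of_le k xs' (not_le.1 hyz').le] at h
          have hxy := le_of_getLast hx (hy.resolve_right hyz)
          have hxy' := le_of_getLast hx' (hy'.resolve_right hyz')
          by_cases h1 : (y ::ₘ (xs : Multiset Y), ({z} : Multiset Y)) = (y' ::ₘ (xs' : Multiset Y), {z'})
          · obtain ⟨hA, hB⟩ := Prod.mk.inj h1
            rw [Multiset.singleton_inj] at hB
            -- Since y > z, the condition of the fourth family makes y the largest of the letters a;
            -- the same holds for y'.
            have hyy : y = y' := by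
              refine le_antisymm ?_ ?_
              · have : y ∈ y' ::ₘ (xs' : Multiset Y) := hA ▸ Multiset.mem_cons_self _ _
                rcases Multiset.mem_cons.1 this with h2 | h2
                · exact h2.le
                · exact hxy' _ (Multiset.mem_coe.1 h2)
              · have : y' ∈ y ::ₘ (xs : Multiset Y) := hA ▸ Multiset.mem_cons_self _ _
                rcases Multiset.mem_cons.1 this with h2 | h2
                · exact h2.le
                · exact hxy _ (Multiset.mem_coe.1 h2)
            subst hyy hB
            have := eq_of_coe_eq hx hx' ((Multiset.cons_inj_right y).1 hA)
            subst this
            exact hne rfl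
          -- The second term would require y' = z and y among z' and xs', all of which are at most
          -- y' = z < y.
          · have h2 : (y ::ₘ (xs : Multiset Y), ({z} : Multiset Y)) ≠
                (z' ::ₘ (xs' : Multiset Y), {y'}) := by
              intro h2
              obtain ⟨hA, hB⟩ := Prod.mk.inj h2
              rw [Multiset.singleton_inj] at hB
              subst hB
              have : y ∈ z' ::ₘ (xs' : Multiset Y) := hA ▸ Multiset.mem_cons_self _ _
              rcases Multiset.mem_cons.1 this with h2 | h2
              · exact hyz (h2.le.trans (not_le.1 hyz').le)
              · exact hyz (hxy' _ (Multiset.mem_coe.1 h2))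
            simp only [map_sub, biCoeff_biMono_of_ne k h1, biCoeff_biMono_of_ne k h2, sub_self] at h
            exact h rfl

variable (k Y) in
/-- The monomials are linearly independent in the commutative model. -/
theorem linearIndependent_eval_biDist [CharZero k] :
    LinearIndependent k fun w : Monomial Y => w.eval k (biDist k) := by
  obtain ⟨P, hP, hl, h4⟩ := exists_eval_poly (k := k) (Y := Y)
  have h := linearIndependent_of_triangular P (fun w => w.detect k) Monomial.rank
    (detect_self hl h4) (detect_lt hl h4)
  have h' := h.map' (Dist.ofPoly k (BiPoly k Y)) (LinearMap.ker_eq_bot.2 Dist.ofPoly_injective)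
  exact (funext hP : (fun w : Monomial Y => w.eval k (biDist k)) = _) ▸ h'

/-- The homomorphism from the free commutative conformal algebra to its model. -/
theorem exists_comConf_hom [CharZero k] {Y : Type*} : ∃ f : ComConf k (fun _ _ : Y => 3) →ₗ[k]
    Dist (BiPoly k Y), IsHom f ∧ ∀ y, f (ComConf.of k _ y) = biDist k y := by
  obtain ⟨f, hf, hfo⟩ := FreeAssoc.exists_hom (k := k) (N := fun _ _ : Y => 3)
    (Dist.nprod_del_left k) (Dist.nprod_del_right k) (biDist k) (biDist_local k)
  -- The vanishing of commutators is available for polynomial distributions, so the image is first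
  -- shown to consist of these.
  have hr : ∀ a, f a ∈ LinearMap.range (Dist.ofPoly k (BiPoly k Y)) := by
    intro a
    induction a using FreeAssoc.induction with
    | hof x => rw [hfo]; exact ⟨_, rfl⟩
    | hzero => rw [map_zero]; exact Submodule.zero_mem _
    | hadd a b ha hb => rw [map_add]; exact Submodule.add_mem _ ha hb
    | hsmul c a ha => rw [map_smul]; exact Submodule.smul_mem _ _ ha
    | hdel a ha =>
      obtain ⟨p, hp⟩ := ha
      rw [hf.map_del, ← hp, Dist.del_ofPoly]
      exact ⟨_, rfl⟩
    | hprod n a b ha hb =>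
      obtain ⟨p, hp⟩ := ha
      obtain ⟨q, hq⟩ := hb
      rw [hf.map_nprod, ← hp, ← hq, Dist.nprod_ofPoly]
      exact ⟨_, rfl⟩
  obtain ⟨g, hg, hgf⟩ := exists_lift k
    (S := {f : FreeAssoc k (fun _ _ : Y => 3) | ∃ n a b, f = comm k n a b}) hf (by
      rintro _ ⟨n, a, b, rfl⟩
      obtain ⟨N, hN⟩ := IsConformal.exists_local (k := k) b a
      rw [hf.map_comm]
      exact Dist.comm_eq_zero (hr a) (hr b) (hf.map_local hN) n)
  exact ⟨g, hg, fun y => (hgf _).trans (hfo y)⟩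

end Independence

/-! ### Monomials under homomorphisms -/

section EvalHom

variable {k : Type*} {C C' : Type*} [Field k] [AddCommGroup C] [Module k C] [Ops k C]
  [AddCommGroup C'] [Module k C'] [Ops k C'] {Y : Type*}

theorem IsHom.map_opL {f : C →ₗ[k] C'} (hf : IsHom f) (ι : Y → C) (n : ℕ) (xs : List Y) (v : C) :
    f (opL k ι n xs v) = opL k (fun y => f (ι y)) n xs (f v) := by
  induction xs with
  | nil => rfl
  | cons x xs ih => exact (hf.map_nprod n _ _).trans (congrArg (nprod k n (f (ι x))) ih)

theorem IsHom.map_eval [LinearOrder Y] {f : C →ₗ[k] C'} (hf : IsHom f) (ι : Y → C)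
    (w : Monomial Y) : f (w.eval k ι) = w.eval k fun y => f (ι y) := by
  cases w <;> simp only [Monomial.eval, hf.map_opL, hf.map_nprod, hf.map_del_pow]

variable (k Y) in
/-- The monomials are linearly independent in the free commutative conformal algebra. -/
theorem linearIndependent_comConf [CharZero k] [LinearOrder Y] : LinearIndependent k
    fun w : Monomial Y => w.eval k (ComConf.of k (fun _ _ : Y => 3)) := by
  obtain ⟨f, hf, hfo⟩ := exists_comConf_hom (k := k) (Y := Y)
  refine LinearIndependent.of_comp f ?_
  have : (f ∘ fun w : Monomial Y => w.eval k (ComConf.of k (fun _ _ : Y => 3))) =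
      fun w => w.eval k (biDist k) := by
    funext w
    simp only [Function.comp_apply, hf.map_eval, hfo]
  rw [this]
  exact linearIndependent_eval_biDist k Y

end EvalHom

end ConformalAlg

namespace ConformalAlg

/-! ### Operators on the space of compatible functionals -/

section Operators

variable {k : Type*} [Field k] {g : Type*} [LieRing g] [LieAlgebra k g] {Y : Type*}
  (form : LinearMap.BilinForm k g) (X₁ : Module.Basis Y k g)

/-- Two linear maps that agree on the words of each length are equal. -/
theorem ext_homog {M α : Type*} [AddCommGroup M] [Module k M] {f f' : FreeAlgebra k α →ₗ[k] M}
    (h : ∀ n, ∀ P ∈ homog k α n, f P = f' P) : f = f' :=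
  (FreeAlgebra.basisFreeMonoid k α).ext fun w => by
    have e := basis_ofList (k := k) w.toList
    rw [FreeMonoid.ofList_toList] at e
    rw [e]
    exact h _ _ (wd_mem_homog _)

/-- Newton interpolation at 0, 1, 2. It turns quadratic dependence into an identity that makes sense
for operators. -/
theorem quad_lagrange [CharZero k] {f : ℤ → k} (h : f ∈ quad k) (t : ℤ) :
    f t = f 0 + (t : k) * (f 1 - f 0) +
      ((t : k) * ((t : k) - 1) / 2) * (f 2 - 2 * f 1 + f 0) := by
  obtain ⟨a, b, c, h⟩ := h
  simp only [h]
  push_cast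
  ring

theorem mem_quad_congr {f f' : ℤ → k} (h : f ∈ quad k) (e : ∀ t, f' t = f t) : f' ∈ quad k := by
  rwa [funext e]

theorem const_mem_quad (a : k) : (fun _ : ℤ => a) ∈ quad k := ⟨a, 0, 0, fun t => by simp⟩

/-- Pairs of a functional and a level such that the functional is compatible at that level. -/
def Functionals : Submodule k ((FreeAlgebra k (Y × ℤ) →ₗ[k] k) × k) where
  carrier := {F | ∀ M, Compat form X₁ F.2 M F.1}
  add_mem' := by
    rintro ⟨F, γ⟩ ⟨F', γ'⟩ h h' M
    refine ⟨fun i j hij P hP Q hQ m n p q => ?_, fun w hw hb => ?_⟩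
    · have h1 := (h M).comm i j hij P hP Q hQ m n p q
      have h2 := (h' M).comm i j hij P hP Q hQ m n p q
      simp only [Prod.mk_add_mk, LinearMap.add_apply] at h1 h2 ⊢
      rw [h1, h2]
      ring
    · exact add_mem ((h M).loc w hw hb) ((h' M).loc w hw hb)
  zero_mem' := fun M => ⟨fun i j hij P hP Q hQ m n p q => by simp, fun w hw hb => zero_mem _⟩
  smul_mem' := by
    rintro c ⟨F, γ⟩ h M
    refine ⟨fun i j hij P hP Q hQ m n p q => ?_, fun w hw hb => ?_⟩
    · have h1 := (h M).comm i j hij P hP Q hQ m n p q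
      simp only [Prod.smul_mk, LinearMap.smul_apply, smul_eq_mul] at h1 ⊢
      rw [h1]
      ring
    · exact Submodule.smul_mem _ c ((h M).loc w hw hb)

/-- The space of pairs of a functional and a level such that the functional is compatible at that
level. -/
def FunctionalSpace : Type _ := ↥(Functionals form X₁)

instance : AddCommGroup (FunctionalSpace form X₁) :=
  inferInstanceAs (AddCommGroup ↥(Functionals form X₁))

instance : Module k (FunctionalSpace form X₁) := inferInstanceAs (Module k ↥(Functionals form X₁))

variable {form X₁}

theorem aug_modeOf (m : ℤ) (p : g) : aug k (modeOf X₁ m p) = 0 :=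
  aug_homog one_ne_zero (modeOf_mem X₁ m p)

/-- The extra factor on the right has augmentation zero, so the central term disappears and the
level becomes 0. For locality the new letter is given slope 0, which keeps the word balanced. -/
theorem Compat.mulRight {γ : k} {F : FreeAlgebra k (Y × ℤ) →ₗ[k] k} {M : ℕ}
    (h : Compat form X₁ γ (M + 1) F) (n : ℤ) (p : g) :
    Compat form X₁ 0 M (F ∘ₗ LinearMap.mulRight k (modeOf X₁ n p)) where
  comm i j hij P hP Q hQ m n' p' q := by
    have h1 := h.comm i (j + 1) (by omega) P hP _ (mul_mem_homog hQ (modeOf_mem X₁ n p)) m n' p' q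
    rw [LinearMap.comp_apply, LinearMap.mulRight_apply, mul_assoc, h1, map_mul, aug_modeOf]
    ring
  loc w hw hb := by
    induction X₁.mem_span p using Submodule.span_induction with
    | mem p hp =>
      obtain ⟨y, rfl⟩ := hp
      have h1 := h.loc (w ++ [(y, n, 0)]) (by simpa using hw) (by
        obtain ⟨h1, h2⟩ := hb
        exact ⟨by simpa using h1, by simpa using h2⟩)
      refine mem_quad_congr h1 fun t => ?_
      rw [LinearMap.comp_apply, LinearMap.mulRight_apply, modeOf_basis, List.map_append, wd_append]
      simp [atTime, wd]
    | zero =>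
      refine mem_quad_congr (zero_mem (quad k)) fun t => ?_
      simp
    | add p q _ _ h1 h2 =>
      refine mem_quad_congr (add_mem h1 h2) fun t => ?_
      simp only [Pi.add_apply, LinearMap.comp_apply, LinearMap.mulRight_apply, map_add, mul_add]
    | smul c p _ h1 =>
      refine mem_quad_congr (Submodule.smul_mem _ c h1) fun t => ?_
      simp only [Pi.smul_apply, LinearMap.comp_apply, LinearMap.mulRight_apply, map_smul,
        mul_smul_comm]

theorem compat_aug (γ : k) (M : ℕ) : Compat form X₁ 0 M (γ • (aug k (α := Y × ℤ)).toLinearMap) where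
  comm i j hij P hP Q hQ m n p q := by
    have : aug k (defect X₁ m n p q) = 0 := by
      rw [defect_apply, map_sub, map_sub, map_mul, map_mul, aug_modeOf, aug_modeOf, aug_modeOf]
      ring
    rw [LinearMap.smul_apply, AlgHom.toLinearMap_apply, map_mul, map_mul, this]
    simp
  loc w hw hb := by
    rcases w with _ | ⟨a, w⟩
    · exact const_mem_quad (γ * aug k (1 : FreeAlgebra k (Y × ℤ)))
    · refine mem_quad_congr (zero_mem (quad k)) fun t => ?_
      rw [List.map_cons, wd_cons, LinearMap.smul_apply, AlgHom.toLinearMap_apply, map_mul, aug_ι]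
      simp

variable (form X₁)

/-- The operator of right multiplication by the mode `p(n)`. -/
noncomputable def opMode (n : ℤ) : g →ₗ[k] Module.End k (FunctionalSpace form X₁) where
  toFun p :=
    -- Because right multiplication acts on the argument of the functional, composition keeps the
    -- order: the operator of a times that of b sends F to P ↦ F(P a b).
    { toFun := fun F => ⟨(F.1.1 ∘ₗ LinearMap.mulRight k (modeOf X₁ n p), 0),
        fun M => (F.2 (M + 1)).mulRight n p⟩
      map_add' := fun F F' => Subtype.ext (Prod.ext (by rfl) (add_zero 0).symm)
      map_smul' := fun c F => Subtype.ext (Prod.ext (by rfl) (smul_zero c).symm) }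
  map_add' p q := LinearMap.ext fun F => Subtype.ext (Prod.ext (LinearMap.ext fun P => by
    change F.1.1 (P * modeOf X₁ n (p + q)) = F.1.1 (P * modeOf X₁ n p) + F.1.1 (P * modeOf X₁ n q)
    rw [map_add, mul_add, map_add]) (add_zero 0).symm)
  map_smul' c p := LinearMap.ext fun F => Subtype.ext (Prod.ext (LinearMap.ext fun P => by
    change F.1.1 (P * modeOf X₁ n (c • p)) = c • F.1.1 (P * modeOf X₁ n p)
    rw [map_smul, mul_smul_comm, map_smul]) (smul_zero c).symm)

/-- The operator corresponding to the central element. -/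
noncomputable def opCentral : Module.End k (FunctionalSpace form X₁) where
  toFun F := ⟨(F.1.2 • (aug k (α := Y × ℤ)).toLinearMap, 0), fun M => compat_aug F.1.2 M⟩
  map_add' _ _ := Subtype.ext (Prod.ext (add_smul _ _ _) (add_zero 0).symm)
  map_smul' c F := Subtype.ext (Prod.ext (smul_assoc c F.1.2 _) (smul_zero c).symm)

variable {form X₁}

theorem opMode_fst (n : ℤ) (p : g) (F : FunctionalSpace form X₁) (P : FreeAlgebra k (Y × ℤ)) :
    (opMode form X₁ n p F).1.1 P = F.1.1 (P * modeOf X₁ n p) := rfl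

theorem functionals_ext {F F' : FunctionalSpace form X₁} (h : ∀ P, F.1.1 P = F'.1.1 P)
    (h' : F.1.2 = F'.1.2) : F = F' := Subtype.ext (Prod.ext (LinearMap.ext h) h')

/-- This is `Compat.comm` with right factor 1: the level times the augmentation of P is the value of
`opCentral` at P. -/
theorem opMode_comm (m n : ℤ) (p q : g) :
    opMode form X₁ m p * opMode form X₁ n q - opMode form X₁ n q * opMode form X₁ m p =
      opMode form X₁ (m + n) ⁅p, q⁆ + cocyc form m p n q • opCentral form X₁ := by
  refine LinearMap.ext fun F => functionals_ext (fun P => ?_) ?_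
  · have h : F.1.1 ∘ₗ LinearMap.mulRight k (defect X₁ m n p q) =
        (F.1.2 * cocyc form m p n q) • (aug k (α := Y × ℤ)).toLinearMap := by
      refine ext_homog fun i P hP => ?_
      have h := (F.2 (i + 2)).comm i 0 le_rfl P hP 1 one_mem_homog m n p q
      rw [mul_one, map_one, mul_one] at h
      exact h
    have h := LinearMap.congr_fun h P
    rw [LinearMap.comp_apply, LinearMap.mulRight_apply, defect_apply, mul_sub, mul_sub, map_sub,
      map_sub, ← mul_assoc, ← mul_assoc, sub_eq_iff_eq_add'] at h
    refine h.trans ?_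
    change _ = F.1.1 (P * modeOf X₁ (m + n) ⁅p, q⁆) + cocyc form m p n q * (F.1.2 * aug k P)
    rw [LinearMap.smul_apply, AlgHom.toLinearMap_apply, smul_eq_mul]
    ring
  · change (0 : k) - 0 = 0 + cocyc form m p n q * 0
    simp

theorem opMode_mul_opCentral (n : ℤ) (p : g) : opMode form X₁ n p * opCentral form X₁ = 0 := by
  refine LinearMap.ext fun F => functionals_ext (fun P => ?_) rfl
  change F.1.2 * aug k (P * modeOf X₁ n p) = 0
  rw [map_mul, aug_modeOf]
  simp

/-- Locality of the operators `opMode`. -/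
theorem opMode_quad [CharZero k] (N : ℤ) (p q : g) (t : ℤ) :
    opMode form X₁ t p * opMode form X₁ (N - t) q =
      opMode form X₁ 0 p * opMode form X₁ N q +
      (t : k) • (opMode form X₁ 1 p * opMode form X₁ (N - 1) q -
        opMode form X₁ 0 p * opMode form X₁ N q) +
      ((t : k) * ((t : k) - 1) / 2) • (opMode form X₁ 2 p * opMode form X₁ (N - 2) q -
        (2 : k) • (opMode form X₁ 1 p * opMode form X₁ (N - 1) q) +
        opMode form X₁ 0 p * opMode form X₁ N q) := by
  let B : ℤ → g →ₗ[k] g →ₗ[k] Module.End k (FunctionalSpace form X₁) := fun t =>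
    (LinearMap.mul k (Module.End k (FunctionalSpace form X₁))).compl₁₂ (opMode form X₁ t)
      (opMode form X₁ (N - t))
  have key : B t = B 0 + (t : k) • (B 1 - B 0) +
      ((t : k) * ((t : k) - 1) / 2) • (B 2 - (2 : k) • B 1 + B 0) := by
    refine LinearMap.ext_basis X₁ X₁ fun x y => LinearMap.ext fun F =>
      functionals_ext (fun P => ?_) ?_
    · have hw : ∀ P : FreeAlgebra k (Y × ℤ),
          (fun t : ℤ => F.1.1 (P * modeOf X₁ t (X₁ x) * modeOf X₁ (N - t) (X₁ y))) ∈ quad k := by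
        intro P
        induction (FreeAlgebra.basisFreeMonoid k (Y × ℤ)).mem_span P using
          Submodule.span_induction with
        | mem P hP =>
          obtain ⟨w, rfl⟩ := hP
          have e := basis_ofList (k := k) w.toList
          rw [FreeMonoid.ofList_toList] at e
          rw [e]
          -- The letters of the prefix stand still; the last two move with slopes 1 and -1.
          let w' : List (Y × ℤ × ℤ) := w.toList.map fun a => (a.1, a.2, 0)
          have hb : Balanced (w' ++ [(x, 0, 1), (y, N, -1)]) := by
            constructor
            · simp [w', Function.comp_def]
            · simp [w', Function.comp_def]
          have h := (F.2 _).loc _ le_rfl hb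
          refine mem_quad_congr h fun t => ?_
          have e2 : w'.map (atTime t) = w.toList := by
            simp [w', atTime, Function.comp_def]
          rw [List.map_append, e2, wd_append, modeOf_basis, modeOf_basis, mul_assoc]
          simp [atTime, wd, sub_eq_add_neg]
        | zero =>
          refine mem_quad_congr (zero_mem (quad k)) fun t => ?_
          simp
        | add P Q _ _ h1 h2 =>
          refine mem_quad_congr (add_mem h1 h2) fun t => ?_
          simp only [Pi.add_apply, map_add, add_mul]
        | smul c P _ h1 =>
          refine mem_quad_congr (Submodule.smul_mem _ c h1) fun t => ?_
          simp only [Pi.smul_apply, map_smul, smul_mul_assoc]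
      exact quad_lagrange (hw P) t
    · change (0 : k) = 0 + _ * (0 - 0) + _ * (0 - _ * 0 + 0)
      ring
  have h0 : B 0 p q = opMode form X₁ 0 p * opMode form X₁ N q := by
    change opMode form X₁ 0 p * opMode form X₁ (N - 0) q = _
    rw [sub_zero]
  rw [← h0]
  exact LinearMap.congr_fun (LinearMap.congr_fun key p) q

end Operators

/-! ### Distributions with quadratic products -/

namespace Dist

variable {k : Type*} [Field k] {A : Type*} [Ring A] [Algebra k A]

variable (k) in
/-- The products `a(t) b(N - t)` are quadratic functions of `t`. -/
def Quadratic (a b : Dist A) : Prop := ∀ N t : ℤ, a t * b (N - t) =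
  a 0 * b N + (t : k) • (a 1 * b (N - 1) - a 0 * b N) +
    ((t : k) * ((t : k) - 1) / 2) • (a 2 * b (N - 2) - (2 : k) • (a 1 * b (N - 1)) + a 0 * b N)

theorem Quadratic.localAt [CharZero k] {a b : Dist A} (h : Quadratic k a b) : LocalAt k 3 a b := by
  intro n hn
  refine Dist.ext fun m => ?_
  rw [nprod_apply, zero_apply]
  let φ₀ : A := a 0 * b (n + m)
  let φ₁ : A := a 1 * b (n + m - 1) - a 0 * b (n + m)
  let φ₂ : A := a 2 * b (n + m - 2) - (2 : k) • (a 1 * b (n + m - 1)) + a 0 * b (n + m)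
  -- The three vectors are the coefficients of 1, s, s² in the interpolation formula at t = n - s.
  rw [← sum_alternating_quadratic (k := k)
    (φ₀ + (n : k) • φ₁ + ((n : k) * ((n : k) - 1) / 2) • φ₂)
    (-φ₁ + (-(2 * (n : k) - 1) / 2) • φ₂) ((1 / 2 : k) • φ₂) hn]
  refine Finset.sum_congr rfl fun s _ => ?_
  have e : m + (s : ℤ) = (n + m : ℤ) - (n - s) := by ring
  rw [e, h]
  change _ • (φ₀ + _ • φ₁ + _ • φ₂) = _
  congr 1
  push_cast
  module

theorem nprod_zero_apply (a b : Dist A) (m : ℤ) : nprod k 0 a b m = a 0 * b m := by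
  simp [nprod_apply]

theorem nprod_one_apply (a b : Dist A) (m : ℤ) :
    nprod k 1 a b m = a 1 * b m - a 0 * b (m + 1) := by
  simp [nprod_apply, Finset.sum_range_succ, sub_eq_add_neg]

theorem nprod_two_apply (a b : Dist A) (m : ℤ) :
    nprod k 2 a b m = a 2 * b m - (2 : k) • (a 1 * b (m + 1)) + a 0 * b (m + 2) := by
  simp [nprod_apply, Finset.sum_range_succ, sub_eq_add_neg]

/-- The mode m - s of the product of order s of b and a is the s-th difference at 0 of t ↦ b(t) a(m
- t), so the reversed product is the Newton expansion of that function at t = m. Here and in orders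
one and two, the reversed product thus becomes the defining sum with the factors exchanged. -/
theorem Quadratic.rev_zero [CharZero k] {a b : Dist A} (h : Quadratic k b a) (m : ℤ) :
    rev k 0 b a m = b m * a 0 := by
  have h1 := h m m
  rw [sub_self] at h1
  rw [h1, rev_eq_sum h.localAt]
  simp only [Finset.sum_range_succ, Finset.sum_range_zero, zero_add, add_apply, smul_apply,
    pow_zero, pow_succ, Module.End.mul_apply, Module.End.one_apply, del_apply, nprod_zero_apply,
    nprod_one_apply, nprod_two_apply, Nat.factorial]
  have e1 : m - 1 + 1 = m := by ring
  have e2 : m - 1 - 1 + 1 = m - 1 := by ring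
  have e3 : m - 1 - 1 + 2 = m := by ring
  have e4 : m - 1 - 1 = m - 2 := by ring
  rw [e1, e2, e3, e4]
  push_cast
  module

theorem Quadratic.rev_one [CharZero k] {a b : Dist A} (h : Quadratic k b a) (m : ℤ) :
    rev k 1 b a m = b m * a 1 - b (m + 1) * a 0 := by
  have h0 : nprod k 3 b a = 0 := h.localAt 3 le_rfl
  have h1 := h (m + 1) m
  have h2 := h (m + 1) (m + 1)
  have e0 : m + 1 - m = 1 := by ring
  rw [e0] at h1
  rw [sub_self] at h2
  rw [h1, h2, rev_eq_sum h.localAt]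
  simp only [Finset.sum_range_succ, Finset.sum_range_zero, zero_add, add_apply, smul_apply,
    pow_zero, pow_succ, Module.End.mul_apply, Module.End.one_apply, del_apply, Nat.reduceAdd,
    nprod_one_apply, nprod_two_apply, Nat.factorial, h0, zero_apply]
  have e1 : m - 1 + 1 = m := by ring
  have e2 : m - 1 + 2 = m + 1 := by ring
  have e3 : m + 1 - 1 = m := by ring
  have e4 : m + 1 - 2 = m - 1 := by ring
  rw [e1, e2, e3, e4]
  push_cast
  module

theorem Quadratic.rev_two [CharZero k] {a b : Dist A} (h : Quadratic k b a) (m : ℤ) :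
    rev k 2 b a m = b m * a 2 - (2 : k) • (b (m + 1) * a 1) + b (m + 2) * a 0 := by
  have h0 : nprod k 3 b a = 0 := h.localAt 3 le_rfl
  have h0' : nprod k 4 b a = 0 := h.localAt 4 (by omega)
  have h1 := h (m + 2) m
  have h2 := h (m + 2) (m + 1)
  have h3 := h (m + 2) (m + 2)
  have e0 : m + 2 - m = 2 := by ring
  have e0' : m + 2 - (m + 1) = 1 := by ring
  rw [e0] at h1
  rw [e0'] at h2
  rw [sub_self] at h3
  rw [h1, h2, h3, rev_eq_sum h.localAt]
  simp only [Finset.sum_range_succ, Finset.sum_range_zero, zero_add, add_apply, smul_apply,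
    pow_zero, pow_succ, Module.End.mul_apply, Module.End.one_apply, del_apply, Nat.reduceAdd,
    nprod_two_apply, Nat.factorial, h0, h0', zero_apply]
  have e1 : m + 2 - 1 = m + 1 := by ring
  have e2 : m + 2 - 2 = m := by ring
  rw [e1, e2]
  push_cast
  module

theorem Quadratic.rev_eq_zero [CharZero k] {a b : Dist A} (h : Quadratic k b a) {n : ℕ}
    (hn : 3 ≤ n) : rev k n b a = 0 := by
  rw [rev_eq_sum h.localAt]
  refine Finset.sum_eq_zero fun s _ => ?_
  rw [h.localAt (n + s) (by omega), map_zero, smul_zero]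

end Dist

end ConformalAlg

namespace ConformalAlg

/-! ### Lie homomorphisms from Kac--Moody conformal algebras -/

section Torsion

variable {k : Type*} [Field k] {C : Type*} [AddCommGroup C] [Module k C] [Ops k C]
  [IsConformal k C]

theorem comm_add_left (n : ℕ) (a a' b : C) : comm k n (a + a') b = comm k n a b + comm k n a' b := by
  rw [comm, comm, comm, rev_add_right, nprod, map_add, LinearMap.add_apply]
  abel

theorem comm_add_right (n : ℕ) (a b b' : C) : comm k n a (b + b') = comm k n a b + comm k n a b' := by
  rw [comm, comm, comm, rev_add_left, nprod, map_add]
  abel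

theorem comm_smul_left (n : ℕ) (c : k) (a b : C) : comm k n (c • a) b = c • comm k n a b := by
  rw [comm, comm, rev_smul_right, nprod, map_smul, LinearMap.smul_apply, smul_sub]

theorem comm_smul_right (n : ℕ) (c : k) (a b : C) : comm k n a (c • b) = c • comm k n a b := by
  rw [comm, comm, rev_smul_left, nprod, map_smul, smul_sub]

variable [CharZero k]

/-- By sesquilinearity the product of order n is, up to the factor -(n + 1), that of order n + 1
with ∂e = 0 on the left; the factor is invertible in characteristic 0. -/
theorem nprod_left_of_del_eq_zero {e : C} (he : del k e = 0) (n : ℕ) (x : C) :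
    nprod k n e x = 0 := by
  have h := IsConformal.del_left (k := k) (n + 1) e x
  rw [he, nprod, map_zero, LinearMap.zero_apply, Nat.add_sub_cancel] at h
  have := smul_eq_zero.1 (neg_eq_zero.1 h.symm)
  exact this.resolve_left (Nat.cast_ne_zero.2 n.succ_ne_zero)

/-- Descending induction from the locality bound, since sesquilinearity expresses the product of
order n through that of order n + 1. -/
theorem nprod_right_of_del_eq_zero {e : C} (he : del k e = 0) (n : ℕ) (x : C) :
    nprod k n x e = 0 := by
  obtain ⟨N, hN⟩ := IsConformal.exists_local (k := k) x e
  have key : ∀ j n, N ≤ n + j → nprod k n x e = 0 := by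
    intro j
    induction j with
    | zero => exact fun n hn => hN n hn
    | succ j ih =>
      intro n hn
      have h := IsConformal.del_right (k := k) (n + 1) x e
      rw [he, nprod, map_zero, ih (n + 1) (by omega), map_zero, zero_add, Nat.add_sub_cancel] at h
      exact (smul_eq_zero.1 h.symm).resolve_left (Nat.cast_ne_zero.2 n.succ_ne_zero)
  exact key N n (by omega)

theorem rev_left_of_del_eq_zero {e : C} (he : del k e = 0) (n : ℕ) (x : C) :
    rev k n e x = 0 := by
  have h : LocalAt k 0 e x := fun n _ => nprod_left_of_del_eq_zero he n x
  rw [rev_eq_sum h, Finset.sum_range_zero]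

theorem rev_right_of_del_eq_zero {e : C} (he : del k e = 0) (n : ℕ) (x : C) :
    rev k n x e = 0 := by
  have h : LocalAt k 0 x e := fun n _ => nprod_right_of_del_eq_zero he n x
  rw [rev_eq_sum h, Finset.sum_range_zero]

theorem comm_left_of_del_eq_zero {e : C} (he : del k e = 0) (n : ℕ) (x : C) :
    comm k n e x = 0 := by
  rw [comm, nprod_left_of_del_eq_zero he, rev_right_of_del_eq_zero he, sub_zero]

theorem comm_right_of_del_eq_zero {e : C} (he : del k e = 0) (n : ℕ) (x : C) :
    comm k n x e = 0 := by
  rw [comm, nprod_right_of_del_eq_zero he, rev_left_of_del_eq_zero he, sub_zero]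

theorem comm_del_left (n : ℕ) (a b : C) :
    comm k n (del k a) b = -((n : k) • comm k (n - 1) a b) := by
  rw [comm, comm, rev_del_right, IsConformal.del_left, smul_sub]
  abel

theorem comm_del_right (n : ℕ) (a b : C) :
    comm k n a (del k b) = del k (comm k n a b) + (n : k) • comm k (n - 1) a b := by
  rw [comm, comm, comm, rev_del_left, IsConformal.del_right, smul_sub, map_sub]
  abel

open scoped Polynomial TensorProduct in
/-- Homomorphisms from `K(g)` are determined by the images of `g` and `e`. -/
theorem KacMoody.exists_lieHom {g : Type*} [LieRing g] [LieAlgebra k g]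
    {form : LinearMap.BilinForm k g} (Z : g →ₗ[k] C) {E : C} (hE : del k E = 0)
    (hZ : ∀ n a b, comm k n (Z a) (Z b) =
      if n = 0 then Z ⁅a, b⁆ else if n = 1 then form a b • E else 0) :
    ∃ ψ : KacMoody form →ₗ[k] C, IsLieHom ψ ∧ (∀ a, ψ (cur form a) = Z a) ∧ ψ (e form) = E := by
  -- k[∂] ⊗ g is free over k[∂] on a basis of g, so `Z` extends by letting polynomials act through
  -- ∂.
  let T : k[X] ⊗[k] g →ₗ[k] C := TensorProduct.lift
    (LinearMap.mk₂ k (fun f a => (Polynomial.aeval (del k : Module.End k C) f) (Z a))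
      (fun f f' a => by simp) (fun c f a => by simp) (fun f a a' => by simp)
      (fun c f a => by simp))
  let ψ : KacMoody form →ₗ[k] C :=
    (LinearMap.coprod T (LinearMap.toSpanSingleton k C E) : (k[X] ⊗[k] g) × k →ₗ[k] C)
  have hmk : ∀ u c, ψ ((u, c) : (k[X] ⊗[k] g) × k) = T u + c • E := fun u c => rfl
  have hcur : ∀ a, ψ (cur form a) = Z a := fun a => by
    rw [cur, hmk, zero_smul, add_zero]
    simp [T]
  have he : ψ (e form) = E := by
    rw [e, hmk, map_zero, zero_add, one_smul]
  have hdel : ∀ x, ψ (del k x) = del k (ψ x) := by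
    rintro ⟨u, c⟩
    rw [del_mk, hmk, hmk, map_add, map_smul, hE, smul_zero, zero_smul, add_zero, add_zero]
    induction u with
    | zero => simp
    | add u v hu hv => simp only [map_add, hu, hv]
    | tmul f a =>
      rw [curDel_tmul]
      simp [T]
  refine ⟨ψ, ⟨hdel, fun n x y => ?_⟩, hcur, he⟩
  induction x using induction_gen generalizing n with
  | hadd x x' h h' =>
    rw [map_add, comm_add_left, ← h, ← h', nprod, map_add, LinearMap.add_apply, map_add]
  | hsmul c x h =>
    rw [map_smul, comm_smul_left, ← h, nprod, map_smul, LinearMap.smul_apply, map_smul]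
  | hdel x h => rw [hdel, IsConformal.del_left, comm_del_left, map_neg, map_smul, h]
  | he => rw [he, nprod_e_left, comm_left_of_del_eq_zero hE, map_zero]
  | hcur a =>
    induction y using induction_gen generalizing n with
    | hadd x x' h h' => rw [map_add, comm_add_right, ← h, ← h', nprod, map_add, map_add]
    | hsmul c x h => rw [map_smul, comm_smul_right, ← h, nprod, map_smul, map_smul]
    | hdel x h =>
      rw [hdel, IsConformal.del_right, comm_del_right, map_add, map_smul, hdel, h, h]
    | he => rw [he, nprod_e_right, comm_right_of_del_eq_zero hE, map_zero]
    | hcur b =>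
      rw [hcur, hcur, hZ, nprod_cur]
      split_ifs
      · exact hcur _
      · rw [map_smul, he]
      · exact map_zero _

end Torsion

/-! ### The operator model of the universal envelope -/

section EnvModel

variable {k : Type*} [Field k] {g : Type*} [LieRing g] [LieAlgebra k g] {Y : Type*}
  (form : LinearMap.BilinForm k g) (X₁ : Module.Basis Y k g)

/-- The distribution of the modes of an element of the Lie algebra. -/
noncomputable def opDist : g →ₗ[k] Dist (Module.End k (FunctionalSpace form X₁)) where
  toFun p n := opMode form X₁ n p
  map_add' p q := funext fun n => map_add (opMode form X₁ n) p q
  map_smul' c p := funext fun n => map_smul (opMode form X₁ n) c p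

/-- The distribution of the central element. -/
noncomputable def centralDist : Dist (Module.End k (FunctionalSpace form X₁)) :=
  fun n => if n = -1 then opCentral form X₁ else 0

theorem opDist_apply (p : g) (n : ℤ) : opDist form X₁ p n = opMode form X₁ n p := rfl

theorem centralDist_apply (n : ℤ) :
    centralDist form X₁ n = if n = -1 then opCentral form X₁ else 0 := rfl

theorem del_centralDist : del k (centralDist form X₁) = 0 := by
  refine Dist.ext fun m => ?_
  rw [Dist.del_apply, centralDist_apply, Dist.zero_apply]
  split_ifs with h
  -- The only nonzero mode, -1, is shifted to mode 0, where the factor -m vanishes.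
  · have : m = 0 := by omega
    simp [this]
  · rw [smul_zero]

theorem opDist_quadratic [CharZero k] (p q : g) :
    Dist.Quadratic k (opDist form X₁ p) (opDist form X₁ q) := fun N t => opMode_quad N p q t

theorem opDist_local [CharZero k] (p q : g) :
    LocalAt k 3 (opDist form X₁ p) (opDist form X₁ q) := (opDist_quadratic form X₁ p q).localAt

/-- The left factor of an `n`-product enters only through the nonnegative modes n - s, and the
central distribution is concentrated in mode -1. -/
theorem nprod_centralDist_left (n : ℕ) (a : Dist (Module.End k (FunctionalSpace form X₁))) :
    nprod k n (centralDist form X₁) a = 0 := by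
  refine Dist.ext fun m => ?_
  rw [Dist.nprod_apply, Dist.zero_apply]
  refine Finset.sum_eq_zero fun s hs => ?_
  have : s ≤ n := by have := Finset.mem_range.1 hs; omega
  rw [centralDist_apply, if_neg (by omega), zero_mul, smul_zero]

theorem nprod_centralDist_right (n : ℕ) (p : g) :
    nprod k n (opDist form X₁ p) (centralDist form X₁) = 0 := by
  refine Dist.ext fun m => ?_
  rw [Dist.nprod_apply, Dist.zero_apply]
  refine Finset.sum_eq_zero fun s _ => ?_
  rw [centralDist_apply, opDist_apply]
  split_ifs
  · rw [opMode_mul_opCentral, smul_zero]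
  · rw [mul_zero, smul_zero]

/-- Mode m of the commutator of order n is the n-th alternating sum of the commutators of p(n - s)
and q(m + s). The brackets all have mode n + m and cancel for n ≥ 1. The cocycle is linear in n - s
and vanishes at mode 0, so it survives only for n = 1. -/
theorem comm_opDist [CharZero k] (n : ℕ) (p q : g) :
    comm k n (opDist form X₁ p) (opDist form X₁ q) =
      if n = 0 then opDist form X₁ ⁅p, q⁆ else if n = 1 then form p q • centralDist form X₁ else 0 := by
  have hq := opDist_quadratic form X₁ q p
  have hc : ∀ m n : ℤ, opMode form X₁ m p * opMode form X₁ n q =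
      opMode form X₁ n q * opMode form X₁ m p +
        (opMode form X₁ (m + n) ⁅p, q⁆ + cocyc form m p n q • opCentral form X₁) := fun m n => by
    rw [← opMode_comm]
    abel
  match n with
  | 0 =>
    rw [if_pos rfl]
    refine Dist.ext fun m => ?_
    rw [comm, Dist.sub_apply, Dist.nprod_zero_apply, hq.rev_zero]
    simp only [opDist_apply]
    rw [hc, zero_add]
    simp [cocyc]
  | 1 =>
    rw [if_neg one_ne_zero, if_pos rfl]
    refine Dist.ext fun m => ?_
    rw [comm, Dist.sub_apply, Dist.nprod_one_apply, hq.rev_one, Dist.smul_apply, centralDist_apply]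
    simp only [opDist_apply]
    rw [hc, hc, zero_add, add_comm m 1]
    have e : (1 + m = 0) ↔ (m = -1) := by omega
    simp only [cocyc, e]
    split_ifs <;> simp <;> abel
  | 2 =>
    rw [if_neg (by omega), if_neg (by omega)]
    refine Dist.ext fun m => ?_
    rw [comm, Dist.sub_apply, Dist.nprod_two_apply, hq.rev_two, Dist.zero_apply]
    simp only [opDist_apply]
    have e1 : 1 + (m + 1) = 2 + m := by ring
    have e2 : 0 + (m + 2) = 2 + m := by ring
    rw [hc, hc, hc]
    simp only [cocyc, e1, e2]
    split_ifs
    · push_cast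
      module
    · module
  | n + 3 =>
    rw [if_neg (by omega), if_neg (by omega), comm, opDist_local form X₁ p q _ (by omega),
      hq.rev_eq_zero (by omega), sub_zero]

/-- The operator model is a module over the universal envelope. -/
theorem exists_env_hom [CharZero k] : ∃ f : KacMoody.Env₃ form X₁ →ₗ[k]
    Dist (Module.End k (FunctionalSpace form X₁)), IsHom f ∧
      (∀ y, f (KacMoody.Env₃.of form X₁ y) = opDist form X₁ (X₁ y)) ∧
      f (KacMoody.Env₃.e form X₁) = centralDist form X₁ := by
  classical
  let N : KacMoody.gens form X₁ → KacMoody.gens form X₁ → ℕ := fun _ _ => 3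
  let gy : Y → KacMoody.gens form X₁ := fun y => ⟨KacMoody.cur form (X₁ y), Or.inl ⟨y, rfl⟩⟩
  let ge : KacMoody.gens form X₁ := ⟨KacMoody.e form, Or.inr rfl⟩
  have hcases : ∀ x : KacMoody.gens form X₁, (∃ y, x = gy y) ∨ x = ge := by
    rintro ⟨_, ⟨y, rfl⟩ | rfl⟩
    · exact Or.inl ⟨y, rfl⟩
    · exact Or.inr rfl
  have hne : ∀ y, gy y ≠ ge := by
    intro y h
    have h1 : KacMoody.cur form (X₁ y) = KacMoody.e form := congrArg Subtype.val h
    have h2 : (0 : k) = 1 := congrArg Prod.snd h1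
    exact zero_ne_one h2
  have hinj : ∀ y y', gy y = gy y' → X₁ y = X₁ y' := by
    intro y y' h
    have h1 : KacMoody.cur form (X₁ y) = KacMoody.cur form (X₁ y') := congrArg Subtype.val h
    have h2 : (1 : Polynomial k) ⊗ₜ[k] X₁ y = (1 : Polynomial k) ⊗ₜ[k] X₁ y' :=
      congrArg Prod.fst h1
    have h3 := congrArg ((TensorProduct.lid k g) ∘
      (LinearMap.rTensor g (Polynomial.lcoeff k 0))) h2
    simpa using h3
  let f₀ : KacMoody.gens form X₁ → Dist (Module.End k (FunctionalSpace form X₁)) := fun x =>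
    if h : ∃ y, x = gy y then opDist form X₁ (X₁ h.choose) else centralDist form X₁
  have hf₀y : ∀ y, f₀ (gy y) = opDist form X₁ (X₁ y) := by
    intro y
    have h : ∃ y', gy y = gy y' := ⟨y, rfl⟩
    simp only [f₀, dif_pos h]
    rw [hinj _ _ h.choose_spec]
  have hf₀e : f₀ ge = centralDist form X₁ := by
    have h : ¬ ∃ y', ge = gy y' := fun ⟨y, hy⟩ => hne y hy.symm
    simp only [f₀, dif_neg h]
  obtain ⟨G, hG, hGo⟩ := FreeAssoc.exists_hom (k := k) (N := N) (Dist.nprod_del_left k)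
    (Dist.nprod_del_right k) f₀ (by
      intro x y
      rcases hcases x with ⟨x, rfl⟩ | rfl
      · rcases hcases y with ⟨y, rfl⟩ | rfl
        · rw [hf₀y, hf₀y]
          exact opDist_local form X₁ _ _
        · rw [hf₀y, hf₀e]
          exact fun n _ => nprod_centralDist_right form X₁ n _
      · rw [hf₀e]
        exact fun n _ => nprod_centralDist_left form X₁ n _)
  -- The space of all distributions is not conformal, so the universal property of the envelope does
  -- not apply to it. The quotient by the kernel of `G` is conformal and embeds into that space,
  -- where the commutators are known.
  let S : Set (FreeAssoc k N) := {x | G x = 0}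
  let π : FreeAssoc k N →ₗ[k] FreeAssoc k N ⧸ idealSpan k S := (idealSpan k S).mkQ
  obtain ⟨G', hG', hG'π⟩ := exists_lift k (S := S) hG (fun x hx => hx)
  have hker : ∀ x, G' x = 0 → x = 0 := by
    intro x hx
    obtain ⟨x, rfl⟩ := Submodule.mkQ_surjective _ x
    rw [hG'π] at hx
    rw [Submodule.mkQ_apply, Submodule.Quotient.mk_eq_zero]
    exact subset_idealSpan k _ hx
  have hG'inj : Function.Injective G' := (injective_iff_map_eq_zero G').2 hker
  let Z : g →ₗ[k] FreeAssoc k N ⧸ idealSpan k S :=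
    X₁.constr k fun y => π (FreeAssoc.of k N (gy y))
  have hGZ : ∀ p, G' (Z p) = opDist form X₁ p := by
    have : G' ∘ₗ Z = opDist form X₁ := X₁.ext fun y => by
      rw [LinearMap.comp_apply, Module.Basis.constr_basis, hG'π, hGo, hf₀y]
    exact LinearMap.congr_fun this
  have hGE : G' (π (FreeAssoc.of k N ge)) = centralDist form X₁ := by
    rw [hG'π, hGo, hf₀e]
  obtain ⟨ψ, hψ, hψc, hψe⟩ := KacMoody.exists_lieHom (form := form) Z
    (E := π (FreeAssoc.of k N ge))
    (hG'inj (by rw [hG'.map_del, hGE, del_centralDist, map_zero])) (fun n a b => hG'inj (by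
      rw [hG'.map_comm, hGZ, hGZ, comm_opDist]
      split_ifs
      · exact (hGZ _).symm
      · rw [map_smul, hGE]
      · exact (map_zero _).symm))
  have hψx : ∀ x : KacMoody.gens form X₁, ψ x = π (FreeAssoc.of k N x) := by
    intro x
    rcases hcases x with ⟨x, rfl⟩ | rfl
    · exact (hψc _).trans (Module.Basis.constr_basis _ _ _ _)
    · exact hψe
  obtain ⟨h, ⟨hh, hhx⟩, -⟩ := Env.existsUnique_lift (X := KacMoody.gens form X₁) (N := N) ψ hψ
    (fun x y => by
      rw [hψx, hψx]
      exact (isHom_mkQ k _).map_local (FreeAssoc.of_local N x y))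
  refine ⟨G' ∘ₗ h, hG'.comp hh, fun y => ?_, ?_⟩
  · have := hhx (gy y)
    refine (congrArg G' this).trans ?_
    rw [hψx, hG'π, hGo, hf₀y]
  · have := hhx ge
    refine (congrArg G' this).trans ?_
    rw [hψx, hG'π, hGo, hf₀e]

end EnvModel

end ConformalAlg

namespace ConformalAlg

/-! ### Monomials in the free algebra on the modes -/

section FreeModes

variable {k : Type*} [Field k]

/-- The map of distributions induced by a homomorphism of algebras. -/
def Dist.map {A B : Type*} [Ring A] [Algebra k A] [Ring B] [Algebra k B] (φ : A →ₐ[k] B) :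
    Dist A →ₗ[k] Dist B where
  toFun a n := φ (a n)
  map_add' a b := funext fun n => map_add φ (a n) (b n)
  map_smul' c a := funext fun n => map_smul φ c (a n)

theorem Dist.map_apply {A B : Type*} [Ring A] [Algebra k A] [Ring B] [Algebra k B]
    (φ : A →ₐ[k] B) (a : Dist A) (n : ℤ) : Dist.map φ a n = φ (a n) := rfl

theorem Dist.isHom_map {A B : Type*} [Ring A] [Algebra k A] [Ring B] [Algebra k B]
    (φ : A →ₐ[k] B) : IsHom (Dist.map φ) where
  map_del a := Dist.ext fun m => by
    rw [map_apply, del_apply, del_apply, map_smul, map_apply]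
  map_nprod n a b := Dist.ext fun m => by
    simp only [map_apply, nprod_apply, map_sum, map_smul, map_mul]

variable (k) in
/-- The distribution of the free modes of a letter. -/
def freeDist {Y : Type*} (y : Y) : Dist (FreeAlgebra k (Y × ℤ)) := fun n => FreeAlgebra.ι k (y, n)

/-- Distributions with values in the words of length `d`. -/
def IsHomogDist {Y : Type*} (d : ℕ) (a : Dist (FreeAlgebra k (Y × ℤ))) : Prop :=
  ∀ n, a n ∈ homog k (Y × ℤ) d

theorem isHomogDist_freeDist {Y : Type*} (y : Y) : IsHomogDist 1 (freeDist k y) := fun n => by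
  have h := wd_mem_homog (k := k) [(y, n)]
  rwa [wd_cons, wd_nil, mul_one] at h

theorem IsHomogDist.nprod {Y : Type*} {d d' : ℕ} {a b : Dist (FreeAlgebra k (Y × ℤ))}
    (ha : IsHomogDist d a) (hb : IsHomogDist d' b) (n : ℕ) :
    IsHomogDist (d + d') (nprod k n a b) := fun m => by
  rw [Dist.nprod_apply]
  exact Submodule.sum_mem _ fun s _ => Submodule.smul_mem _ _ (mul_mem_homog (ha _) (hb _))

theorem IsHomogDist.del_pow {Y : Type*} {d : ℕ} {a : Dist (FreeAlgebra k (Y × ℤ))}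
    (ha : IsHomogDist d a) (s : ℕ) :
    IsHomogDist d (((del k : Module.End k (Dist (FreeAlgebra k (Y × ℤ)))) ^ s) a) := by
  induction s with
  | zero => exact ha
  | succ s ih =>
    intro m
    rw [pow_succ', Module.End.mul_apply, Dist.del_apply]
    exact Submodule.smul_mem _ _ (ih _)

theorem IsHomogDist.opL {Y : Type*} {d : ℕ} {a : Dist (FreeAlgebra k (Y × ℤ))}
    (ha : IsHomogDist d a) (n : ℕ) (xs : List Y) :
    IsHomogDist (xs.length + d) (opL k (freeDist k) n xs a) := by
  induction xs with
  | nil =>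
    rw [List.length_nil, zero_add]
    exact ha
  | cons x xs ih =>
    have e : (x :: xs).length + d = 1 + (xs.length + d) := by
      rw [List.length_cons]
      ring
    rw [e]
    exact (isHomogDist_freeDist x).nprod ih n

/-- The number of letters of a monomial. -/
def Monomial.size {Y : Type*} [LinearOrder Y] (w : Monomial Y) : ℕ :=
  w.leftLetters.length + w.rightLetters.length

theorem isHomogDist_eval {Y : Type*} [LinearOrder Y] (w : Monomial Y) :
    IsHomogDist w.size (w.eval k (freeDist k)) := by
  have hg := isHomogDist_freeDist (k := k) (Y := Y)
  cases w with
  | fam₁ xs ys z u hx hy =>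
    have h := (((hg z).nprod (hg u) 2).opL 1 ys).opL 0 xs
    have e : (.fam₁ xs ys z u hx hy : Monomial Y).size =
        xs.length + (ys.length + (1 + 1)) := by
      simp [Monomial.size, Monomial.leftLetters, Monomial.rightLetters]
    rw [e]
    exact h
  | fam₂ xs ys s z hx hy hs =>
    have h := (((hg z).del_pow s).opL 1 ys).opL 0 xs
    have e : (.fam₂ xs ys s z hx hy hs : Monomial Y).size =
        xs.length + (ys.length + 1) := by
      simp [Monomial.size, Monomial.leftLetters, Monomial.rightLetters]
    rw [e]
    exact h
  | fam₃ xs ys z hx hy hm =>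
    have h := ((hg z).opL 1 ys).opL 0 xs
    have e : (.fam₃ xs ys z hx hy hm : Monomial Y).size =
        xs.length + (ys.length + 1) := by
      simp [Monomial.size, Monomial.leftLetters, Monomial.rightLetters]
    rw [e]
    exact h
  | fam₄ xs y z hx hy => exact ((hg y).nprod (hg z) 1).opL 0 xs

/-- The homomorphism to the commutative model. -/
noncomputable def modesToBiPoly (k : Type*) [Field k] (Y : Type*) :
    FreeAlgebra k (Y × ℤ) →ₐ[k] BiPoly k Y :=
  FreeAlgebra.lift k fun a => biDist k a.1 a.2

theorem map_freeDist_biDist {Y : Type*} (y : Y) :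
    Dist.map (modesToBiPoly k Y) (freeDist k y) = biDist k y :=
  Dist.ext fun n => by
    rw [Dist.map_apply, freeDist, modesToBiPoly, FreeAlgebra.lift_ι_apply]

end FreeModes

/-! ### Initial compatible functionals -/

section Initial

variable {k : Type*} [Field k] {g : Type*} [LieRing g] [LieAlgebra k g] {Y : Type*}
  (form : LinearMap.BilinForm k g) (X₁ : Module.Basis Y k g)

open Polynomial in
/-- The image of a moving word in the commutative model is polynomial in the time. -/
theorem exists_poly_modesToBiPoly (w : List (Y × ℤ × ℤ)) : ∃ p : (BiPoly k Y)[X],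
    p.natDegree ≤ (w.map fun a => a.2.2.natAbs).sum ∧
      ∀ t : ℤ, modesToBiPoly k Y (wd k (w.map (atTime t))) = p.eval (t : BiPoly k Y) := by
  induction w with
  | nil => exact ⟨1, by simp, fun t => by simp [wd]⟩
  | cons a w ih =>
    obtain ⟨p, hp, hpt⟩ := ih
    obtain ⟨y, m, σ⟩ := a
    refine ⟨(C (biDist k y m) - C ((σ : k) • biMono k 0 {y}) * X) * p, ?_, fun t => ?_⟩
    · refine natDegree_mul_le.trans ?_
      rw [List.map_cons, List.sum_cons]
      refine add_le_add ?_ hp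
      -- A resting letter contributes a constant, a moving one a polynomial of degree at most one in
      -- the time.
      rcases eq_or_ne σ 0 with rfl | hσ
      · simp
      · have h1 : 1 ≤ σ.natAbs := Nat.one_le_iff_ne_zero.2 (Int.natAbs_ne_zero.2 hσ)
        refine le_trans ?_ h1
        compute_degree
    · rw [List.map_cons, wd_cons, map_mul, hpt, eval_mul]
      congr 1
      rw [modesToBiPoly, FreeAlgebra.lift_ι_apply]
      simp only [atTime, biDist_apply, eval_sub, eval_mul, eval_C, eval_X, Algebra.smul_def]
      push_cast
      simp only [map_intCast]
      ring

/-- Functionals of level `0` supported on the words of length `d` that factor through the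
commutative model. -/
theorem exists_compat_level_zero (d : ℕ) (h : BiPoly k Y →ₗ[k] k) :
    ∃ F : FreeAlgebra k (Y × ℤ) →ₗ[k] k, Compat form X₁ 0 d F ∧
      (∀ P ∈ homog k (Y × ℤ) d, F P = h (modesToBiPoly k Y P)) ∧
      ∀ i ≠ d, ∀ P ∈ homog k (Y × ℤ) i, F P = 0 := by
  let F : FreeAlgebra k (Y × ℤ) →ₗ[k] k :=
    wordFun fun w => if w.length = d then h (modesToBiPoly k Y (wd k w)) else 0
  have hd : ∀ P ∈ homog k (Y × ℤ) d, F P = h (modesToBiPoly k Y P) := by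
    intro P hP
    induction hP using homog_induction with
    | hw w hl => rw [wordFun_wd, if_pos hl]
    | hzero => simp
    | hadd P Q _ _ h1 h2 => simp only [map_add, h1, h2]
    | hsmul c P _ h1 => simp only [map_smul, h1]
  have hi : ∀ i ≠ d, ∀ P ∈ homog k (Y × ℤ) i, F P = 0 := by
    intro i hi P hP
    induction hP using homog_induction with
    | hw w hl => rw [wordFun_wd, if_neg (by omega)]
    | hzero => simp
    | hadd P Q _ _ h1 h2 => rw [map_add, h1, h2, add_zero]
    | hsmul c P _ h1 => rw [map_smul, h1, smul_zero]
  refine ⟨F, ⟨fun i j hij P hP Q hQ m n p q => ?_, fun w hw hb => ?_⟩, hd, hi⟩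
  · have hpq := mul_mem_homog (modeOf_mem X₁ m p) (modeOf_mem X₁ n q)
    have hqp := mul_mem_homog (modeOf_mem X₁ n q) (modeOf_mem X₁ m p)
    have h1 : P * (modeOf X₁ m p * modeOf X₁ n q - modeOf X₁ n q * modeOf X₁ m p) * Q ∈
        homog k (Y × ℤ) (i + (1 + 1) + j) := mul_mem_homog (mul_mem_homog hP (sub_mem hpq hqp)) hQ
    have h2 : P * modeOf X₁ (m + n) ⁅p, q⁆ * Q ∈ homog k (Y × ℤ) (i + 1 + j) :=
      mul_mem_homog (mul_mem_homog hP (modeOf_mem X₁ _ _)) hQ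
    -- The bracket term is shorter than d, hence killed; in length d the two products agree in the
    -- commutative model.
    rw [defect_apply, mul_sub, sub_mul, map_sub, hi _ (by omega) _ h2]
    have h3 : F (P * (modeOf X₁ m p * modeOf X₁ n q - modeOf X₁ n q * modeOf X₁ m p) * Q) = 0 := by
      by_cases hid : i + (1 + 1) + j = d
      · rw [hd _ (hid ▸ h1)]
        simp only [map_mul, map_sub]
        rw [mul_comm (modesToBiPoly k Y (modeOf X₁ m p)), sub_self, mul_zero, zero_mul, map_zero]
      · exact hi _ hid _ h1
    rw [h3]
    ring
  · by_cases hl : w.length = d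
    · obtain ⟨p, hp, hpt⟩ := exists_poly_modesToBiPoly (k := k) w
      have hp2 : p.natDegree < 3 := by
        have := hb.2
        omega
      refine ⟨h (p.coeff 0), h (p.coeff 1), h (p.coeff 2), fun t => ?_⟩
      simp only
      rw [wordFun_wd, if_pos (by simpa using hl), hpt, Polynomial.eval_eq_sum_range' hp2]
      have e : ∀ (r : BiPoly k Y) (j : ℕ), r * (t : BiPoly k Y) ^ j = ((t : k) ^ j) • r := by
        intro r j
        rw [Algebra.smul_def, map_pow, map_intCast, mul_comm]
      simp only [e, Finset.sum_range_succ, Finset.sum_range_zero, map_add, map_smul, map_zero,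
        smul_eq_mul]
      ring
    · refine mem_quad_congr (zero_mem (quad k)) fun t => ?_
      rw [wordFun_wd, if_neg (by simpa using hl)]
      rfl

/-- The initial functional of level `1`. -/
theorem exists_compat_level_one [CharZero k] (hsymm : form.IsSymm) :
    ∃ F : FreeAlgebra k (Y × ℤ) →ₗ[k] k, Compat form X₁ 1 2 F := by
  -- The cocycle is antisymmetric, so half of it on two-letter words gives the whole cocycle on
  -- commutators.
  let c : List (Y × ℤ) → k := fun w => match w with
    | [a, b] => cocyc form a.2 (X₁ a.1) b.2 (X₁ b.1) / 2
    | _ => 0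
  refine ⟨wordFun c, fun i j hij P hP Q hQ m n p q => ?_, fun w hw hb => ?_⟩
  · refine comm_of_words (fun u v hu hv m n x y => ?_) hP hQ m n p q
    obtain rfl : u = [] := List.length_eq_zero_iff.1 (by omega)
    obtain rfl : v = [] := List.length_eq_zero_iff.1 (by omega)
    have h1 : ∀ P ∈ homog k (Y × ℤ) 1, wordFun c P = 0 := by
      intro P hP
      induction hP using homog_induction with
      | hw w hl =>
        obtain ⟨a, rfl⟩ := List.length_eq_one_iff.1 hl
        rw [wordFun_wd]
      | hzero => simp
      | hadd P Q _ _ h1 h2 => rw [map_add, h1, h2, add_zero]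
      | hsmul c P _ h1 => rw [map_smul, h1, smul_zero]
    have h2 : ∀ a b : Y × ℤ, wordFun c (FreeAlgebra.ι k a * FreeAlgebra.ι k b) =
        cocyc form a.2 (X₁ a.1) b.2 (X₁ b.1) / 2 := fun a b => by
      have := wordFun_wd (k := k) c [a, b]
      rw [wd_cons, wd_cons, wd_nil, mul_one] at this
      exact this
    rw [wd_nil, one_mul, mul_one, defect_apply, map_sub, map_sub, h1 _ (modeOf_mem X₁ _ _), modeOf_basis, modeOf_basis,
      h2, h2, map_one]
    simp only [cocyc, add_comm n m]
    have hs : form (X₁ x) (X₁ y) = form (X₁ y) (X₁ x) := hsymm.eq _ _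
    split_ifs with h0
    · have h3 : (n : k) = -m := by
        rw [eq_neg_iff_add_eq_zero, ← Int.cast_add, add_comm, h0, Int.cast_zero]
      rw [h3, ← hs]
      ring
    · ring
  · match w, hw, hb with
    | [], _, _ => exact mem_quad_congr (const_mem_quad 0) fun t => wordFun_wd c []
    | [a], _, _ =>
      refine mem_quad_congr (zero_mem (quad k)) fun t => ?_
      exact wordFun_wd c _
    | [a, b], _, hb =>
      -- Balance makes the total mode constant, so the cocycle is linear in the time.
      have hσ : a.2.2 + b.2.2 = 0 := by simpa using hb.1
      have e : ∀ t, a.2.1 + a.2.2 * t + (b.2.1 + b.2.2 * t) = a.2.1 + b.2.1 := fun t => by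
        linear_combination t * hσ
      have key : ∀ t, wordFun c (wd k ([a, b].map (atTime t))) =
          (if a.2.1 + b.2.1 = 0 then ((a.2.1 : k) + a.2.2 * t) * form (X₁ a.1) (X₁ b.1) else 0) / 2 := by
        intro t
        refine (wordFun_wd c _).trans ?_
        change cocyc form (a.2.1 + a.2.2 * t) (X₁ a.1) (b.2.1 + b.2.2 * t) (X₁ b.1) / 2 = _
        rw [cocyc, e]
        push_cast
        rfl
      split_ifs at key
      · exact ⟨(a.2.1 : k) * form (X₁ a.1) (X₁ b.1) / 2, (a.2.2 : k) * form (X₁ a.1) (X₁ b.1) / 2, 0,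
          fun t => (key t).trans (by ring)⟩
      · exact ⟨0, 0, 0, fun t => (key t).trans (by ring)⟩

/-- The action of the free algebra on the modes by right multiplication. -/
noncomputable def modesToEnd :
    FreeAlgebra k (Y × ℤ) →ₐ[k] Module.End k (FunctionalSpace form X₁) :=
  FreeAlgebra.lift k fun a => opMode form X₁ a.2 (X₁ a.1)

theorem modesToEnd_fst (a : FreeAlgebra k (Y × ℤ)) : ∀ (F : FunctionalSpace form X₁)
    (P : FreeAlgebra k (Y × ℤ)), (modesToEnd form X₁ a F).1.1 P = F.1.1 (P * a) := by
  induction a using FreeAlgebra.induction with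
  | grade0 r =>
    intro F P
    rw [AlgHom.commutes, ← Algebra.commutes, ← Algebra.smul_def, map_smul]
    rfl
  | grade1 a =>
    intro F P
    rw [modesToEnd, FreeAlgebra.lift_ι_apply, opMode_fst, modeOf_basis]
  | mul a b ha hb =>
    intro F P
    rw [map_mul, Module.End.mul_apply, ha, hb, mul_assoc]
  | add a b ha hb =>
    intro F P
    rw [map_add, mul_add, map_add, ← ha, ← hb]
    rfl

theorem map_freeDist_opDist (y : Y) :
    Dist.map (modesToEnd form X₁) (freeDist k y) = opDist form X₁ (X₁ y) :=
  Dist.ext fun n => by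
    rw [Dist.map_apply, freeDist, modesToEnd, FreeAlgebra.lift_ι_apply, opDist_apply]

/-- The monomials and `e` are linearly independent in the universal envelope. -/
theorem linearIndependent_env [CharZero k] [LinearOrder Y] (hsymm : form.IsSymm)
    (hinv : ∀ a b c, form ⁅a, b⁆ c = form a ⁅b, c⁆) :
    LinearIndependent k fun o : Option (Monomial Y) => o.elim (KacMoody.Env₃.e form X₁)
      fun w => w.eval k (KacMoody.Env₃.of form X₁) := by
  obtain ⟨f, hf, hfy, hfe⟩ := exists_env_hom form X₁
  rw [linearIndependent_iff']
  intro s l hl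
  classical
  let T : Finset (Monomial Y) := s.eraseNone
  let l₀ : k := if none ∈ s then l none else 0
  have hsum : ∀ v : Option (Monomial Y) → Dist (Module.End k (FunctionalSpace form X₁)),
      ∑ o ∈ s, l o • v o = l₀ • v none + ∑ w ∈ T, l (some w) • v (some w) := by
    intro v
    by_cases hn : none ∈ s
    · have e : s = Finset.insertNone T := by
        ext o
        cases o <;> simp [T, hn]
      rw [e, Finset.sum_insertNone]
      simp only [l₀, if_pos hn]
    · have e : s = T.map Function.Embedding.some := by
        ext o
        cases o <;> simp [T, hn]
      simp only [l₀, if_neg hn, zero_smul, zero_add]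
      rw [e, Finset.sum_map]
      simp
  have hw : ∀ w : Monomial Y, f (w.eval k (KacMoody.Env₃.of form X₁)) =
      Dist.map (modesToEnd form X₁) (w.eval k (freeDist k)) := by
    intro w
    rw [hf.map_eval, (Dist.isHom_map _).map_eval]
    simp only [hfy, map_freeDist_opDist]
  -- The relation is applied to `F` at mode n and the result is evaluated at the empty word. A
  -- monomial gives the value of `F` on its mode in the free algebra, and e gives the level in mode
  -- -1.
  have main : ∀ (n : ℤ) (F : FunctionalSpace form X₁),
      l₀ * (if n = -1 then F.1.2 else 0) +
        ∑ w ∈ T, l (some w) * F.1.1 (w.eval k (freeDist k) n) = 0 := by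
    intro n F
    have h := congrArg f hl
    rw [map_zero, map_sum] at h
    simp only [map_smul] at h
    rw [hsum fun o => f (o.elim (KacMoody.Env₃.e form X₁)
      fun w => w.eval k (KacMoody.Env₃.of form X₁))] at h
    simp only [Option.elim_none, Option.elim_some, hfe, hw] at h
    have h1 := congrFun h n
    rw [Dist.add_apply, Dist.sum_apply, Dist.smul_apply, centralDist_apply] at h1
    simp only [Dist.smul_apply, Dist.map_apply] at h1
    let ev : Module.End k (FunctionalSpace form X₁) →ₗ[k] k :=
      { toFun := fun φ => (φ F).1.1 1
        map_add' := fun φ ψ => rfl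
        map_smul' := fun c φ => rfl }
    have h2 := congrArg ev h1
    rw [map_add, map_sum, map_smul] at h2
    have h3 : ev (if n = -1 then opCentral form X₁ else 0) = if n = -1 then F.1.2 else 0 := by
      split_ifs
      · change F.1.2 * aug k (1 : FreeAlgebra k (Y × ℤ)) = _
        rw [map_one, mul_one]
      · rfl
    have h4 : ∀ a, ev (modesToEnd form X₁ a) = F.1.1 a := fun a => by
      change (modesToEnd form X₁ a F).1.1 1 = _
      rw [modesToEnd_fst, one_mul]
    simp only [map_smul, h3, h4, smul_eq_mul] at h2
    exact h2
  have hT : ∀ w ∈ T, l (some w) = 0 := by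
    by_contra hne
    push Not at hne
    obtain ⟨w₁, hw₁, hlw₁⟩ := hne
    let T' := T.filter fun w => l (some w) ≠ 0
    obtain ⟨w₀, hw₀, hmax⟩ := T'.exists_max_image Monomial.size
      ⟨w₁, Finset.mem_filter.2 ⟨hw₁, hlw₁⟩⟩
    -- An extension of a level 0 functional supported in the maximal size kills the shorter
    -- monomials and evaluates those of maximal size through the commutative model.
    have h0 : ∑ w ∈ T'.filter (fun w => w.size = w₀.size), l (some w) • w.eval k (biDist k) = 0 := by
      refine Dist.ext fun n => ?_
      rw [Dist.zero_apply, Dist.sum_apply, ← Module.forall_dual_apply_eq_zero_iff k]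
      intro h
      obtain ⟨F, hF, hFd, hFi⟩ := exists_compat_level_zero form X₁ w₀.size h
      obtain ⟨F', hF', hFF'⟩ := hF.exists_extension hsymm hinv (Or.inl rfl)
      have hm := main n ⟨(F', 0), hF'⟩
      simp only [ite_self, mul_zero, zero_add] at hm
      rw [map_sum, Finset.sum_filter, Finset.sum_filter]
      refine Eq.trans (Finset.sum_congr rfl fun w hwT => ?_) hm
      by_cases hlw : l (some w) = 0
      · rw [if_neg (by simpa using hlw), hlw, zero_mul]
      · rw [if_pos hlw]
        have hle : w.size ≤ w₀.size := hmax w (Finset.mem_filter.2 ⟨hwT, hlw⟩)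
        rw [hFF' _ hle _ (isHomogDist_eval w n)]
        split_ifs with hs
        · rw [hFd _ (hs ▸ isHomogDist_eval w n), Dist.smul_apply, map_smul, smul_eq_mul,
            ← Dist.map_apply, (Dist.isHom_map _).map_eval]
          simp only [map_freeDist_biDist]
        · rw [hFi _ hs _ (isHomogDist_eval w n), mul_zero]
    have h1 := linearIndependent_iff'.1 (linearIndependent_eval_biDist k Y) _ (fun w => l (some w)) h0
      w₀ (Finset.mem_filter.2 ⟨hw₀, rfl⟩)
    exact (Finset.mem_filter.1 hw₀).2 h1
  intro o ho
  match o with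
  | some w => exact hT w (Finset.mem_eraseNone.2 ho)
  | none =>
    -- The monomials no longer contribute, so mode -1 of a functional of level 1 isolates the
    -- coefficient of e.
    obtain ⟨F, hF⟩ := exists_compat_level_one form X₁ hsymm
    obtain ⟨F', hF', -⟩ := hF.exists_extension hsymm hinv (Or.inr le_rfl)
    have hm := main (-1) ⟨(F', 1), hF'⟩
    rw [Finset.sum_eq_zero fun w hw => by rw [hT w hw, zero_mul]] at hm
    simpa [l₀, ho] using hm

end Initial

end ConformalAlg

namespace ConformalAlg

/-! ### Commutators of left multiplications -/

section Commutator

variable {k : Type*} [Field k] {C : Type*} [AddCommGroup C] [Module k C]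

variable (k) in
/-- The linear map with prescribed values on the monomials in two variables. -/
noncomputable def bilinExt (f : ℕ → ℕ → C) : MvPolynomial (Fin 2) k →ₗ[k] C :=
  (MvPolynomial.basisMonomials (Fin 2) k).constr k fun d => f (d 0) (d 1)

theorem bilinExt_monomial (f : ℕ → ℕ → C) (i j : ℕ) :
    bilinExt k f (MvPolynomial.X 0 ^ i * MvPolynomial.X 1 ^ j) = f i j := by
  have h : (MvPolynomial.X 0 ^ i * MvPolynomial.X 1 ^ j : MvPolynomial (Fin 2) k) =
      MvPolynomial.basisMonomials (Fin 2) k (Finsupp.single 0 i + Finsupp.single 1 j) := by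
    simp [MvPolynomial.X_pow_eq_monomial, MvPolynomial.monomial_mul]
  rw [h, bilinExt, Module.Basis.constr_basis]
  simp

variable [Ops k C]

theorem nprod_del_pow [IsConformal k C] (u c : C) (j : ℕ) : ∀ N : ℕ,
    nprod k N (((del k : Module.End k C) ^ j) u) c =
      ((-1 : k) ^ j * (N.descFactorial j : k)) • nprod k (N - j) u c := by
  induction j generalizing u with
  | zero => intro N; simp
  | succ j ih =>
    intro N
    rw [pow_succ, Module.End.mul_apply, ih, IsConformal.del_left, Nat.descFactorial_succ,
      ← neg_smul, smul_smul, Nat.sub_sub]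
    congr 1
    push_cast
    ring

variable [IsAssoc k C]

/-- With x₀^i x₁^j standing for L_i^a L_j^b c, associativity is the binomial expansion of (x₀ -
x₁)^s. -/
theorem nprod_nprod_eq (a b c : C) (s N : ℕ) : nprod k N (nprod k s a b) c =
    bilinExt k (fun i j => nprod k i a (nprod k j b c))
      ((MvPolynomial.X 0 - MvPolynomial.X 1) ^ s * MvPolynomial.X 1 ^ N) := by
  rw [Dist.sub_pow_eq k, Finset.sum_mul, map_sum, IsAssoc.assoc]
  refine Finset.sum_congr rfl fun t _ => ?_
  rw [smul_mul_assoc, map_smul, mul_assoc, ← pow_add, bilinExt_monomial, add_comm]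

theorem nprod_nprod_eq' (a b c : C) (s N : ℕ) : nprod k N (nprod k s b a) c =
    bilinExt k (fun i j => nprod k j b (nprod k i a c))
      ((MvPolynomial.X 1 - MvPolynomial.X 0) ^ s * MvPolynomial.X 0 ^ N) := by
  rw [Dist.sub_pow_eq k, Finset.sum_mul, map_sum, IsAssoc.assoc]
  refine Finset.sum_congr rfl fun t _ => ?_
  have e : (MvPolynomial.X 1 ^ (s - t) * MvPolynomial.X 0 ^ t * MvPolynomial.X 0 ^ N :
      MvPolynomial (Fin 2) k) = MvPolynomial.X 0 ^ (N + t) * MvPolynomial.X 1 ^ (s - t) := by ring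
  rw [smul_mul_assoc, map_smul, e, bilinExt_monomial]

variable [IsConformal k C]

/-- The polynomial is the same as for the product of a and b, with the operators composed in the
other order. Writing x₁ = (x₁ - x₀) + x₀ reproduces the sum defining the reversed product, so a
commutator acts through the difference of the two linear maps. -/
theorem nprod_rev_eq [CharZero k] (a b c : C) (s N : ℕ) : nprod k N (rev k s b a) c =
    bilinExt k (fun i j => nprod k j b (nprod k i a c))
      ((MvPolynomial.X 0 - MvPolynomial.X 1) ^ s * MvPolynomial.X 1 ^ N) := by
  obtain ⟨M, hM⟩ := IsConformal.exists_local (k := k) b a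
  rw [rev_eq_sum (hM.mono (le_max_left M (N + 1))), nprod, map_sum, LinearMap.sum_apply]
  symm
  rw [← Finset.sum_subset (Finset.range_mono (le_max_right M (N + 1)))]
  · have e : (MvPolynomial.X 0 - MvPolynomial.X 1) ^ s * MvPolynomial.X 1 ^ N =
        ∑ j ∈ Finset.range (N + 1), ((-1 : k) ^ s * (N.choose j : k)) •
          ((MvPolynomial.X 1 - MvPolynomial.X 0) ^ (s + j) * MvPolynomial.X 0 ^ (N - j) :
            MvPolynomial (Fin 2) k) := by
      have e1 : (MvPolynomial.X 1 : MvPolynomial (Fin 2) k) ^ N =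
        ((MvPolynomial.X 1 - MvPolynomial.X 0) + MvPolynomial.X 0) ^ N := by ring
      have e2 : (MvPolynomial.X 0 - MvPolynomial.X 1 : MvPolynomial (Fin 2) k) ^ s =
        (-1) ^ s * (MvPolynomial.X 1 - MvPolynomial.X 0) ^ s := by
        rw [← mul_pow]
        ring
      rw [e1, e2, add_pow, Finset.mul_sum]
      refine Finset.sum_congr rfl fun j _ => ?_
      rw [Algebra.smul_def, map_mul, map_pow, map_neg, map_one, map_natCast]
      ring
    rw [e, map_sum]
    refine Finset.sum_congr rfl fun j _ => ?_
    rw [map_smul, ← nprod_nprod_eq', map_smul, LinearMap.smul_apply, ← nprod, nprod_del_pow,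
      smul_smul, Nat.descFactorial_eq_factorial_mul_choose]
    congr 1
    have h1 : (j.factorial : k) ≠ 0 := Nat.cast_ne_zero.2 j.factorial_ne_zero
    have h2 : ((-1 : k) ^ j) * (-1) ^ j = 1 := by rw [← mul_pow]; simp
    push_cast
    rw [pow_add]
    field_simp
    linear_combination -(N.choose j : k) * h2
  · intro j _ hj
    have hj' : N < j := by simpa using hj
    rw [map_smul, LinearMap.smul_apply, ← nprod, nprod_del_pow,
      Nat.descFactorial_eq_zero_iff_lt.2 hj']
    simp

/-- The commutator formula for left multiplications in an associative conformal algebra. -/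
theorem nprod_commutator [CharZero k] (a b c : C) (n m : ℕ) :
    nprod k n a (nprod k m b c) - nprod k m b (nprod k n a c) =
      ∑ s ∈ Finset.range (n + 1), (n.choose s : k) • nprod k (n + m - s) (comm k s a b) c := by
  have h1 : ∀ s N, nprod k N (comm k s a b) c =
      (bilinExt k (fun i j => nprod k i a (nprod k j b c)) -
        bilinExt k (fun i j => nprod k j b (nprod k i a c)))
        ((MvPolynomial.X 0 - MvPolynomial.X 1) ^ s * MvPolynomial.X 1 ^ N) := fun s N => by
    rw [LinearMap.sub_apply, ← nprod_nprod_eq, ← nprod_rev_eq, comm, nprod, map_sub,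
      LinearMap.sub_apply]
  have h2 : nprod k n a (nprod k m b c) - nprod k m b (nprod k n a c) =
      (bilinExt k (fun i j => nprod k i a (nprod k j b c)) -
        bilinExt k (fun i j => nprod k j b (nprod k i a c)))
        (MvPolynomial.X 0 ^ n * MvPolynomial.X 1 ^ m) := by
    rw [LinearMap.sub_apply, bilinExt_monomial, bilinExt_monomial]
  have h3 : (MvPolynomial.X 0 ^ n * MvPolynomial.X 1 ^ m : MvPolynomial (Fin 2) k) =
      ∑ s ∈ Finset.range (n + 1), (n.choose s : k) •
        ((MvPolynomial.X 0 - MvPolynomial.X 1) ^ s * MvPolynomial.X 1 ^ (n + m - s)) := by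
    have e1 : (MvPolynomial.X 0 : MvPolynomial (Fin 2) k) ^ n =
      ((MvPolynomial.X 0 - MvPolynomial.X 1) + MvPolynomial.X 1) ^ n := by ring
    rw [e1, add_pow, Finset.sum_mul]
    refine Finset.sum_congr rfl fun s hs => ?_
    have hs' : s ≤ n := by have := Finset.mem_range.1 hs; omega
    rw [Algebra.smul_def, map_natCast, show n + m - s = (n - s) + m by omega, pow_add]
    ring
  rw [h2, h3, map_sum]
  refine Finset.sum_congr rfl fun s _ => ?_
  rw [map_smul, ← h1]

end Commutator

end ConformalAlg

namespace ConformalAlg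

/-! ### Relations between words in a filtered associative conformal algebra -/

section Spanning

variable (k : Type*) [Field k] {C : Type*} [AddCommGroup C] [Module k C] [Ops k C] {Y : Type*}

/-- The operator `L_n^x`. -/
abbrev Lop (ι : Y → C) (n : ℕ) (x : Y) : C →ₗ[k] C := Ops.prod n (ι x)

/-- A family of elements that is pairwise local of order three and whose commutators are those of
a family of currents with central element `e`. -/
structure IsCurrent (ι : Y → C) (e : C) : Prop where
  del_e : del k e = 0
  local_three : ∀ x y, LocalAt k 3 (ι x) (ι y)
  comm_zero : ∀ x y, comm k 0 (ι x) (ι y) ∈ Submodule.span k (Set.range ι)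
  comm_one : ∀ x y, comm k 1 (ι x) (ι y) ∈ Submodule.span k {e}
  comm_two : ∀ x y, comm k 2 (ι x) (ι y) = 0

/-- The span of `e` and of all words of length at most `d`. -/
def filt (ι : Y → C) (e : C) : ℕ → Submodule k C
  | 0 => Submodule.span k {e}
  | d + 1 => filt ι e d ⊔
      Submodule.span k (Set.range fun p : ℕ × Y => ((del k : Module.End k C) ^ p.1) (ι p.2)) ⊔
      ⨆ n, ⨆ x, (filt ι e d).map (Lop k ι n x)

variable {k} {ι : Y → C} {e : C}

theorem filt_succ_le {d : ℕ} {S : Submodule k C} (h1 : filt k ι e d ≤ S)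
    (h2 : ∀ s x, ((del k : Module.End k C) ^ s) (ι x) ∈ S)
    (h3 : ∀ n x, ∀ v ∈ filt k ι e d, Lop k ι n x v ∈ S) : filt k ι e (d + 1) ≤ S := by
  refine sup_le (sup_le h1 (Submodule.span_le.2 ?_))
    (iSup_le fun n => iSup_le fun x => Submodule.map_le_iff_le_comap.2 fun v hv => h3 n x v hv)
  rintro _ ⟨p, rfl⟩
  exact h2 p.1 p.2

theorem filt_mono {d d' : ℕ} (h : d ≤ d') : filt k ι e d ≤ filt k ι e d' :=
  monotone_nat_of_le_succ (fun _ => le_sup_left.trans le_sup_left) h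

theorem del_pow_mem_filt (d s : ℕ) (x : Y) :
    ((del k : Module.End k C) ^ s) (ι x) ∈ filt k ι e (d + 1) :=
  Submodule.mem_sup_left (Submodule.mem_sup_right (Submodule.subset_span ⟨(s, x), rfl⟩))

theorem gen_mem_filt (d : ℕ) (x : Y) : ι x ∈ filt k ι e (d + 1) := del_pow_mem_filt d 0 x

theorem Lop_mem_filt {d : ℕ} {v : C} (hv : v ∈ filt k ι e d) (n : ℕ) (x : Y) :
    Lop k ι n x v ∈ filt k ι e (d + 1) :=
  Submodule.mem_sup_right (Submodule.mem_iSup_of_mem n (Submodule.mem_iSup_of_mem x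
    (Submodule.mem_map_of_mem hv)))

theorem e_mem_filt (d : ℕ) : e ∈ filt k ι e d :=
  filt_mono (Nat.zero_le d) (Submodule.subset_span rfl)

variable [IsConformal k C]

theorem Lop_del (n : ℕ) (x : Y) (v : C) :
    Lop k ι n x (del k v) = del k (Lop k ι n x v) + (n : k) • Lop k ι (n - 1) x v :=
  IsConformal.del_right n (ι x) v

theorem del_Lop_zero (x : Y) (v : C) : del k (Lop k ι 0 x v) = Lop k ι 0 x (del k v) := by
  rw [Lop_del, Nat.cast_zero, zero_smul, add_zero]

theorem del_Lop_one (x : Y) (v : C) :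
    del k (Lop k ι 1 x v) = Lop k ι 1 x (del k v) - Lop k ι 0 x v := by
  rw [Lop_del, Nat.cast_one, one_smul, add_sub_cancel_right]

/-- The derivation moves inward past L_n^x at the cost of a word of the same length with L_{n-1}^x,
until it is absorbed by the innermost ∂^s x. -/
theorem IsCurrent.del_mem_filt (h : IsCurrent k ι e) {d : ℕ} {v : C} (hv : v ∈ filt k ι e d) :
    del k v ∈ filt k ι e d := by
  have key : ∀ d, filt k ι e d ≤ (filt k ι e d).comap (del k) := by
    intro d
    induction d with
    | zero =>
      refine Submodule.span_le.2 ?_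
      rintro c hc
      rw [Set.mem_singleton_iff.1 hc, SetLike.mem_coe, Submodule.mem_comap, h.del_e]
      exact zero_mem _
    | succ d ih =>
      refine filt_succ_le (ih.trans (Submodule.comap_mono (filt_mono d.le_succ))) (fun s x => ?_)
        fun n x v hv => ?_
      · rw [Submodule.mem_comap, ← Module.End.mul_apply, ← pow_succ']
        exact del_pow_mem_filt d _ x
      · have h1 := Lop_del (k := k) (ι := ι) n x v
        rw [← sub_eq_iff_eq_add] at h1
        rw [Submodule.mem_comap, ← h1]
        exact sub_mem (Lop_mem_filt (ih hv) n x)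
          (Submodule.smul_mem _ _ (Lop_mem_filt hv _ x))
  exact key d hv

variable [CharZero k]

theorem nprod_span_e (h : IsCurrent k ι e) {c : C} (hc : c ∈ Submodule.span k {e}) (n : ℕ) (v : C) :
    nprod k n c v = 0 := by
  obtain ⟨a, rfl⟩ := Submodule.mem_span_singleton.1 hc
  rw [nprod, map_smul, LinearMap.smul_apply, ← nprod, nprod_left_of_del_eq_zero h.del_e, smul_zero]

theorem Lop_span_e (h : IsCurrent k ι e) {c : C} (hc : c ∈ Submodule.span k {e}) (n : ℕ) (x : Y) :
    Lop k ι n x c = 0 := by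
  obtain ⟨a, rfl⟩ := Submodule.mem_span_singleton.1 hc
  rw [map_smul]
  exact (congrArg (a • ·) (nprod_right_of_del_eq_zero h.del_e n (ι x))).trans (smul_zero a)

omit [IsConformal k C] [CharZero k] in
theorem IsCurrent.comm_eq_zero (h : IsCurrent k ι e) {s : ℕ} (hs : 2 ≤ s) (x y : Y) :
    comm k s (ι x) (ι y) = 0 := by
  rcases hs.eq_or_lt with rfl | hs
  · exact h.comm_two x y
  · rw [comm, h.local_three x y s hs, rev_eq_sum (h.local_three y x), zero_sub, neg_eq_zero]
    exact Finset.sum_eq_zero fun j _ => by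
      rw [h.local_three y x _ (by omega), map_zero, smul_zero]

omit [IsConformal k C] in
/-- The relation `∂ L₂^z y ≡ L₁^y z + L₁^z y`. -/
theorem IsCurrent.rel_one (h : IsCurrent k ι e) (y z : Y) :
    Lop k ι 1 y (ι z) + Lop k ι 1 z (ι y) - del k (Lop k ι 2 z (ι y)) ∈ filt k ι e 1 := by
  have h1 := h.comm_one y z
  rw [comm, rev_eq_sum (h.local_three z y), Finset.sum_range_succ, Finset.sum_range_succ,
    Finset.sum_range_one, h.local_three z y (1 + 2) le_rfl] at h1
  refine filt_mono zero_le_one ?_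
  refine (congrArg (· ∈ Submodule.span k {e}) ?_).mp h1
  simp [Lop]
  abel

omit [IsConformal k C] in
/-- The relation expressing the commutator `[y ₍₀₎ z]`. -/
theorem IsCurrent.rel_zero (h : IsCurrent k ι e) (y z : Y) :
    Lop k ι 0 y (ι z) - Lop k ι 0 z (ι y) + del k (Lop k ι 1 z (ι y)) -
      (1 / 2 : k) • del k (del k (Lop k ι 2 z (ι y))) ∈ filt k ι e 1 := by
  have h1 := h.comm_zero y z
  rw [comm, rev_eq_sum (h.local_three z y), Finset.sum_range_succ, Finset.sum_range_succ,
    Finset.sum_range_one] at h1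
  have h2 : Submodule.span k (Set.range ι) ≤ filt k ι e 1 := by
    refine Submodule.span_le.2 ?_
    rintro _ ⟨x, rfl⟩
    exact gen_mem_filt 0 x
  refine (congrArg (· ∈ filt k ι e 1) ?_).mp (h2 h1)
  simp only [pow_zero, pow_one, pow_two, Module.End.mul_apply, Module.End.one_apply, zero_add,
    Nat.factorial, nprod, Lop, Nat.cast_one]
  norm_num
  module

omit [IsConformal k C] in
theorem IsCurrent.rel_two (h : IsCurrent k ι e) (y z : Y) :
    Lop k ι 2 y (ι z) = Lop k ι 2 z (ι y) := by
  have h1 := h.comm_two y z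
  rw [comm, rev_eq_sum (h.local_three z y), Finset.sum_range_succ, Finset.sum_range_succ,
    Finset.sum_range_one, h.local_three z y (2 + 1) (by omega),
    h.local_three z y (2 + 2) (by omega)] at h1
  have h2 : Lop k ι 2 y (ι z) - Lop k ι 2 z (ι y) = 0 := by
    rw [← h1]
    simp [Lop]
  exact sub_eq_zero.1 h2

/-- The relation `∂ (L₁^y z - L₁^z y) ≡ 2 (L₀^y z - L₀^z y)`. -/
theorem IsCurrent.rel_del (h : IsCurrent k ι e) (y z : Y) :
    del k (Lop k ι 1 y (ι z)) - del k (Lop k ι 1 z (ι y)) -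
      (2 : k) • (Lop k ι 0 y (ι z) - Lop k ι 0 z (ι y)) ∈ filt k ι e 1 := by
  have h1 := h.del_mem_filt (h.rel_one y z)
  have h2 := sub_mem h1 (Submodule.smul_mem _ (2 : k) (h.rel_zero y z))
  refine (congrArg (· ∈ filt k ι e 1) ?_).mp h2
  simp only [map_sub, map_add]
  module

/-- Obtained from `rel_del` by repeated differentiation. Moving ∂ inside L_1 releases one more L_0
term each time: the factor 2 becomes 3 for s = 0 and then grows by one. -/
theorem IsCurrent.rel_swap (h : IsCurrent k ι e) (s : ℕ) (y z : Y) :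
    Lop k ι 1 y (((del k : Module.End k C) ^ (s + 1)) (ι z)) -
      Lop k ι 1 z (((del k : Module.End k C) ^ (s + 1)) (ι y)) -
      ((s : k) + 3) • (Lop k ι 0 y (((del k : Module.End k C) ^ s) (ι z)) -
        Lop k ι 0 z (((del k : Module.End k C) ^ s) (ι y))) ∈ filt k ι e 1 := by
  induction s with
  | zero =>
    refine (congrArg (· ∈ filt k ι e 1) ?_).mp (h.rel_del y z)
    simp only [zero_add, pow_one, pow_zero, Module.End.one_apply, del_Lop_one, Nat.cast_zero]
    module
  | succ s ih =>
    refine (congrArg (· ∈ filt k ι e 1) ?_).mp (h.del_mem_filt ih)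
    simp only [map_sub, map_smul, del_Lop_one, del_Lop_zero]
    simp only [← Module.End.mul_apply, ← pow_succ']
    push_cast
    module

variable [IsAssoc k C]

/-- The commutators of the operators `L_n^x` do not increase the length by more than one. -/
theorem IsCurrent.commute (h : IsCurrent k ι e) (n m : ℕ) (x y : Y) {d : ℕ} {v : C}
    (hv : v ∈ filt k ι e d) :
    Lop k ι n x (Lop k ι m y v) - Lop k ι m y (Lop k ι n x v) ∈ filt k ι e (d + 1) := by
  have h1 := nprod_commutator (k := k) (ι x) (ι y) v n m
  refine (congrArg (· ∈ filt k ι e (d + 1)) h1).mpr (Submodule.sum_mem _ fun s _ =>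
    Submodule.smul_mem _ _ ?_)
  match s with
  | 0 =>
    have aux : Submodule.span k (Set.range ι) ≤
        (filt k ι e (d + 1)).comap ((Ops.prod (k := k) (n + m - 0)).flip v) := by
      refine Submodule.span_le.2 ?_
      rintro _ ⟨z, rfl⟩
      exact Lop_mem_filt hv _ z
    exact aux (h.comm_zero x y)
  | 1 => rw [nprod_span_e h (h.comm_one x y)]; exact zero_mem _
  | s + 2 => rw [h.comm_eq_zero (by omega), nprod, map_zero]; exact zero_mem _

-- The associativity expansion of the vanishing third product of the two letters, acting on v.
omit [IsConformal k C] [CharZero k] in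
theorem IsCurrent.locality (h : IsCurrent k ι e) (m : ℕ) (x y : Y) (v : C) :
    Lop k ι 3 x (Lop k ι m y v) - (3 : k) • Lop k ι 2 x (Lop k ι (m + 1) y v) +
      (3 : k) • Lop k ι 1 x (Lop k ι (m + 2) y v) - Lop k ι 0 x (Lop k ι (m + 3) y v) = 0 := by
  have h1 := IsAssoc.assoc (k := k) 3 m (ι x) (ι y) v
  rw [h.local_three x y 3 le_rfl, nprod, map_zero, LinearMap.zero_apply] at h1
  rw [h1]
  simp only [Finset.sum_range_succ, Finset.sum_range_zero, Lop, nprod]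
  norm_num
  module

/-- Modulo shorter words L_3^y L_0^z u vanishes, since L_3^y commutes with L_0^z and kills u.
`locality` then gives L_1^y L_2^z u ≡ L_2^y L_1^z u, and the latter commutes to L_1^z L_2^y u. -/
theorem IsCurrent.high_symm (h : IsCurrent k ι e) (y z u : Y) :
    Lop k ι 1 y (Lop k ι 2 z (ι u)) - Lop k ι 1 z (Lop k ι 2 y (ι u)) ∈ filt k ι e 2 := by
  have h1 := h.locality 0 y z (ι u)
  have hu : ι u ∈ filt k ι e 1 := gen_mem_filt 0 u
  have h2 := h.commute 3 0 y z hu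
  have h3 := h.commute 2 1 y z hu
  have e1 : Lop k ι 3 y (ι u) = 0 := h.local_three y u 3 le_rfl
  have e2 : Lop k ι 3 z (ι u) = 0 := h.local_three z u 3 le_rfl
  rw [e1, map_zero, sub_zero] at h2
  simp only [zero_add] at h1
  rw [e2, map_zero, sub_zero] at h1
  have h4 := sub_mem h3 (Submodule.smul_mem _ (1 / 3 : k) h2)
  refine (congrArg (· ∈ filt k ι e 2) ?_).mp h4
  have h5 : Lop k ι 3 y (Lop k ι 0 z (ι u)) = (3 : k) • Lop k ι 2 y (Lop k ι 1 z (ι u)) -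
      (3 : k) • Lop k ι 1 y (Lop k ι 2 z (ι u)) := by
    rw [← sub_eq_zero, ← h1]
    abel
  rw [h5]
  module

/-- For n ≥ 3 the operator commutes past L_2^z and kills u. For n = 2, `locality` gives 3 L_2^x
L_2^z u = L_3^x L_1^z u, and L_3^x commutes past L_1^z. -/
theorem IsCurrent.high_eq_zero (h : IsCurrent k ι e) {n : ℕ} (hn : 2 ≤ n) (x z u : Y) :
    Lop k ι n x (Lop k ι 2 z (ι u)) ∈ filt k ι e 2 := by
  have hu : ι u ∈ filt k ι e 1 := gen_mem_filt 0 u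
  have hl : ∀ {n : ℕ}, 3 ≤ n → ∀ x, Lop k ι n x (ι u) = 0 := fun hn x => h.local_three x u _ hn
  rcases hn.eq_or_lt with rfl | hn
  · have h1 := h.locality 1 x z (ι u)
    have h2 := h.commute 3 1 x z hu
    rw [hl le_rfl, map_zero, sub_zero] at h2
    rw [hl (show 3 ≤ 1 + 2 by omega), hl (show 3 ≤ 1 + 3 by omega), map_zero, map_zero, smul_zero,
      add_zero, sub_zero, sub_eq_zero] at h1
    rw [h1] at h2
    have h3 := Submodule.smul_mem _ (1 / 3 : k) h2
    rwa [smul_smul, one_div, inv_mul_cancel₀ (by norm_num), one_smul] at h3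
  · have h2 := h.commute n 2 x z hu
    rwa [hl hn, map_zero, sub_zero] at h2

/-- Apply L_2^w to `rel_del`. From L_2 ∂ = ∂ L_2 + 2 L_1 the wanted difference appears twice,
together with the derivative of L_2^w L_1^y z - L_2^w L_1^z y, which is negligible by commutation
and `high_symm`. -/
theorem IsCurrent.low_swap (h : IsCurrent k ι e) (w y z : Y) :
    Lop k ι 1 w (Lop k ι 1 y (ι z)) - Lop k ι 1 w (Lop k ι 1 z (ι y)) -
      (Lop k ι 0 y (Lop k ι 2 w (ι z)) - Lop k ι 0 z (Lop k ι 2 w (ι y))) ∈ filt k ι e 2 := by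
  have hy : ι y ∈ filt k ι e 1 := gen_mem_filt 0 y
  have hz : ι z ∈ filt k ι e 1 := gen_mem_filt 0 z
  have h1 := Lop_mem_filt (h.rel_del y z) 2 w
  have h2 := h.commute 2 1 w y hz
  have h3 := h.commute 2 1 w z hy
  have h4 := h.high_symm y z w
  rw [h.rel_two z w, h.rel_two y w] at h4
  have h5 := h.del_mem_filt (add_mem (sub_mem h2 h3) h4)
  have h6 := h.commute 2 0 w y hz
  have h7 := h.commute 2 0 w z hy
  have h8 := add_mem (Submodule.smul_mem _ (1 / 2 : k) (sub_mem h1 h5)) (sub_mem h6 h7)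
  refine (congrArg (· ∈ filt k ι e 2) ?_).mp h8
  simp only [map_sub, map_smul, map_add, Lop_del]
  push_cast
  module

/-- Apply L_1^x to `rel_del`. The derivative of L_1^x L_1^y z - L_1^x L_1^z y is given by
`low_swap`, and `rel_one` rewrites the resulting derivatives of L_2 words as sums of two L_1 words.
-/
theorem IsCurrent.cyclic (h : IsCurrent k ι e) (x y z : Y) :
    Lop k ι 0 y (Lop k ι 1 z (ι x)) - Lop k ι 0 y (Lop k ι 1 x (ι z)) +
      (Lop k ι 0 z (Lop k ι 1 x (ι y)) - Lop k ι 0 z (Lop k ι 1 y (ι x))) +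
      (Lop k ι 0 x (Lop k ι 1 y (ι z)) - Lop k ι 0 x (Lop k ι 1 z (ι y))) ∈ filt k ι e 2 := by
  have hy : ι y ∈ filt k ι e 1 := gen_mem_filt 0 y
  have hz : ι z ∈ filt k ι e 1 := gen_mem_filt 0 z
  have h1 := Lop_mem_filt (h.rel_del y z) 1 x
  have h2 := h.del_mem_filt (h.low_swap x y z)
  have h3 := Lop_mem_filt (h.rel_one z x) 0 y
  have h4 := Lop_mem_filt (h.rel_one y x) 0 z
  have h5 := h.commute 1 0 x y hz
  have h6 := h.commute 1 0 x z hy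
  have h8 := add_mem (add_mem (sub_mem h1 h2) (sub_mem h3 h4))
    (Submodule.smul_mem _ (2 : k) (sub_mem h5 h6))
  refine (congrArg (· ∈ filt k ι e 2) ?_).mp h8
  simp only [map_sub, map_smul, map_add, Lop_del]
  push_cast
  module

end Spanning

end ConformalAlg

namespace ConformalAlg

/-! ### Spanning by ordered words -/

theorem exists_sorted {Y : Type*} [LinearOrder Y] (l : List Y) :
    ∃ l', l.Perm l' ∧ l'.Pairwise (· ≤ ·) :=
  ⟨l.insertionSort (· ≤ ·), (l.perm_insertionSort _).symm, l.pairwise_insertionSort _⟩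

section Words

variable (k : Type*) [Field k] {C : Type*} [AddCommGroup C] [Module k C] [Ops k C] {Y : Type*}

/-- `L_n^{x₁} … L_n^{xᵣ}` as a linear map. -/
def opMap (ι : Y → C) (n : ℕ) (xs : List Y) : C →ₗ[k] C :=
  xs.foldr (fun x f => Lop k ι n x ∘ₗ f) LinearMap.id

/-- `L₁^{y₁} … L₁^{yₘ} ∂^s z` as a function of `[y₁, …, yₘ, z]`. -/
def low (ι : Y → C) (s : ℕ) : List Y → C
  | [] => 0
  | [z] => ((del k : Module.End k C) ^ s) (ι z)
  | y :: z :: l => Lop k ι 1 y (low ι s (z :: l))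

/-- `L₁^{y₁} … L₁^{yₘ} L₂^z u` as a function of `[y₁, …, yₘ, z, u]`. -/
def high (ι : Y → C) : List Y → C
  | [] => 0
  | [_] => 0
  | [z, u] => Lop k ι 2 z (ι u)
  | y :: z :: u :: l => Lop k ι 1 y (high ι (z :: u :: l))

variable {k} {ι : Y → C} {e : C}

theorem opMap_cons (n : ℕ) (x : Y) (xs : List Y) (v : C) :
    opMap k ι n (x :: xs) v = Lop k ι n x (opMap k ι n xs v) := rfl

theorem opMap_append (n : ℕ) (xs ys : List Y) (v : C) :
    opMap k ι n (xs ++ ys) v = opMap k ι n xs (opMap k ι n ys v) := by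
  induction xs with
  | nil => rfl
  | cons x xs ih => rw [List.cons_append, opMap_cons, opMap_cons, ih]

theorem opMap_eq_opL (n : ℕ) (xs : List Y) (v : C) : opMap k ι n xs v = opL k ι n xs v := by
  induction xs with
  | nil => rfl
  | cons x xs ih => exact congrArg (Lop k ι n x) ih

/-- The hypothesis excludes the empty list, at which `low` has the conventional value 0. -/
theorem low_cons (s : ℕ) (y : Y) {l : List Y} (h : low k ι s l ≠ 0) :
    low k ι s (y :: l) = Lop k ι 1 y (low k ι s l) := by
  match l with
  | [] => exact absurd rfl h
  | z :: l => rfl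

theorem high_cons (y : Y) {l : List Y} (h : high k ι l ≠ 0) :
    high k ι (y :: l) = Lop k ι 1 y (high k ι l) := by
  match l with
  | [] => exact absurd rfl h
  | [_] => exact absurd rfl h
  | z :: u :: l => rfl

theorem low_append (s : ℕ) (ys : List Y) (z : Y) :
    low k ι s (ys ++ [z]) = opMap k ι 1 ys (((del k : Module.End k C) ^ s) (ι z)) := by
  induction ys with
  | nil => rfl
  | cons y ys ih =>
    rw [opMap_cons, ← ih]
    cases ys <;> rfl

theorem high_append (ys : List Y) (z u : Y) :
    high k ι (ys ++ [z, u]) = opMap k ι 1 ys (Lop k ι 2 z (ι u)) := by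
  induction ys with
  | nil => rfl
  | cons y ys ih =>
    rw [opMap_cons, ← ih]
    match ys with
    | [] => rfl
    | [_] => rfl
    | _ :: _ :: _ => rfl

theorem opMap_mem_filt {d : ℕ} {v : C} (hv : v ∈ filt k ι e d) (n : ℕ) (xs : List Y) :
    opMap k ι n xs v ∈ filt k ι e (xs.length + d) := by
  induction xs with
  | nil => rwa [List.length_nil, zero_add]
  | cons x xs ih =>
    rw [List.length_cons, Nat.add_right_comm]
    exact Lop_mem_filt ih n x

theorem low_mem_filt (s : ℕ) : ∀ l : List Y, low k ι s l ∈ filt k ι e l.length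
  | [] => zero_mem _
  | [z] => del_pow_mem_filt 0 s z
  | y :: z :: l => Lop_mem_filt (low_mem_filt s (z :: l)) 1 y

theorem high_mem_filt : ∀ l : List Y, high k ι l ∈ filt k ι e l.length
  | [] => zero_mem _
  | [_] => zero_mem _
  | [z, u] => Lop_mem_filt (gen_mem_filt 0 u) 2 z
  | y :: z :: u :: l => Lop_mem_filt (high_mem_filt (z :: u :: l)) 1 y

variable (k ι) in
/-- Words of the given length in the operators `L₁` applied to `∂^s z` or `L₂^z u`. -/
inductive IsBase : ℕ → C → Prop
  | low (s : ℕ) (z : Y) : IsBase 1 (((del k : Module.End k C) ^ s) (ι z))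
  | high (z u : Y) : IsBase 2 (Lop k ι 2 z (ι u))
  | cons (y : Y) {l : ℕ} {b : C} : IsBase l b → IsBase (l + 1) (Lop k ι 1 y b)

theorem IsBase.mem_filt {l : ℕ} {b : C} (hb : IsBase k ι l b) : b ∈ filt k ι e l := by
  induction hb with
  | low s z => exact del_pow_mem_filt 0 s z
  | high z u => exact Lop_mem_filt (gen_mem_filt 0 u) 2 z
  | cons y _ ih => exact Lop_mem_filt ih 1 y

theorem IsBase.exists_list {l : ℕ} {b : C} (hb : IsBase k ι l b) :
    (∃ s l', l'.length = l ∧ l' ≠ [] ∧ b = ConformalAlg.low k ι s l') ∨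
      ∃ l', l'.length = l ∧ 2 ≤ l'.length ∧ b = ConformalAlg.high k ι l' := by
  induction hb with
  | low s z => exact Or.inl ⟨s, [z], rfl, by simp, rfl⟩
  | high z u => exact Or.inr ⟨[z, u], rfl, le_rfl, rfl⟩
  | cons y _ ih =>
    rcases ih with ⟨s, _ | ⟨z, l⟩, rfl, h, rfl⟩ | ⟨_ | ⟨z, _ | ⟨u, l⟩⟩, rfl, h, rfl⟩
    · exact absurd rfl h
    · exact Or.inl ⟨s, y :: z :: l, rfl, by simp, rfl⟩
    · simp at h
    · simp at h
    · exact Or.inr ⟨y :: z :: u :: l, rfl, by simp, rfl⟩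

variable (k ι) in
/-- The span of the words of length `d` in which the operators `L₀` come first. -/
def wordSpan (d : ℕ) : Submodule k C :=
  Submodule.span k {w | ∃ xs l b, IsBase k ι l b ∧ xs.length + l = d ∧ w = opMap k ι 0 xs b}

theorem opMap_base_mem {l : ℕ} {b : C} (hb : IsBase k ι l b) (xs : List Y) :
    opMap k ι 0 xs b ∈ wordSpan k ι (xs.length + l) :=
  Submodule.subset_span ⟨xs, l, b, hb, rfl, rfl⟩

theorem opMap_wordSpan {d : ℕ} {v : C} (hv : v ∈ wordSpan k ι d) (xs : List Y) :
    opMap k ι 0 xs v ∈ wordSpan k ι (xs.length + d) := by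
  suffices H : wordSpan k ι d ≤ (wordSpan k ι (xs.length + d)).comap (opMap k ι 0 xs) from H hv
  refine Submodule.span_le.2 ?_
  rintro _ ⟨ys, l, b, hb, rfl, rfl⟩
  rw [SetLike.mem_coe, Submodule.mem_comap, ← opMap_append, ← add_assoc, ← List.length_append]
  exact opMap_base_mem hb _

variable [IsConformal k C] [CharZero k] [IsAssoc k C]

theorem IsCurrent.opMap_perm (h : IsCurrent k ι e) (n : ℕ) {j : ℕ} {v : C}
    (hv : v ∈ filt k ι e (j + 1)) {xs xs' : List Y} (hp : xs.Perm xs') :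
    opMap k ι n xs v - opMap k ι n xs' v ∈ filt k ι e (xs.length + j) := by
  induction hp with
  | nil => rw [sub_self]; exact zero_mem _
  | cons x _ ih =>
    rw [opMap_cons, opMap_cons, ← map_sub, List.length_cons, Nat.add_right_comm]
    exact Lop_mem_filt ih n x
  | swap x y l =>
    have h1 := h.commute n n y x (opMap_mem_filt hv n l)
    exact filt_mono (by simp only [List.length_cons]; omega) h1
  | trans hp _ ih ih' =>
    rw [← hp.length_eq] at ih'
    have h1 := add_mem ih ih'
    rwa [sub_add_sub_cancel] at h1

theorem IsCurrent.Lop_opMap (h : IsCurrent k ι e) (n m : ℕ) (x : Y) {j : ℕ} {v : C}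
    (hv : v ∈ filt k ι e j) (xs : List Y) :
    Lop k ι n x (opMap k ι m xs v) - opMap k ι m xs (Lop k ι n x v) ∈
      filt k ι e (xs.length + j) := by
  induction xs with
  | nil => rw [opMap, List.foldr_nil, LinearMap.id_apply, LinearMap.id_apply, sub_self]
           exact zero_mem _
  | cons y xs ih =>
    rw [List.length_cons, Nat.add_right_comm, opMap_cons, opMap_cons]
    have h1 := add_mem (h.commute n m x y (opMap_mem_filt hv m xs)) (Lop_mem_filt ih m y)
    rwa [map_sub, sub_add_sub_cancel] at h1

-- The only derivative not absorbed by moving ∂ inward is that of L_2^z u, which `rel_one` turns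
-- into L_1 words.
omit [IsAssoc k C] in
theorem IsCurrent.del_mem_wordSpan_two (h : IsCurrent k ι e) {v : C}
    (hv : v ∈ filt k ι e 1 ⊔ wordSpan k ι 2) : del k v ∈ filt k ι e 1 ⊔ wordSpan k ι 2 := by
  have h0 : ∀ s y z, Lop k ι 0 y (((del k : Module.End k C) ^ s) (ι z)) ∈ wordSpan k ι 2 :=
    fun s y z => opMap_base_mem (IsBase.low s z) [y]
  have h1 : ∀ s y z, Lop k ι 1 y (((del k : Module.End k C) ^ s) (ι z)) ∈ wordSpan k ι 2 :=
    fun s y z => opMap_base_mem (IsBase.cons y (IsBase.low s z)) []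
  suffices H : filt k ι e 1 ⊔ wordSpan k ι 2 ≤ (filt k ι e 1 ⊔ wordSpan k ι 2).comap (del k) from
    H hv
  refine sup_le (fun v hv => Submodule.mem_sup_left (h.del_mem_filt hv)) (Submodule.span_le.2 ?_)
  rintro _ ⟨xs, l, b, hb, hl, rfl⟩
  rw [SetLike.mem_coe, Submodule.mem_comap]
  cases hb with
  | low s z =>
    obtain ⟨y, rfl⟩ := List.length_eq_one_iff.1 (show xs.length = 1 by omega)
    refine Submodule.mem_sup_right ?_
    change del k (Lop k ι 0 y _) ∈ _
    rw [del_Lop_zero]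
    have h2 := h0 (s + 1) y z
    rwa [pow_succ', Module.End.mul_apply] at h2
  | high z u =>
    obtain rfl := List.length_eq_zero_iff.1 (show xs.length = 0 by omega)
    change del k (Lop k ι 2 z _) ∈ _
    rw [← sub_sub_cancel (Lop k ι 1 u (ι z) + Lop k ι 1 z (ι u)) (del k (Lop k ι 2 z (ι u)))]
    exact sub_mem (Submodule.mem_sup_right (add_mem (h1 0 u z) (h1 0 z u)))
      (Submodule.mem_sup_left (h.rel_one u z))
  | cons y hb =>
    cases hb with
    | low s z =>
      obtain rfl := List.length_eq_zero_iff.1 (show xs.length = 0 by omega)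
      refine Submodule.mem_sup_right ?_
      change del k (Lop k ι 1 y _) ∈ _
      rw [del_Lop_one]
      have h2 := h1 (s + 1) y z
      rw [pow_succ', Module.End.mul_apply] at h2
      exact sub_mem h2 (h0 s y z)
    | high z u => omega
    | cons z hb => cases hb <;> omega

-- Moving ∂ out of L_n reduces to s = 0, where locality leaves only n = 0, 1, 2.
omit [IsAssoc k C] in
theorem IsCurrent.Lop_low_mem (h : IsCurrent k ι e) (x z : Y) (s : ℕ) : ∀ n,
    Lop k ι n x (((del k : Module.End k C) ^ s) (ι z)) ∈ filt k ι e 1 ⊔ wordSpan k ι 2 := by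
  induction s with
  | zero =>
    intro n
    match n with
    | 0 => exact Submodule.mem_sup_right (opMap_base_mem (IsBase.low 0 z) [x])
    | 1 => exact Submodule.mem_sup_right (opMap_base_mem (IsBase.cons x (IsBase.low 0 z)) [])
    | 2 => exact Submodule.mem_sup_right (opMap_base_mem (IsBase.high x z) [])
    | n + 3 =>
      have h1 : Lop k ι (n + 3) x (ι z) = 0 := h.local_three x z _ (by omega)
      rw [pow_zero, Module.End.one_apply, h1]
      exact zero_mem _
  | succ s ih =>
    intro n
    rw [pow_succ', Module.End.mul_apply, Lop_del]
    exact add_mem (h.del_mem_wordSpan_two (ih n)) (Submodule.smul_mem _ _ (ih _))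

/-- Reduce a statement about all words to words without operators `L₀`. -/
theorem IsCurrent.Lop_wordSpan_aux (h : IsCurrent k ι e) (n : ℕ) (x : Y)
    (H : ∀ l b, IsBase k ι l b → Lop k ι n x b ∈ filt k ι e l ⊔ wordSpan k ι (l + 1)) {d : ℕ}
    {v : C} (hv : v ∈ wordSpan k ι d) : Lop k ι n x v ∈ filt k ι e d ⊔ wordSpan k ι (d + 1) := by
  suffices h0 : wordSpan k ι d ≤ (filt k ι e d ⊔ wordSpan k ι (d + 1)).comap (Lop k ι n x) from
    h0 hv
  refine Submodule.span_le.2 ?_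
  rintro _ ⟨xs, l, b, hb, rfl, rfl⟩
  rw [SetLike.mem_coe, Submodule.mem_comap]
  have h1 := h.Lop_opMap n 0 x (hb.mem_filt (e := e)) xs
  obtain ⟨u, hu, w, hw, huw⟩ := Submodule.mem_sup.1 (H l b hb)
  have h3 := opMap_wordSpan hw xs
  rw [← add_assoc] at h3
  have h2 := add_mem (Submodule.mem_sup_left h1) (add_mem
    (Submodule.mem_sup_left (opMap_mem_filt hu 0 xs)) (Submodule.mem_sup_right h3))
  rwa [← map_add, huw, sub_add_cancel] at h2

/-- L_0 and L_1 prolong the word in the prescribed form. For n ≥ 2 the operator is commuted inward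
to the innermost part: L_2^z u makes it negligible by `high_eq_zero`, and on ∂^s z the two-letter
case applies. -/
theorem IsCurrent.Lop_wordSpan (h : IsCurrent k ι e) (n : ℕ) (x : Y) {d : ℕ} {v : C}
    (hv : v ∈ wordSpan k ι d) : Lop k ι n x v ∈ filt k ι e d ⊔ wordSpan k ι (d + 1) := by
  have hone : ∀ y, ∀ {d : ℕ} {v : C}, v ∈ wordSpan k ι d →
      Lop k ι 1 y v ∈ filt k ι e d ⊔ wordSpan k ι (d + 1) := fun y _ _ =>
    h.Lop_wordSpan_aux 1 y fun l b hb => Submodule.mem_sup_right (by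
      have h1 := opMap_base_mem (IsBase.cons y hb) []
      rwa [List.length_nil, zero_add] at h1)
  match n with
  | 0 =>
    refine h.Lop_wordSpan_aux 0 x (fun l b hb => Submodule.mem_sup_right ?_) hv
    have h1 := opMap_base_mem hb [x]
    rwa [List.length_singleton, add_comm] at h1
  | 1 => exact hone x hv
  | n + 2 =>
    refine h.Lop_wordSpan_aux _ x (fun l b hb => ?_) hv
    induction hb with
    | low s z => exact h.Lop_low_mem x z s _
    | high z u => exact Submodule.mem_sup_left (h.high_eq_zero (by omega) x z u)
    | cons y hb ih =>
      obtain ⟨u, hu, w, hw, huw⟩ := Submodule.mem_sup.1 ih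
      have h1 := h.commute (n + 2) 1 x y (hb.mem_filt (e := e))
      have h2 := add_mem (Submodule.mem_sup_left h1)
        (add_mem (Submodule.mem_sup_left (Lop_mem_filt hu 1 y)) (hone y hw))
      rwa [← map_add, huw, sub_add_cancel] at h2

theorem IsCurrent.filt_succ_le_wordSpan (h : IsCurrent k ι e) (d : ℕ) :
    filt k ι e (d + 1) ≤ filt k ι e d ⊔ wordSpan k ι (d + 1) := by
  induction d with
  | zero =>
    refine filt_succ_le le_sup_left (fun s x => ?_) fun n x v hv => ?_
    · exact Submodule.mem_sup_right (opMap_base_mem (IsBase.low s x) [])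
    · rw [Lop_span_e h hv]
      exact zero_mem _
  | succ d ih =>
    refine filt_succ_le le_sup_left (fun s x => Submodule.mem_sup_left (del_pow_mem_filt d s x))
      fun n x v hv => ?_
    obtain ⟨u, hu, w, hw, rfl⟩ := Submodule.mem_sup.1 (ih hv)
    rw [map_add]
    exact add_mem (Submodule.mem_sup_left (Lop_mem_filt hu n x)) (h.Lop_wordSpan n x hw)

/-- Associativity peels the left factor one letter at a time, turning each into an operator applied
to a shorter product. -/
theorem IsCurrent.nprod_mem_filt (h : IsCurrent k ι e) {d d' : ℕ} {u v : C}
    (hu : u ∈ filt k ι e d) (hv : v ∈ filt k ι e d') (n : ℕ) :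
    nprod k n u v ∈ filt k ι e (d + d') := by
  suffices H : ∀ n v, v ∈ filt k ι e d' → filt k ι e d ≤
      (filt k ι e (d + d')).comap ((Ops.prod (k := k) n).flip v) from H n v hv hu
  clear hu hv n v u
  induction d with
  | zero =>
    intro n v _ u hu
    rw [Submodule.mem_comap, LinearMap.flip_apply, ← nprod, nprod_span_e h hu]
    exact zero_mem _
  | succ d ih =>
    intro n v hv
    refine filt_succ_le ((ih n v hv).trans (Submodule.comap_mono (filt_mono (by omega))))
      (fun s x => ?_) fun m x w hw => ?_
    · rw [Submodule.mem_comap, LinearMap.flip_apply, ← nprod, nprod_del_pow]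
      exact Submodule.smul_mem _ _ (filt_mono (by omega) (Lop_mem_filt hv (n - s) x))
    · rw [Submodule.mem_comap, LinearMap.flip_apply, ← nprod, Lop, ← nprod, IsAssoc.assoc]
      refine Submodule.sum_mem _ fun s _ => Submodule.smul_mem _ _ ?_
      rw [Nat.add_right_comm]
      exact Lop_mem_filt (ih (n + s) v hv hw) (m - s) x

/-- A generated algebra is exhausted by the filtration. -/
theorem IsCurrent.iSup_filt (h : IsCurrent k ι e)
    (hgen : ∀ S : Submodule k C, (∀ y, ι y ∈ S) → e ∈ S → (∀ a ∈ S, del k a ∈ S) →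
      (∀ n, ∀ a ∈ S, ∀ b ∈ S, nprod k n a b ∈ S) → S = ⊤) : ⨆ d, filt k ι e d = ⊤ := by
  have hmono : Monotone (filt k ι e) := fun _ _ => filt_mono
  have hmem : ∀ a, a ∈ ⨆ d, filt k ι e d ↔ ∃ d, a ∈ filt k ι e d := fun a =>
    Submodule.mem_iSup_of_directed _ hmono.directed_le
  refine hgen _ (fun y => (hmem _).2 ⟨1, gen_mem_filt 0 y⟩) ((hmem _).2 ⟨0, e_mem_filt 0⟩) ?_ ?_
  · intro a ha
    obtain ⟨d, hd⟩ := (hmem a).1 ha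
    exact (hmem _).2 ⟨d, h.del_mem_filt hd⟩
  · intro n a ha b hb
    obtain ⟨d, hd⟩ := (hmem a).1 ha
    obtain ⟨d', hd'⟩ := (hmem b).1 hb
    exact (hmem _).2 ⟨d + d', h.nprod_mem_filt hd hd' n⟩

/-- Words of length `len` that start with an operator `L₀`, together with shorter words. -/
def shortSpan (ι : Y → C) (e : C) (b : List Y → C) (len : ℕ) : Submodule k C :=
  filt k ι e (len - 1) ⊔
    Submodule.span k {w | ∃ a l, l.length + 1 = len ∧ w = Lop k ι 0 a (b l)}

/-- L_1^a passes the leading L_0 up to shorter words, so the error terms of a reordering keep their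
shape when the word is prolonged on the left. -/
theorem IsCurrent.Lop_shortSpan (h : IsCurrent k ι e) {b : List Y → C}
    (hb : ∀ l, b l ∈ filt k ι e l.length)
    (hcons : ∀ a l, b l ≠ 0 → b (a :: l) = Lop k ι 1 a (b l)) {len : ℕ} (hlen : 1 ≤ len) {v : C}
    (hv : v ∈ shortSpan (k := k) ι e b len) (a : Y) :
    Lop k ι 1 a v ∈ shortSpan (k := k) ι e b (len + 1) := by
  obtain ⟨len, rfl⟩ := Nat.exists_eq_add_of_le' hlen
  suffices H : shortSpan (k := k) ι e b (len + 1) ≤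
      (shortSpan (k := k) ι e b (len + 1 + 1)).comap (Lop k ι 1 a) from H hv
  refine sup_le (fun v hv => Submodule.mem_sup_left (Lop_mem_filt hv 1 a)) (Submodule.span_le.2 ?_)
  rintro _ ⟨c, l, hl, rfl⟩
  rw [SetLike.mem_coe, Submodule.mem_comap]
  have h1 := h.commute 1 0 a c (hb l)
  rw [← sub_add_cancel (Lop k ι 1 a (Lop k ι 0 c (b l))) (Lop k ι 0 c (Lop k ι 1 a (b l)))]
  refine add_mem (Submodule.mem_sup_left (filt_mono (by omega) h1)) (Submodule.mem_sup_right ?_)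
  by_cases h0 : b l = 0
  · rw [h0, map_zero, map_zero]
    exact zero_mem _
  · rw [← hcons a l h0]
    exact Submodule.subset_span ⟨c, a :: l, by rw [List.length_cons, hl], rfl⟩

/-- The last two letters are exchanged by `rel_two`, the two before the last by `high_symm`, and all
others by commuting operators L_1. -/
theorem IsCurrent.high_perm (h : IsCurrent k ι e) {l l' : List Y} (hp : l.Perm l') :
    high k ι l - high k ι l' ∈ filt k ι e (l.length - 1) := by
  induction hp with
  | nil => rw [sub_self]; exact zero_mem _
  | @cons x l l' hp ih =>
    have hl := hp.length_eq
    match l, l', hl, ih with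
    | [], [], _, _ => rw [sub_self]; exact zero_mem _
    | [_], [_], _, _ =>
      obtain rfl := List.singleton_inj.1 (List.perm_singleton.1 hp)
      rw [sub_self]; exact zero_mem _
    | y :: z :: l, y' :: z' :: l', _, ih =>
      change Lop k ι 1 x _ - Lop k ι 1 x _ ∈ _
      rw [← map_sub]
      exact Lop_mem_filt ih 1 x
  | swap x y l =>
    match l with
    | [] =>
      change Lop k ι 2 y (ι x) - Lop k ι 2 x (ι y) ∈ _
      rw [h.rel_two y x, sub_self]
      exact zero_mem _
    | [u] => exact h.high_symm y x u
    | z :: u :: l => exact h.commute 1 1 y x (high_mem_filt (z :: u :: l))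
  | trans hp _ ih ih' =>
    rw [← hp.length_eq] at ih'
    have h1 := add_mem ih ih'
    rwa [sub_add_sub_cancel] at h1

/-- Only an exchange with the last letter is more than a commutation; by `rel_swap` it costs words
that start with L_0 and have one ∂ fewer. -/
theorem IsCurrent.low_succ_perm (h : IsCurrent k ι e) (s : ℕ) {l l' : List Y} (hp : l.Perm l') :
    low k ι (s + 1) l - low k ι (s + 1) l' ∈
      shortSpan (k := k) ι e (low k ι s) l.length := by
  induction hp with
  | nil => rw [sub_self]; exact zero_mem _
  | @cons x l l' hp ih =>
    have hl := hp.length_eq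
    match l, l', hl, ih with
    | [], [], _, _ => rw [sub_self]; exact zero_mem _
    | y :: l, y' :: l', _, ih =>
      change Lop k ι 1 x _ - Lop k ι 1 x _ ∈ _
      rw [← map_sub]
      exact h.Lop_shortSpan (low_mem_filt s) (fun a l => low_cons s a) (by simp) ih x
  | swap x y l =>
    match l with
    | [] =>
      have h1 := h.rel_swap s y x
      refine (congrArg (· ∈ shortSpan (k := k) ι e (low k ι s) _) (sub_add_cancel _ _)).mp
        (add_mem (Submodule.mem_sup_left h1) (Submodule.mem_sup_right
          (Submodule.smul_mem _ ((s : k) + 3) (sub_mem ?_ ?_))))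
      · exact Submodule.subset_span ⟨y, [x], rfl, rfl⟩
      · exact Submodule.subset_span ⟨x, [y], rfl, rfl⟩
    | z :: l =>
      exact Submodule.mem_sup_left (h.commute 1 1 y x (low_mem_filt (s + 1) (z :: l)))
  | trans hp _ ih ih' =>
    rw [← hp.length_eq] at ih'
    have h1 := add_mem ih ih'
    rwa [sub_add_sub_cancel] at h1

/-- Without ∂ the exchange with the last letter comes from `low_swap`, which needs one more L_1 to
the left. It costs words in which L_0 precedes a word containing L_2. -/
theorem IsCurrent.low_zero_perm (h : IsCurrent k ι e) {l l' : List Y} (hp : l.Perm l')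
    (h3 : 3 ≤ l.length) :
    low k ι 0 l - low k ι 0 l' ∈ shortSpan (k := k) ι e (high k ι) l.length := by
  induction hp with
  | nil => rw [sub_self]; exact zero_mem _
  | @cons x l l' hp ih =>
    have hl := hp.length_eq
    match l, l', hl, ih with
    | [], _, _, _ => simp at h3
    | [_], _, _, _ => simp at h3
    | [y, z], [y', z'], _, _ =>
      have h1 : Lop k ι 0 y (Lop k ι 2 x (ι z)) - Lop k ι 0 z (Lop k ι 2 x (ι y)) ∈
          Submodule.span k {w | ∃ a l, l.length + 1 = 3 ∧ w = Lop k ι 0 a (high k ι l)} :=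
        sub_mem (Submodule.subset_span ⟨y, [x, z], rfl, rfl⟩)
          (Submodule.subset_span ⟨z, [x, y], rfl, rfl⟩)
      have h2 := add_mem (Submodule.mem_sup_left (h.low_swap x y z))
        (Submodule.mem_sup_right (S := filt k ι e 2) h1)
      rw [sub_add_cancel] at h2
      have h4 : [y', z'] = [y, z] ∨ [y', z'] = [z, y] := by
        have hm : y' ∈ [y, z] := hp.symm.subset (by simp)
        rcases List.mem_pair.1 hm with rfl | rfl
        · rw [List.singleton_inj.1 (List.perm_singleton.1 (hp.symm.cons_inv))]
          exact Or.inl rfl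
        · have h5 := (hp.symm.trans (List.Perm.swap y' y [])).cons_inv
          rw [List.singleton_inj.1 (List.perm_singleton.1 h5)]
          exact Or.inr rfl
      rcases h4 with h4 | h4
      · rw [h4, sub_self]; exact zero_mem _
      · rw [h4]; exact h2
    | y :: w :: z :: l, y' :: l', _, ih =>
      change Lop k ι 1 x _ - Lop k ι 1 x _ ∈ _
      rw [← map_sub]
      exact h.Lop_shortSpan high_mem_filt (fun a l => high_cons a) (by simp) (ih (by simp)) x
  | swap x y l =>
    match l with
    | [] => simp at h3
    | z :: l =>
      exact Submodule.mem_sup_left (h.commute 1 1 y x (low_mem_filt 0 (z :: l)))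
  | trans hp _ ih ih' =>
    rw [← hp.length_eq] at ih'
    have h1 := add_mem (ih h3) (ih' h3)
    rwa [sub_add_sub_cancel] at h1

end Words

end ConformalAlg

namespace ConformalAlg

/-! ### Reduction of words to ordered words -/

section OrderedWords

variable {k : Type*} [Field k] {C : Type*} [AddCommGroup C] [Module k C] [Ops k C]
  {Y : Type*} [LinearOrder Y] {ι : Y → C} {e : C}

omit [LinearOrder Y] in
theorem exists_eq_append_pair {l : List Y} (h : 2 ≤ l.length) :
    ∃ ys z u, l = ys ++ [z, u] := by
  rcases l.eq_nil_or_concat with rfl | ⟨l, u, rfl⟩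
  · simp at h
  rcases l.eq_nil_or_concat with rfl | ⟨l, z, rfl⟩
  · simp at h
  exact ⟨l, z, u, by simp⟩

variable (k ι e) in
/-- The span of `e` and the ordered words. -/
def orderedSpan : Submodule k C :=
  Submodule.span k (Set.range fun o : Option (Monomial Y) => o.elim e fun w => w.eval k ι)

theorem eval_mem_orderedSpan (w : Monomial Y) : w.eval k ι ∈ orderedSpan k ι e :=
  Submodule.subset_span ⟨some w, rfl⟩

variable [IsConformal k C] [CharZero k] [IsAssoc k C]

section Step

variable {d : ℕ}

theorem IsCurrent.opMap_mem_of_perm (h : IsCurrent k ι e) (hd : filt k ι e d ≤ orderedSpan k ι e)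
    {xs xs' : List Y} (hp : xs.Perm xs') {j : ℕ} {v : C} (hv : v ∈ filt k ι e (j + 1))
    (hj : xs.length + j = d) (H : opMap k ι 0 xs' v ∈ orderedSpan k ι e) :
    opMap k ι 0 xs v ∈ orderedSpan k ι e := by
  have h1 := add_mem (hd (hj ▸ h.opMap_perm 0 hv hp)) H
  rwa [sub_add_cancel] at h1

theorem IsCurrent.high_mem (h : IsCurrent k ι e) (hd : filt k ι e d ≤ orderedSpan k ι e)
    (xs l : List Y) (hl : xs.length + l.length = d + 1) :
    opMap k ι 0 xs (high k ι l) ∈ orderedSpan k ι e := by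
  by_cases h2 : 2 ≤ l.length
  · obtain ⟨l', hp, hs⟩ := exists_sorted l
    obtain ⟨xs', hp', hs'⟩ := exists_sorted xs
    have hlen := hp'.length_eq
    have hlen' := hp.length_eq
    obtain ⟨j, hj⟩ := Nat.exists_eq_add_of_le' (show 1 ≤ l.length by omega)
    refine h.opMap_mem_of_perm hd hp' (j := j) (hj ▸ high_mem_filt l) (by omega) ?_
    have h3 := opMap_mem_filt (h.high_perm hp) 0 xs'
    rw [map_sub] at h3
    obtain ⟨ys, z, u, rfl⟩ := exists_eq_append_pair (hlen' ▸ h2)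
    have h4 := add_mem (hd (filt_mono (by omega) h3))
      (eval_mem_orderedSpan (k := k) (ι := ι) (e := e) (.fam₁ xs' ys z u hs' hs))
    rwa [Monomial.eval, ← opMap_eq_opL, ← opMap_eq_opL, ← high_append, sub_add_cancel] at h4
  · have h0 : high k ι l = 0 := by
      match l, h2 with
      | [], _ => rfl
      | [_], _ => rfl
      | _ :: _ :: _, h2 => simp at h2
    rw [h0, map_zero]
    exact zero_mem _

omit [IsConformal k C] [CharZero k] [IsAssoc k C] in
theorem opMap_shortSpan (hd : filt k ι e d ≤ orderedSpan k ι e) {b : List Y → C}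
    (hb : ∀ xs l, xs.length + l.length = d + 1 → opMap k ι 0 xs (b l) ∈ orderedSpan k ι e)
    {len : ℕ} (xs : List Y) (hl : xs.length + len = d + 1) (hlen : 1 ≤ len) {v : C}
    (hv : v ∈ shortSpan (k := k) ι e b len) : opMap k ι 0 xs v ∈ orderedSpan k ι e := by
  suffices H : shortSpan (k := k) ι e b len ≤ (orderedSpan k ι e).comap (opMap k ι 0 xs) from H hv
  refine sup_le (fun v hv => hd (filt_mono (by omega) (opMap_mem_filt hv 0 xs)))
    (Submodule.span_le.2 ?_)
  rintro _ ⟨a, l, hl', rfl⟩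
  have h1 := hb (xs ++ [a]) l (by rw [List.length_append, List.length_singleton]; omega)
  rwa [opMap_append] at h1

theorem IsCurrent.low_pair_mem_of_le (h : IsCurrent k ι e) (hd : filt k ι e d ≤ orderedSpan k ι e)
    (xs : List Y) (y z : Y) (hl : xs.length + 2 = d + 1) (hy : (∀ x ∈ xs, x ≤ y) ∨ y ≤ z) :
    opMap k ι 0 xs (Lop k ι 1 y (ι z)) ∈ orderedSpan k ι e := by
  obtain ⟨xs', hp', hs'⟩ := exists_sorted xs
  refine h.opMap_mem_of_perm hd hp' (j := 1) (Lop_mem_filt (gen_mem_filt 0 z) 1 y) (by omega) ?_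
  have h1 := eval_mem_orderedSpan (k := k) (ι := ι) (e := e) (.fam₄ xs' y z hs'
    (hy.imp_left fun h x hx => h x (hp'.symm.subset (List.mem_of_mem_getLast? hx))))
  rwa [Monomial.eval, ← opMap_eq_opL] at h1

/-- With the L_0 letters sorted and x the largest of them, the word is not ordered only if z < y <
x. The `cyclic` relation then expresses it through five words: in each, either the L_1 letter is x,
which dominates all L_0 letters, or the last two letters are in order. -/
theorem IsCurrent.low_pair_mem (h : IsCurrent k ι e) (hd : filt k ι e d ≤ orderedSpan k ι e)
    (xs : List Y) (y z : Y) (hl : xs.length + 2 = d + 1) :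
    opMap k ι 0 xs (Lop k ι 1 y (ι z)) ∈ orderedSpan k ι e := by
  obtain ⟨xs', hp', hs'⟩ := exists_sorted xs
  refine h.opMap_mem_of_perm hd hp' (j := 1) (Lop_mem_filt (gen_mem_filt 0 z) 1 y) (by omega) ?_
  rw [hp'.length_eq] at hl
  clear hp' xs
  rcases xs'.eq_nil_or_concat with rfl | ⟨xs, x, rfl⟩
  · exact h.low_pair_mem_of_le hd _ y z hl (Or.inl (by simp))
  rw [List.concat_eq_append] at hl hs' ⊢
  have hx : ∀ a ∈ xs, a ≤ x := fun a ha => (List.pairwise_append.1 hs').2.2 a ha x (by simp)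
  by_cases hyz : y ≤ z
  · exact h.low_pair_mem_of_le hd _ y z hl (Or.inr hyz)
  by_cases hxy : x ≤ y
  · refine h.low_pair_mem_of_le hd _ y z hl (Or.inl fun a ha => ?_)
    rcases List.mem_append.1 ha with ha | ha
    · exact (hx a ha).trans hxy
    · exact (List.mem_singleton.1 ha).trans_le hxy
  rw [not_le] at hyz hxy
  have hlen : ∀ a, (xs ++ [a]).length + 2 = d + 1 := fun a => by simpa using hl
  have hmax : ∀ a, a ≤ x → ∀ c ∈ xs ++ [a], c ≤ x := fun a ha c hc => by
    rcases List.mem_append.1 hc with hc | hc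
    · exact hx c hc
    · exact (List.mem_singleton.1 hc).trans_le ha
  have good : ∀ a b c, (∀ x ∈ xs ++ [a], x ≤ b) ∨ b ≤ c →
      opMap k ι 0 xs (Lop k ι 0 a (Lop k ι 1 b (ι c))) ∈ orderedSpan k ι e := fun a b c habc => by
    have h1 := h.low_pair_mem_of_le hd (xs ++ [a]) b c (hlen a) habc
    rwa [opMap_append] at h1
  have hc := opMap_mem_filt (h.cyclic x y z) 0 xs
  simp only [map_add, map_sub] at hc
  have h1 := add_mem (add_mem (sub_mem (sub_mem (hd (filt_mono (by simp at hl; omega) hc))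
    (good y z x (Or.inr (hyz.trans hxy).le))) (good z x y (Or.inl (hmax z (hyz.trans hxy).le))))
    (good z y x (Or.inr hxy.le))) (add_mem (good x z y (Or.inr hyz.le))
      (good y x z (Or.inl (hmax y hxy.le))))
  rw [opMap_append]
  refine (congrArg (· ∈ orderedSpan k ι e) ?_).mp h1
  change _ = opMap k ι 0 xs (Lop k ι 0 x (Lop k ι 1 y (ι z)))
  abel

/-- Induction on s. For s + 1 the error terms of sorting are words with s, covered by induction. For
s = 0 they contain L_2 and are covered by `high_mem`, except for two letters, which are treated by
`low_pair_mem`. -/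
theorem IsCurrent.low_mem (h : IsCurrent k ι e) (hd : filt k ι e d ≤ orderedSpan k ι e) (s : ℕ) :
    ∀ xs l : List Y, xs.length + l.length = d + 1 →
      opMap k ι 0 xs (low k ι s l) ∈ orderedSpan k ι e := by
  have hsort : ∀ s xs l, l ≠ [] → xs.length + l.length = d + 1 →
      (∀ xs' l', xs'.length = xs.length → l.Perm l' → xs'.Pairwise (· ≤ ·) →
        l'.Pairwise (· ≤ ·) → ∀ ys z, l' = ys ++ [z] →
          opMap k ι 0 xs' (low k ι s l - low k ι s l') ∈ orderedSpan k ι e ∧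
          opMap k ι 0 xs' (low k ι s l') ∈ orderedSpan k ι e) →
      opMap k ι 0 xs (low k ι s l) ∈ orderedSpan k ι e := by
    intro s xs l hl hlen H
    obtain ⟨l', hp, hs⟩ := exists_sorted l
    obtain ⟨xs', hp', hs'⟩ := exists_sorted xs
    obtain ⟨j, hj⟩ := Nat.exists_eq_add_of_le' (List.length_pos_iff.2 hl)
    refine h.opMap_mem_of_perm hd hp' (j := j) (hj ▸ low_mem_filt s l) (by omega) ?_
    rcases l'.eq_nil_or_concat with rfl | ⟨ys, z, rfl⟩
    · exact absurd (List.perm_nil.1 hp) hl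
    rw [List.concat_eq_append] at hp hs
    obtain ⟨h1, h2⟩ := H xs' _ hp'.length_eq.symm hp hs' hs ys z rfl
    have h3 := add_mem h1 h2
    rwa [← map_add, sub_add_cancel] at h3
  induction s with
  | zero =>
    intro xs l hl
    match l with
    | [] => exact (map_zero (opMap k ι 0 xs)) ▸ zero_mem _
    | [y, z] => exact h.low_pair_mem hd xs y z hl
    | [z] =>
      refine hsort 0 xs [z] (by simp) hl fun xs' l' hlen hp hs' hs ys z' hys => ?_
      obtain rfl := List.perm_singleton.1 hp.symm
      refine ⟨?_, ?_⟩
      · rw [sub_self, map_zero]; exact zero_mem _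
      · have h1 := eval_mem_orderedSpan (k := k) (ι := ι) (e := e)
          (.fam₃ xs' [] z hs' hs (Or.inl rfl))
        rwa [Monomial.eval, ← opMap_eq_opL] at h1
    | x :: y :: z :: l =>
      refine hsort 0 xs _ (by simp) hl fun xs' l' hlen hp hs' hs ys z' hys => ⟨?_, ?_⟩
      · exact opMap_shortSpan hd (h.high_mem hd) xs' (by rw [hlen, hl]) (by simp)
          (h.low_zero_perm hp (by simp))
      · subst hys
        have hlen' := hp.length_eq
        simp only [List.length_cons, List.length_append, List.length_nil] at hlen'
        have h1 := eval_mem_orderedSpan (k := k) (ι := ι) (e := e)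
          (.fam₃ xs' ys z' hs' hs (Or.inr (by omega)))
        rw [low_append, pow_zero, Module.End.one_apply]
        rwa [Monomial.eval, ← opMap_eq_opL, ← opMap_eq_opL] at h1
  | succ s ih =>
    intro xs l hl
    match l with
    | [] => exact (map_zero (opMap k ι 0 xs)) ▸ zero_mem _
    | y :: l =>
      refine hsort (s + 1) xs _ (by simp) hl fun xs' l' hlen hp hs' hs ys z' hys => ⟨?_, ?_⟩
      · exact opMap_shortSpan hd ih xs' (by rw [hlen, hl]) (by simp) (h.low_succ_perm s hp)
      · subst hys
        have h1 := eval_mem_orderedSpan (k := k) (ι := ι) (e := e)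
          (.fam₂ xs' ys (s + 1) z' hs' hs (by omega))
        rwa [Monomial.eval, ← opMap_eq_opL, ← opMap_eq_opL, ← low_append] at h1

end Step

theorem IsCurrent.filt_le (h : IsCurrent k ι e) (d : ℕ) :
    filt k ι e d ≤ orderedSpan k ι e := by
  induction d with
  | zero =>
    refine Submodule.span_le.2 (Set.singleton_subset_iff.2 ?_)
    exact Submodule.subset_span ⟨none, rfl⟩
  | succ d ih =>
    refine (h.filt_succ_le_wordSpan d).trans (sup_le ih (Submodule.span_le.2 ?_))
    rintro _ ⟨xs, l, b, hb, hl, rfl⟩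
    rcases hb.exists_list with ⟨s, l', rfl, _, rfl⟩ | ⟨l', rfl, _, rfl⟩
    · exact h.low_mem ih s xs l' hl
    · exact h.high_mem ih xs l' hl

/-- The ordered words together with `e` span an algebra generated by currents. -/
theorem IsCurrent.orderedSpan_eq_top (h : IsCurrent k ι e)
    (hgen : ∀ S : Submodule k C, (∀ y, ι y ∈ S) → e ∈ S → (∀ a ∈ S, del k a ∈ S) →
      (∀ n, ∀ a ∈ S, ∀ b ∈ S, nprod k n a b ∈ S) → S = ⊤) : orderedSpan k ι e = ⊤ :=
  top_unique ((h.iSup_filt hgen).ge.trans (iSup_le h.filt_le))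

end OrderedWords

end ConformalAlg

namespace ConformalAlg

/-! ### Spanning sets of the free commutative conformal algebra and of the envelope -/

/-- A quotient of a free associative conformal algebra is generated by the images of the
generators. -/
theorem FreeAssoc.quotient_generates {k : Type*} [Field k] {X : Type*} {N : X → X → ℕ}
    {R : Set (FreeAssoc k N)} (S : Submodule k (FreeAssoc k N ⧸ idealSpan k R))
    (hof : ∀ x, (idealSpan k R).mkQ (FreeAssoc.of k N x) ∈ S) (hdel : ∀ a ∈ S, del k a ∈ S)
    (hprod : ∀ n, ∀ a ∈ S, ∀ b ∈ S, nprod k n a b ∈ S) : S = ⊤ := by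
  rw [eq_top_iff]
  rintro a -
  obtain ⟨a, rfl⟩ := Submodule.mkQ_surjective _ a
  induction a using FreeAssoc.induction with
  | hof x => exact hof x
  | hzero => rw [map_zero]; exact S.zero_mem
  | hadd a b ha hb => rw [map_add]; exact S.add_mem ha hb
  | hsmul c a ha => rw [map_smul]; exact S.smul_mem c ha
  | hdel a ha => rw [(isHom_mkQ k R).map_del]; exact hdel _ ha
  | hprod n a b ha hb => rw [(isHom_mkQ k R).map_nprod]; exact hprod n _ ha _ hb

section

variable (k : Type*) [Field k] [CharZero k] (Y : Type*)

-- All commutators vanish here, so 0 serves as the central element.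
omit [CharZero k] in
theorem ComConf.isCurrent :
    IsCurrent k (ComConf.of k (fun _ _ : Y => 3)) (0 : ComConf k (fun _ _ : Y => 3)) := by
  have h : ∀ n (a b : ComConf k (fun _ _ : Y => 3)), ConformalAlg.comm k n a b = 0 :=
    fun n a b => sub_eq_zero.2 (IsComm.comm n a b)
  refine ⟨map_zero _, ComConf.of_local _, fun x y => ?_, fun x y => ?_, fun x y => h _ _ _⟩
  all_goals rw [h]; exact zero_mem _

theorem span_comConf [LinearOrder Y] :
    ⊤ ≤ Submodule.span k (Set.range fun w : Monomial Y =>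
      w.eval k (ComConf.of k (fun _ _ : Y => 3))) := by
  rw [← (ComConf.isCurrent k Y).orderedSpan_eq_top fun S hS _ hdel hprod =>
    FreeAssoc.quotient_generates S hS hdel hprod]
  refine Submodule.span_le.2 ?_
  rintro _ ⟨_ | w, rfl⟩
  · exact zero_mem _
  · exact Submodule.subset_span ⟨w, rfl⟩

end

namespace KacMoody

variable {k : Type*} [Field k] [CharZero k] {g : Type*} [LieRing g] [LieAlgebra k g]
  (form : LinearMap.BilinForm k g) {Y : Type*} (X₁ : Module.Basis Y k g)

omit [CharZero k] in
theorem isCurrent_env : IsCurrent k (Env₃.of form X₁) (Env₃.e form X₁) := by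
  obtain ⟨φ, hφ, hφX⟩ := Env.exists_lieHom (k := k) (X := gens form X₁) (fun _ _ => 3)
    (generates_gens X₁)
  have hy : ∀ y, φ (cur form (X₁ y)) = Env₃.of form X₁ y := fun y => hφX ⟨_, Or.inl ⟨y, rfl⟩⟩
  have he : φ (e form) = Env₃.e form X₁ := hφX ⟨_, Or.inr rfl⟩
  have hcomm : ∀ n x y, comm k n (Env₃.of form X₁ x) (Env₃.of form X₁ y) =
      φ (nprod k n (cur form (X₁ x)) (cur form (X₁ y))) := fun n x y => by
    rw [hφ.map_nprod, hy, hy]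
  have hcur : ∀ a, φ (cur form a) ∈ Submodule.span k (Set.range (Env₃.of form X₁)) := by
    intro a
    induction X₁.mem_span a using Submodule.span_induction with
    | zero =>
      have h := cur_smul (form := form) 0 (0 : g)
      rw [zero_smul, zero_smul] at h
      rw [h, map_zero]
      exact zero_mem _
    | add a b _ _ ha hb => rw [cur_add, map_add]; exact add_mem ha hb
    | smul c a _ ha => rw [cur_smul, map_smul]; exact Submodule.smul_mem _ c ha
    | mem a ha =>
      obtain ⟨y, rfl⟩ := ha
      exact Submodule.subset_span ⟨y, (hy y).symm⟩
  refine ⟨?_, fun x y => Env.of_local (fun _ _ => 3) _ _, fun x y => ?_, fun x y => ?_, fun x y => ?_⟩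
  · rw [← he, ← hφ.map_del, del_e, map_zero]
  · rw [hcomm, nprod_cur, if_pos rfl]
    exact hcur _
  · rw [hcomm, nprod_cur, if_neg one_ne_zero, if_pos rfl, map_smul, he]
    exact Submodule.smul_mem _ _ (Submodule.mem_span_singleton_self _)
  · rw [hcomm, nprod_cur, if_neg two_ne_zero, if_neg (by norm_num), map_zero]

theorem span_env [LinearOrder Y] :
    ⊤ ≤ Submodule.span k (Set.range fun o : Option (Monomial Y) =>
      o.elim (Env₃.e form X₁) fun w => w.eval k (Env₃.of form X₁)) := by
  refine ((isCurrent_env form X₁).orderedSpan_eq_top fun S hS he hdel hprod =>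
    FreeAssoc.quotient_generates S ?_ hdel hprod).ge
  rintro ⟨_, ⟨y, rfl⟩ | h⟩
  · exact hS y
  · obtain rfl := Set.mem_singleton_iff.1 h
    exact he

end KacMoody

end ConformalAlg

/-! ### The two bases -/

theorem mainTheorem3 (k : Type*) [Field k] [CharZero k] (Y : Type*) [LinearOrder Y] :
    (∃ B : Module.Basis (ConformalAlg.Monomial Y) k
        (ConformalAlg.ComConf k (fun _ _ : Y => 3)),
      ∀ w, B w = w.eval k (ConformalAlg.ComConf.of k (fun _ _ : Y => 3))) ∧
    ∀ (g : Type*) [LieRing g] [LieAlgebra k g] (form : LinearMap.BilinForm k g),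
      form.IsSymm → (∀ a b c : g, form ⁅a, b⁆ c = form a ⁅b, c⁆) →
      ∀ X₁ : Module.Basis Y k g,
        ∃ B : Module.Basis (Option (ConformalAlg.Monomial Y)) k
            (ConformalAlg.KacMoody.Env₃ form X₁),
          B none = ConformalAlg.KacMoody.Env₃.e form X₁ ∧
          ∀ w, B (some w) = w.eval k (ConformalAlg.KacMoody.Env₃.of form X₁) := by
  refine ⟨⟨Module.Basis.mk (ConformalAlg.linearIndependent_comConf k Y)
    (ConformalAlg.span_comConf k Y), fun w => Module.Basis.mk_apply _ _ w⟩, ?_⟩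
  intro g _ _ form hsymm hinv X₁
  exact ⟨Module.Basis.mk (ConformalAlg.linearIndependent_env form X₁ hsymm hinv)
    (ConformalAlg.KacMoody.span_env form X₁), Module.Basis.mk_apply _ _ none,
    fun w => Module.Basis.mk_apply _ _ (some w)⟩
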